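/- Let $m\ge 2$, let $\alpha_1=x$, $\alpha_2=y$ and $\alpha_i=x+c_iy$ for $3\le i\le m$, where the $c_i\in\mathbb C$ are nonzero and pairwise distinct, and let $H_i=\{\alpha_i=0\}\subset\mathbb C^2$. Put $\alpha=\prod_{i=1}^m\alpha_i$ and let $\beta=(\beta_1,\dots,\beta_m)\in\mathbb C^m$. Let $M_\alpha^\beta$ be the $D$-module on $\mathbb C^2$ which is the free $\mathbb C[x,y]_\alpha$-module of rank one on the generator $\alpha^\beta$, with $\partial(\alpha^\beta)=\sum_{i=1}^m\beta_i\frac{\partial(\alpha_i)}{\alpha_i}\alpha^\beta$ for $\partial=\partial_x,\partial_y$. Let $\pi\colon\tilde{\mathbb C}^2\to\mathbb C^2$ be the blow-up of the origin, $\tilde{\mathbb C}^2=\{((x,y),[W_0:W_1]) : xW_1=yW_0\}\subset\mathbb C^2\times\mathbb P^1$, let $E=\pi^{-1}(0)$ be the exceptional divisor and let $\tilde H_i$ be the proper transform of $H_i$, i.e. the Zariski closure of $\pi^{-1}(H_i)\setminus E$. Let $I=\{i : \beta_i\in\mathbb Z\}$, $k=|I|$ and $|\beta|=\sum_{i=1}^m\beta_i$.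 Consider the inverse image $\pi^*M_\alpha^\beta$, a quasi-coherent $D$-module on $\tilde{\mathbb C}^2$. It has finite length, and its decomposition factors (the irreducible subquotients of a composition series in the category of quasi-coherent $D$-modules, counted with multiplicity) are as follows. (i) If $|\beta|\in\mathbb Z$, then there is exactly one decomposition factor with support $\tilde{\mathbb C}^2$, exactly one with support $E$, and, for each $i\in I$, exactly one with support $\tilde H_i$ and exactly one with support $\tilde H_i\cap E$; these are all the decomposition factors, altogether $2(k+1)$. (ii) If $|\beta|\notin\mathbb Z$, then there is exactly one decomposition factor with support $\tilde{\mathbb C}^2$ and, for each $i\in I$, exactly one with support $\tilde H_i$; these are all the decomposition factors, altogether $k+1$. -/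

import Mathlib

open scoped TensorProduct LinearAlgebra.Projectivization

noncomputable section

/-! ### D-modules on smooth affine varieties -/

/-- A (left) D-module over the coordinate ring `R` of a smooth affine complex variety: an
`R`-module `M` on which the vector fields `Der_ℂ(R)` act, subject to the relations of the ring
of differential operators, which is generated by functions and vector fields:
`(f D) m = f (D m)`, `D (f m) = D(f) m + f (D m)` and `[D, D'] m = D (D' m) - D' (D m)`.
(Equivalently, `M` carries an integrable connection.) -/
class DMod (R M : Type*) [CommRing R] [Algebra ℂ R] [AddCommGroup M] [Module R M] where
  nabla : Derivation ℂ R R →ₗ[R] (M →+ M)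
  nabla_smul : ∀ (D : Derivation ℂ R R) (f : R) (m : M),
    nabla D (f • m) = D f • m + f • nabla D m
  nabla_lie : ∀ (D D' : Derivation ℂ R R) (m : M),
    nabla ⁅D, D'⁆ m = nabla D (nabla D' m) - nabla D' (nabla D m)

/-! ### Derivations of a localization -/

section Localization

variable {A : Type*} [CommRing A] [Algebra ℂ A] (S : Submonoid A)

/-- The unique extension of a derivation of `A` to the localization of `A` at `S`. -/
def extendDerivation (D : Derivation ℂ A A) :
    Derivation ℂ (Localization S) (Localization S) :=
  haveI := Algebra.FormallyEtale.of_isLocalization (Rₘ := Localization S) S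
  (((Algebra.linearMap A (Localization S) ∘ₗ
      D.liftKaehlerDifferential).liftBaseChange (Localization S)) ∘ₗ
    (KaehlerDifferential.tensorKaehlerEquivOfFormallyEtale ℂ A
      (Localization S)).symm.toLinearMap).compDer (KaehlerDifferential.D ℂ (Localization S))

theorem extendDerivation_algebraMap (D : Derivation ℂ A A) (a : A) :
    extendDerivation S D (algebraMap A (Localization S) a) =
      algebraMap A (Localization S) (D a) := by
  have := Algebra.FormallyEtale.of_isLocalization (Rₘ := Localization S) S
  simp [extendDerivation,
    KaehlerDifferential.tensorKaehlerEquivOfFormallyEtale_symm_D_algebraMap]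

variable {S} in
theorem localizationDerivation_ext {D D' : Derivation ℂ (Localization S) (Localization S)}
    (h : ∀ a : A, D (algebraMap A (Localization S) a) = D' (algebraMap A (Localization S) a)) :
    D = D' := by
  ext z
  obtain ⟨⟨a, s⟩, hz⟩ := IsLocalization.surj S z
  have hs : IsUnit (algebraMap A (Localization S) s) := IsLocalization.map_units _ s
  have h1 := D.leibniz z (algebraMap A (Localization S) s)
  have h2 := D'.leibniz z (algebraMap A (Localization S) s)
  simp only at hz
  rw [hz, h] at h1
  rw [hz] at h2
  rw [h1, h s] at h2
  have h3 := add_left_cancel h2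
  simp only [smul_eq_mul] at h3
  exact hs.mul_left_cancel h3

end Localization

/-! ### The module `M_α^β` -/

section Twisted

variable {A ι : Type*} [CommRing A] [Algebra ℂ A] [Fintype ι]

/-- The module `M_α^β`: the free rank one `A_α`-module on the generator `α^β`, where
`α = ∏ α_i`. The element `g : A_α` stands for `g α^β`. -/
@[nolint unusedArguments]
def Twisted (α : ι → A) (_β : ι → ℂ) : Type _ :=
  Localization.Away (∏ i, α i)

variable (α : ι → A) (β : ι → ℂ)

instance : AddCommGroup (Twisted α β) :=
  inferInstanceAs (AddCommGroup (Localization.Away (∏ i, α i)))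

instance : Module A (Twisted α β) :=
  inferInstanceAs (Module A (Localization.Away (∏ i, α i)))

/-- The logarithmic derivative `∑ β_i D(α_i) / α_i ∈ A_α` of `α^β`. -/
def logDer (D : Derivation ℂ A A) : Localization.Away (∏ i, α i) :=
  ∑ i, β i • (algebraMap A (Localization.Away (∏ i, α i)) (D (α i)) *
    Ring.inverse (algebraMap A (Localization.Away (∏ i, α i)) (α i)))

theorem isUnit_factor (i : ι) :
    IsUnit (algebraMap A (Localization.Away (∏ i, α i)) (α i)) := by
  have h := IsLocalization.Away.algebraMap_isUnit (S := Localization.Away (∏ i, α i)) (∏ i, α i)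
  rw [map_prod] at h
  exact isUnit_of_dvd_unit (Finset.dvd_prod_of_mem
    (fun i => algebraMap A (Localization.Away (∏ i, α i)) (α i)) (Finset.mem_univ i)) h

theorem extend_logDer (D D' : Derivation ℂ A A) :
    extendDerivation _ D (logDer α β D') - extendDerivation _ D' (logDer α β D) =
      logDer α β ⁅D, D'⁆ := by
  simp only [logDer, map_sum, ← Finset.sum_sub_distrib]
  refine Finset.sum_congr rfl fun i _ => ?_
  rw [Derivation.map_smul, Derivation.map_smul, ← smul_sub]
  congr 1
  have hi := isUnit_factor α i
  set u := algebraMap A (Localization.Away (∏ i, α i)) (α i) with hu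
  have hv : Ring.inverse u * u = 1 := Ring.inverse_mul_cancel _ hi
  rw [Derivation.leibniz, Derivation.leibniz, Derivation.leibniz_of_mul_eq_one _ hv,
    Derivation.leibniz_of_mul_eq_one _ hv, hu]
  simp only [extendDerivation_algebraMap, Derivation.commutator_apply, map_sub, smul_eq_mul]
  ring

theorem extendDerivation_lie (S : Submonoid A) (D D' : Derivation ℂ A A) :
    extendDerivation S ⁅D, D'⁆ = ⁅extendDerivation S D, extendDerivation S D'⁆ := by
  refine localizationDerivation_ext fun a => ?_
  simp [Derivation.commutator_apply, extendDerivation_algebraMap]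

theorem extendDerivation_add (S : Submonoid A) (D D' : Derivation ℂ A A) :
    extendDerivation S (D + D') = extendDerivation S D + extendDerivation S D' := by
  refine localizationDerivation_ext fun a => ?_
  simp [extendDerivation_algebraMap]

theorem extendDerivation_smul (S : Submonoid A) (f : A) (D : Derivation ℂ A A) :
    extendDerivation S (f • D) =
      algebraMap A (Localization S) f • extendDerivation S D := by
  refine localizationDerivation_ext fun a => ?_
  simp [extendDerivation_algebraMap, Algebra.smul_def]

/-- `D (g α^β) = (D(g) + g ∑ β_i D(α_i) / α_i) α^β`. -/
def twistedNabla (D : Derivation ℂ A A) :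
    Localization.Away (∏ i, α i) →+ Localization.Away (∏ i, α i) :=
  (extendDerivation (Submonoid.powers (∏ i, α i)) D).toLinearMap.toAddMonoidHom +
    AddMonoidHom.mulRight (logDer α β D)

theorem twistedNabla_apply (D : Derivation ℂ A A) (g : Localization.Away (∏ i, α i)) :
    twistedNabla α β D g =
      extendDerivation (Submonoid.powers (∏ i, α i)) D g + g * logDer α β D := rfl

/-- `twistedNabla` as a linear function of the vector field. -/
def twistedNablaHom :
    Derivation ℂ A A →ₗ[A] (Localization.Away (∏ i, α i) →+ Localization.Away (∏ i, α i)) where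
  toFun := twistedNabla α β
  map_add' D D' := by
    ext g
    have : logDer α β (D + D') = logDer α β D + logDer α β D' := by
      simp [logDer, add_mul, Finset.sum_add_distrib]
    rw [AddMonoidHom.add_apply, twistedNabla_apply, twistedNabla_apply, twistedNabla_apply,
      extendDerivation_add, this, Derivation.add_apply]
    ring
  map_smul' f D := by
    ext g
    have : logDer α β (f • D) =
        algebraMap A (Localization.Away (∏ i, α i)) f * logDer α β D := by
      simp [logDer, Finset.mul_sum, mul_assoc]
    change twistedNabla α β (f • D) g = f • twistedNabla α β D g
    rw [twistedNabla_apply, twistedNabla_apply,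
      extendDerivation_smul, this, Derivation.smul_apply, smul_eq_mul, Algebra.smul_def]
    ring

theorem twistedNabla_smul (D : Derivation ℂ A A) (f : A) (g : Localization.Away (∏ i, α i)) :
    twistedNabla α β D (f • g) = D f • g + f • twistedNabla α β D g := by
  rw [twistedNabla_apply, twistedNabla_apply]
  simp only [Algebra.smul_def, Derivation.leibniz, extendDerivation_algebraMap,
    Algebra.algebraMap_self, RingHom.id_apply]
  ring

theorem twistedNabla_lie (D D' : Derivation ℂ A A) (g : Localization.Away (∏ i, α i)) :
    twistedNabla α β ⁅D, D'⁆ g =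
      twistedNabla α β D (twistedNabla α β D' g) - twistedNabla α β D' (twistedNabla α β D g) := by
  simp only [twistedNabla_apply]
  rw [extendDerivation_lie, ← extend_logDer]
  simp only [Derivation.commutator_apply, map_add, Derivation.leibniz, smul_eq_mul]
  ring

/-- The D-module structure on `M_α^β`. -/
instance : DMod A (Twisted α β) where
  nabla := twistedNablaHom α β
  nabla_smul := twistedNabla_smul α β
  nabla_lie := twistedNabla_lie α β

end Twisted

/-! ### Inverse images of D-modules on affine space -/

section InverseImage

open MvPolynomial

variable {σ B M : Type*} [Fintype σ] [CommRing B] [Algebra ℂ B]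
  [Algebra (MvPolynomial σ ℂ) B] [IsScalarTower ℂ (MvPolynomial σ ℂ) B]
  [AddCommGroup M] [Module (MvPolynomial σ ℂ) M] [DMod (MvPolynomial σ ℂ) M]

/-- The chain rule. -/
theorem derivation_chain_rule (D : Derivation ℂ B B) (p : MvPolynomial σ ℂ) :
    D (algebraMap (MvPolynomial σ ℂ) B p) =
      ∑ j, pderiv j p • D (algebraMap (MvPolynomial σ ℂ) B (X j)) := by
  classical
  induction p using MvPolynomial.induction_on with
  | C a =>
    have : algebraMap (MvPolynomial σ ℂ) B (C a) = algebraMap ℂ B a :=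
      (IsScalarTower.algebraMap_apply ℂ (MvPolynomial σ ℂ) B a).symm
    rw [this]
    simp
  | add p q hp hq => simp [hp, hq, add_smul, Finset.sum_add_distrib]
  | mul_X p i hp =>
    rw [map_mul, Derivation.leibniz, hp]
    simp only [Derivation.leibniz, pderiv_X, add_smul, Finset.sum_add_distrib, smul_eq_mul,
      Finset.mul_sum, Pi.single_apply]
    simp [Algebra.smul_def, apply_ite, mul_comm, mul_left_comm]

/-- The action of a vector field on the inverse image `B ⊗ M` of a D-module `M` on affine space:
`D (b ⊗ m) = D(b) ⊗ m + ∑_j b D(φ^* x_j) ⊗ ∂_j m`. -/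
def inverseImageNabla (D : Derivation ℂ B B) :
    B ⊗[MvPolynomial σ ℂ] M →+ B ⊗[MvPolynomial σ ℂ] M :=
  TensorProduct.liftAddHom
    { toFun := fun b =>
        { toFun := fun m => D b ⊗ₜ m + ∑ j, (b * D (algebraMap (MvPolynomial σ ℂ) B (X j))) ⊗ₜ
            DMod.nabla (pderiv (R := ℂ) j) m
          map_zero' := by simp
          map_add' := fun m m' => by
            simp only [map_add, TensorProduct.tmul_add, Finset.sum_add_distrib]
            abel }
      map_zero' := by ext m; simp
      map_add' := fun b b' => by
        ext m
        simp only [map_add, add_mul, TensorProduct.add_tmul, Finset.sum_add_distrib,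
          AddMonoidHom.coe_mk, ZeroHom.coe_mk, AddMonoidHom.add_apply]
        abel }
    (fun p b m => by
      have h : D (p • b) = p • D b +
          ∑ j, pderiv j p • (b * D (algebraMap (MvPolynomial σ ℂ) B (X j))) := by
        rw [Algebra.smul_def, Derivation.leibniz, derivation_chain_rule, Finset.smul_sum,
          algebraMap_smul]
        simp only [smul_eq_mul, mul_smul_comm]
      simp only [AddMonoidHom.coe_mk, ZeroHom.coe_mk, DMod.nabla_smul, TensorProduct.tmul_add,
        Finset.sum_add_distrib, h, smul_mul_assoc, TensorProduct.add_tmul, TensorProduct.sum_tmul,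
        TensorProduct.tmul_smul, TensorProduct.smul_tmul']
      abel)

theorem inverseImageNabla_tmul (D : Derivation ℂ B B) (b : B) (m : M) :
    inverseImageNabla D (b ⊗ₜ[MvPolynomial σ ℂ] m) =
      D b ⊗ₜ m + ∑ j, (b * D (algebraMap (MvPolynomial σ ℂ) B (X j))) ⊗ₜ
        DMod.nabla (pderiv (R := ℂ) j) m := rfl

theorem nabla_pderiv_comm (i j : σ) (m : M) :
    DMod.nabla (pderiv (R := ℂ) i) (DMod.nabla (pderiv (R := ℂ) j) m) =
      DMod.nabla (pderiv (R := ℂ) j) (DMod.nabla (pderiv (R := ℂ) i) m) := by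
  classical
  have h : ⁅pderiv (R := ℂ) i, pderiv (R := ℂ) j⁆ = 0 := by
    refine derivation_ext fun k => ?_
    simp only [Derivation.commutator_apply, pderiv_X, Pi.single_apply]
    split_ifs <;> simp
  have h' := DMod.nabla_lie (pderiv (R := ℂ) i) (pderiv (R := ℂ) j) m
  rw [h, map_zero, AddMonoidHom.zero_apply] at h'
  exact (sub_eq_zero.mp h'.symm)

/-- The D-module inverse image `B ⊗ M` of a D-module `M` on affine space along the morphism
given by the ring map `ℂ[x_j] → B`. -/
instance : DMod B (B ⊗[MvPolynomial σ ℂ] M) where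
  nabla :=
    { toFun := inverseImageNabla
      map_add' := fun D D' => by
        ext z
        induction z with
        | zero => simp
        | add z w hz hw => rw [map_add, map_add, hz, hw]
        | tmul b m =>
          simp only [AddMonoidHom.add_apply, inverseImageNabla_tmul, Derivation.add_apply, mul_add,
            TensorProduct.add_tmul, Finset.sum_add_distrib]
          abel
      map_smul' := fun f D => by
        ext z
        change inverseImageNabla (f • D) z = f • inverseImageNabla D z
        induction z with
        | zero => simp
        | add z w hz hw => rw [map_add, map_add, hz, hw, smul_add]
        | tmul b m =>
          simp only [inverseImageNabla_tmul, Derivation.smul_apply, smul_add, Finset.smul_sum,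
            TensorProduct.smul_tmul', mul_smul_comm] }
  nabla_smul D f z := by
    change inverseImageNabla D (f • z) = D f • z + f • inverseImageNabla D z
    induction z with
    | zero => simp
    | add z w hz hw =>
      rw [smul_add, map_add, hz, hw, map_add, smul_add, smul_add]
      abel
    | tmul b m =>
      simp only [inverseImageNabla_tmul, TensorProduct.smul_tmul', Derivation.leibniz, smul_add,
        Finset.smul_sum, smul_eq_mul, TensorProduct.add_tmul, mul_assoc, mul_comm b]
      abel
  nabla_lie D D' z := by
    change inverseImageNabla ⁅D, D'⁆ z =
      inverseImageNabla D (inverseImageNabla D' z) - inverseImageNabla D' (inverseImageNabla D z)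
    induction z with
    | zero => simp
    | add z w hz hw =>
      simp only [map_add, hz, hw]
      abel
    | tmul b m =>
      have h : ∑ j, ∑ i, (b * D (algebraMap (MvPolynomial σ ℂ) B (X j)) *
            D' (algebraMap (MvPolynomial σ ℂ) B (X i))) ⊗ₜ[MvPolynomial σ ℂ]
              DMod.nabla (pderiv (R := ℂ) i) (DMod.nabla (pderiv (R := ℂ) j) m) =
          ∑ j, ∑ i, (b * D' (algebraMap (MvPolynomial σ ℂ) B (X j)) *
            D (algebraMap (MvPolynomial σ ℂ) B (X i))) ⊗ₜ[MvPolynomial σ ℂ]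
              DMod.nabla (pderiv (R := ℂ) i) (DMod.nabla (pderiv (R := ℂ) j) m) := by
        rw [Finset.sum_comm]
        refine Finset.sum_congr rfl fun i _ => Finset.sum_congr rfl fun j _ => ?_
        rw [nabla_pderiv_comm]
        congr 1
        ring
      simp only [inverseImageNabla_tmul, map_add, map_sum, Derivation.commutator_apply,
        Derivation.leibniz, smul_eq_mul, TensorProduct.add_tmul, TensorProduct.sub_tmul,
        Finset.sum_add_distrib, mul_sub, Finset.sum_sub_distrib, h]
      simp only [mul_comm (D' _) (D b), mul_comm (D' b)]
      abel

end InverseImage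

/-! ### The blow-up of the plane at the origin -/

section Blowup

open MvPolynomial

/-- The coordinate ring `ℂ[x, y]` of the plane. -/
abbrev PlaneRing : Type := MvPolynomial (Fin 2) ℂ

/-- The blow-up `{((x, y), [W₀ : W₁]) | x W₁ = y W₀}` of the plane at the origin. -/
def Blowup : Type :=
  {p : (Fin 2 → ℂ) × ℙ ℂ (Fin 2 → ℂ) // p.1 0 * p.2.rep 1 = p.1 1 * p.2.rep 0}

/-- The blow-down map `π`. -/
def Blowup.down (p : Blowup) : Fin 2 → ℂ := p.1.1

/-- The two affine charts: `one` is `W₀ ≠ 0` with coordinates `x, w₁ = W₁ / W₀`, and `two` is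
`W₁ ≠ 0` with coordinates `y, w₀ = W₀ / W₁`. -/
inductive Chart
  | one
  | two

/-- The functions `π^* x`, `π^* y` in the coordinates of a chart: `(x, x w₁)`, resp.
`(y w₀, y)`. -/
def pullCoord : Chart → Fin 2 → MvPolynomial (Fin 2) ℂ
  | .one => ![X 0, X 0 * X 1]
  | .two => ![X 0 * X 1, X 0]

/-- The homogeneous coordinates `(W₀, W₁)` on a chart: `(1, w₁)`, resp. `(w₀, 1)`. -/
def homCoord : Chart → (Fin 2 → ℂ) → Fin 2 → ℂ
  | .one, a => ![1, a 1]
  | .two, a => ![a 1, 1]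

theorem homCoord_ne_zero (i : Chart) (a : Fin 2 → ℂ) : homCoord i a ≠ 0 := by
  intro h
  cases i
  · simpa [homCoord] using congrFun h 0
  · simpa [homCoord] using congrFun h 1

/-- The point of the blow-up with coordinates `a` in the chart `i`. -/
def chartPoint (i : Chart) (a : Fin 2 → ℂ) : Blowup :=
  ⟨(fun j => eval a (pullCoord i j), Projectivization.mk ℂ (homCoord i a) (homCoord_ne_zero i a)),
    by
      obtain ⟨u, hu⟩ :=
        Projectivization.exists_smul_eq_mk_rep ℂ (homCoord i a) (homCoord_ne_zero i a)
      rw [← hu]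
      cases i <;> simp [homCoord, pullCoord, Units.smul_def] <;> ring⟩

/-- A subset of the blow-up is Zariski closed if it is an algebraic set in both charts. -/
def IsZariskiClosed (Z : Set Blowup) : Prop :=
  ∀ i : Chart, ∃ S : Set (MvPolynomial (Fin 2) ℂ), ∀ a : Fin 2 → ℂ,
    chartPoint i a ∈ Z ↔ ∀ f ∈ S, eval a f = 0

/-- Zariski closure in the blow-up. -/
def zariskiClosure (S : Set Blowup) : Set Blowup :=
  ⋂₀ {Z | IsZariskiClosed Z ∧ S ⊆ Z}

/-- The exceptional divisor `E = π⁻¹(0)`. -/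
def excDivisor : Set Blowup :=
  {p | p.down = 0}

/-- The proper transform of the plane curve `f = 0`: the closure of its inverse image
outside `E`. -/
def properTransform (f : PlaneRing) : Set Blowup :=
  zariskiClosure {p | eval p.down f = 0 ∧ p ∉ excDivisor}

/-- The coordinate ring of the chart `i`. As a `ℂ`-algebra it is a polynomial ring in two
variables; its structure as a `ℂ[x, y]`-algebra is given by `π`. -/
def ChartRing (_i : Chart) : Type := MvPolynomial (Fin 2) ℂ

variable (i : Chart)

instance : CommRing (ChartRing i) := inferInstanceAs (CommRing (MvPolynomial (Fin 2) ℂ))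

instance : Algebra ℂ (ChartRing i) := inferInstanceAs (Algebra ℂ (MvPolynomial (Fin 2) ℂ))

/-- Restriction of functions along `π` to the chart `i`. -/
def pullHom : PlaneRing →ₐ[ℂ] ChartRing i :=
  (aeval (pullCoord i) : PlaneRing →ₐ[ℂ] MvPolynomial (Fin 2) ℂ)

instance : Algebra PlaneRing (ChartRing i) := (pullHom i).toRingHom.toAlgebra

instance : IsScalarTower ℂ PlaneRing (ChartRing i) :=
  IsScalarTower.of_algebraMap_eq fun r => ((pullHom i).commutes r).symm

/-- The coordinate ring `ℂ[x, w₁, w₁⁻¹]` of the intersection of the two charts. -/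
def OverlapRing : Type := Localization.Away (X 1 : MvPolynomial (Fin 2) ℂ)

instance : CommRing OverlapRing :=
  inferInstanceAs (CommRing (Localization.Away (X 1 : MvPolynomial (Fin 2) ℂ)))

instance : Algebra ℂ OverlapRing :=
  inferInstanceAs (Algebra ℂ (Localization.Away (X 1 : MvPolynomial (Fin 2) ℂ)))

/-- Restriction of functions from a chart to the intersection of the charts: the localization
map on the first chart, and `y ↦ x w₁`, `w₀ ↦ w₁⁻¹` on the second. -/
def restrictHom : (i : Chart) → ChartRing i →ₐ[ℂ] OverlapRing
  | .one => IsScalarTower.toAlgHom ℂ (MvPolynomial (Fin 2) ℂ)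
      (Localization.Away (X 1 : MvPolynomial (Fin 2) ℂ))
  | .two => (aeval ![algebraMap (MvPolynomial (Fin 2) ℂ)
        (Localization.Away (X 1 : MvPolynomial (Fin 2) ℂ)) (X 0 * X 1),
      IsLocalization.Away.invSelf (X 1 : MvPolynomial (Fin 2) ℂ)] :
      MvPolynomial (Fin 2) ℂ →ₐ[ℂ] Localization.Away (X 1 : MvPolynomial (Fin 2) ℂ))

instance : Algebra (ChartRing i) OverlapRing := (restrictHom i).toRingHom.toAlgebra

instance : IsScalarTower ℂ (ChartRing i) OverlapRing :=
  IsScalarTower.of_algebraMap_eq fun r => ((restrictHom i).commutes r).symm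

instance : Algebra PlaneRing OverlapRing :=
  ((restrictHom .one).comp (pullHom .one)).toRingHom.toAlgebra

instance : IsScalarTower ℂ PlaneRing OverlapRing :=
  IsScalarTower.of_algebraMap_eq fun r =>
    (((restrictHom .one).comp (pullHom .one)).commutes r).symm

theorem restrict_pull (f : PlaneRing) :
    restrictHom i (pullHom i f) = algebraMap PlaneRing OverlapRing f := by
  cases i
  · rfl
  · have h : (restrictHom .two).comp (pullHom .two) = (restrictHom .one).comp (pullHom .one) := by
      refine MvPolynomial.algHom_ext fun j => ?_
      have hinv := IsLocalization.Away.mul_invSelf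
        (S := Localization.Away (X 1 : MvPolynomial (Fin 2) ℂ)) (X 1 : MvPolynomial (Fin 2) ℂ)
      change (aeval _ (aeval (pullCoord .two) (X j)) :
          Localization.Away (X 1 : MvPolynomial (Fin 2) ℂ)) =
        algebraMap (MvPolynomial (Fin 2) ℂ) (Localization.Away (X 1 : MvPolynomial (Fin 2) ℂ))
          (aeval (pullCoord .one) (X j))
      fin_cases j
      · simp [pullCoord, mul_assoc, hinv]
      · simp [pullCoord]
    exact DFunLike.congr_fun h f

instance : IsScalarTower PlaneRing (ChartRing i) OverlapRing :=
  IsScalarTower.of_algebraMap_eq fun f => (restrict_pull i f).symm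

/-! ### D-modules on the blow-up -/

/-- A (quasi-coherent) D-module on the blow-up, given by its sections over the two affine charts
and over their affine intersection, with the restriction maps. -/
structure BlowupDMod where
  sec : Chart → Type
  overlap : Type
  [secGroup : ∀ i, AddCommGroup (sec i)]
  [secModule : ∀ i, Module (ChartRing i) (sec i)]
  [secDMod : ∀ i, DMod (ChartRing i) (sec i)]
  [ovGroup : AddCommGroup overlap]
  [ovModule : Module OverlapRing overlap]
  [ovDMod : DMod OverlapRing overlap]
  [ovChartModule : ∀ i, Module (ChartRing i) overlap]
  [ovTower : ∀ i, IsScalarTower (ChartRing i) OverlapRing overlap]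
  res : ∀ i, sec i →ₗ[ChartRing i] overlap
  /-- Quasi-coherence: the sections over the intersection are obtained from those over each chart
  by extension of scalars. -/
  res_isBaseChange : ∀ i, IsBaseChange OverlapRing (res i)
  /-- Restriction is compatible with the action of vector fields. -/
  res_nabla : ∀ (i : Chart) (D : Derivation ℂ (ChartRing i) (ChartRing i))
    (D' : Derivation ℂ OverlapRing OverlapRing),
    (∀ f, D' (algebraMap (ChartRing i) OverlapRing f) =
      algebraMap (ChartRing i) OverlapRing (D f)) →
    ∀ m, res i (DMod.nabla D m) = DMod.nabla D' (res i m)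

attribute [instance] BlowupDMod.secGroup BlowupDMod.secModule BlowupDMod.secDMod
  BlowupDMod.ovGroup BlowupDMod.ovModule BlowupDMod.ovDMod BlowupDMod.ovChartModule
  BlowupDMod.ovTower

/-- A (quasi-coherent) sub-D-module: a submodule of the sections over each chart, stable under
vector fields, such that both generate the same sections over the intersection. -/
@[ext]
structure SubDMod (F : BlowupDMod) where
  sub : ∀ i, Submodule (ChartRing i) (F.sec i)
  nabla_mem : ∀ i (D : Derivation ℂ (ChartRing i) (ChartRing i)) (m : F.sec i),
    m ∈ sub i → DMod.nabla D m ∈ sub i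
  glue : Submodule.span OverlapRing (F.res .one '' (sub .one : Set (F.sec .one))) =
    Submodule.span OverlapRing (F.res .two '' (sub .two : Set (F.sec .two)))

variable {F : BlowupDMod}

instance : PartialOrder (SubDMod F) :=
  PartialOrder.lift SubDMod.sub fun _ _ h => SubDMod.ext h

theorem span_res_univ (i : Chart) :
    Submodule.span OverlapRing (F.res i '' (Set.univ : Set (F.sec i))) = ⊤ := by
  refine eq_top_iff.mpr fun z _ => ?_
  induction z using (F.res_isBaseChange i).inductionOn with
  | zero => exact zero_mem _
  | tmul m => exact Submodule.subset_span ⟨m, trivial, rfl⟩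
  | smul s n hn => exact Submodule.smul_mem _ _ (hn trivial)
  | add n n' hn hn' => exact add_mem (hn trivial) (hn' trivial)

/-- The zero sub-D-module is the least, and the whole D-module the greatest, sub-D-module. -/
instance : BoundedOrder (SubDMod F) where
  bot :=
    { sub := fun _ => ⊥
      nabla_mem := by simp
      glue := by simp }
  bot_le N i := bot_le
  top :=
    { sub := fun _ => ⊤
      nabla_mem := by simp
      glue := by simp only [Submodule.top_coe, span_res_univ] }
  le_top N i := le_top

/-- The support of the subquotient `N' / N`: the set of points of the blow-up at which its stalk,
i.e. the localization of `N' / N` on a chart at the maximal ideal of the point, is not zero. -/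
def subquotientSupport (N N' : SubDMod F) : Set Blowup :=
  {p | ∃ (i : Chart) (a : Fin 2 → ℂ), chartPoint i a = p ∧
    (⟨RingHom.ker (eval a), RingHom.ker_isPrime (eval a)⟩ : PrimeSpectrum (ChartRing i)) ∈
      Module.support (ChartRing i) (N'.sub i ⧸ (N.sub i).submoduleOf (N'.sub i))}

variable (F) in
/-- A composition series `0 = N_0 ⊂ N_1 ⊂ ⋯ ⊂ N_l = F` of `F`: no sub-D-module lies strictly
between `N_j ⊂ N_{j+1}`, that is, the decomposition factors `N_{j+1} / N_j` are irreducible. -/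
structure DecompositionSeries where
  length : ℕ
  term : Fin (length + 1) → SubDMod F
  covBy : ∀ j : Fin length, term j.castSucc ⋖ term j.succ
  first : term 0 = ⊥
  last : term (Fin.last length) = ⊤

/-- The support of the `j`-th decomposition factor. -/
def DecompositionSeries.supp (s : DecompositionSeries F) (j : Fin s.length) : Set Blowup :=
  subquotientSupport (s.term j.castSucc) (s.term j.succ)

section Pullback

variable (M : Type) [AddCommGroup M] [Module PlaneRing M] [DMod PlaneRing M]

/-- The inverse image `π^* M` of a D-module `M` on the plane: over an affine open set with
coordinate ring `B` its sections are `B ⊗ M`. -/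
def blowupPullback : BlowupDMod where
  sec i := ChartRing i ⊗[PlaneRing] M
  overlap := OverlapRing ⊗[PlaneRing] M
  res i := TensorProduct.AlgebraTensorModule.map
    (Algebra.linearMap (ChartRing i) OverlapRing) (LinearMap.id : M →ₗ[PlaneRing] M)
  res_isBaseChange i := by
    refine IsBaseChange.of_comp (TensorProduct.isBaseChange PlaneRing M (ChartRing i)) ?_
    have h : (TensorProduct.AlgebraTensorModule.map (Algebra.linearMap (ChartRing i) OverlapRing)
        (LinearMap.id : M →ₗ[PlaneRing] M)).restrictScalars PlaneRing ∘ₗ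
          TensorProduct.mk PlaneRing (ChartRing i) M 1 =
        TensorProduct.mk PlaneRing OverlapRing M 1 := by
      ext m
      simp
    exact h ▸ TensorProduct.isBaseChange PlaneRing M OverlapRing
  res_nabla i D D' h m := by
    change TensorProduct.AlgebraTensorModule.map
        (Algebra.linearMap (ChartRing i) OverlapRing) (LinearMap.id : M →ₗ[PlaneRing] M)
          (inverseImageNabla D m) =
      inverseImageNabla D' (TensorProduct.AlgebraTensorModule.map
        (Algebra.linearMap (ChartRing i) OverlapRing) (LinearMap.id : M →ₗ[PlaneRing] M) m)
    induction m with
    | zero => simp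
    | add z w hz hw => simp only [map_add, hz, hw]
    | tmul b m =>
      simp only [inverseImageNabla_tmul, map_add, map_sum,
        TensorProduct.AlgebraTensorModule.map_tmul, Algebra.linearMap_apply, LinearMap.id_apply,
        map_mul, h]
      congr 1
      refine Finset.sum_congr rfl fun j _ => ?_
      rw [IsScalarTower.algebraMap_apply PlaneRing (ChartRing i) OverlapRing, h]

end Pullback

/-! ### The line configuration -/

/-- The linear forms `x`, `y`, `x + c_i y`. -/
def lineForms {n : ℕ} (c : Fin n → ℂ) : Fin (n + 2) → PlaneRing :=
  Fin.cons (X 0) (Fin.cons (X 1) fun i => X 0 + C (c i) * X 1)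

end Blowup

end

/-! On a chart with coordinates `u, w`, where `u = 0` is the exceptional divisor `E`, each `α_i`
pulls back to `u * l_i` with `l_i = a_i + b_i w` an equation of the proper transform of `H_i`. So
`α^β` becomes `u^|β| ∏ l_i^β_i`, and the inverse image is realized as all rational functions with
poles along `E` and the lines, with the corresponding logarithmic connection
(`LineConfig.pullbackModel`). Multiplying the generator by integral powers of `u` and of the `l_i`
removes the integral exponents. There remain an exponent `γ` along `E`, which is `0` or not an
integer, and non-integral exponents along the lines in `T`, the complement of `I`.

The operator `u (∂_u + γ/u)` multiplies `u^j q(w)` by `j + γ`, so a sub-D-module contains the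
homogeneous components of its elements (`PlaneEmbedding.IsStable.component_mem`). Let `C_j` be the
set of those `q` for which `u^j q` lies in it. Multiplication by `u` gives `C_j ≤ C_(j+1)`, and
`∂_u` gives the converse unless `j + 1 + γ = 0`. For `γ` not an integer all `C_j` coincide; for `γ =
0` there are two independent blocks, `j < 0` and `j ≥ 0`.

Each `C_j` is a D-module in the variable `w`. There the chain from `0` to the fractions with poles
along `T`, followed by admitting poles along the remaining lines one at a time, has irreducible
factors (`LineConfig.IsStable.eq_fractions`, `LineConfig.IsStable.eq_fractions_insert`). A block
therefore contributes one factor not confined to any line and one for each line outside `T`. In the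
block `j < 0` every element of the factor is killed by a power of `u`, which confines the support to
`E`.

These steps glue, because a change of chart multiplies `u`, the `l_i` and the generator by powers of
`w`. They stay irreducible on the blow-up (`BlowupModel.IsStep.covBy`), with the expected supports
(`BlowupModel.IsStep.support`). This gives one composition series. Sub-D-modules form a modular
lattice, so a Jordan–Hölder theorem that records supports (`HasFactors.unique`) carries the result
to every other series; the supports being pairwise distinct, multiplicities are read off. -/

noncomputable section

/-! ### Jordan–Hölder for labelled covering relations -/

section JordanHoelder

variable {X L : Type*} [PartialOrder X] (supp : X → X → L)

/-- There is a maximal chain from `a` to `b` whose covering steps have labels `m`. -/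
inductive HasFactors : X → X → Multiset L → Prop
  | nil (a : X) : HasFactors a a 0
  | cons {a c b : X} {m : Multiset L} (h : a ⋖ c) (hm : HasFactors c b m) :
      HasFactors a b (supp a c ::ₘ m)

/-- Two distinct covers of an element have a join, which covers both of them, with the labels of
opposite sides of the resulting square equal. -/
def DiamondProperty : Prop :=
  ∀ a c c' : X, a ⋖ c → a ⋖ c' → c ≠ c' →
    ∃ d, c ⋖ d ∧ c' ⋖ d ∧ (∀ b, c ≤ b → c' ≤ b → d ≤ b) ∧ supp c d = supp a c' ∧
      supp c' d = supp a c

variable {supp}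

theorem HasFactors.le {a b : X} {m : Multiset L} (h : HasFactors supp a b m) : a ≤ b := by
  induction h with
  | nil a => exact le_rfl
  | cons h _ ih => exact h.le.trans ih

theorem HasFactors.trans {a b c : X} {m m' : Multiset L} (h : HasFactors supp a b m)
    (h' : HasFactors supp b c m') : HasFactors supp a c (m + m') := by
  induction h with
  | nil a => simpa using h'
  | cons h _ ih => rw [Multiset.cons_add]; exact .cons h (ih h')

theorem HasFactors.single {a b : X} (h : a ⋖ b) : HasFactors supp a b {supp a b} :=
  .cons h (.nil b)

theorem HasFactors.snoc {a b c : X} {m : Multiset L} (h : HasFactors supp a b m) (h' : b ⋖ c) :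
    HasFactors supp a c (supp b c ::ₘ m) := by
  rw [← Multiset.singleton_add, add_comm]
  exact h.trans (.single h')

/-- The exchange step of Jordan–Hölder. If the chain starts with `e ≠ c`, the diamond over `e` and
`c` has its top `d` below `b`. By induction the chain from `e` may be taken to pass through `d`, and
then `e` is replaced by `c`, which only swaps the first two labels. -/
theorem HasFactors.exists_of_covBy (hX : DiamondProperty supp) {a b c : X} {m : Multiset L}
    (h : HasFactors supp a b m) (hac : a ⋖ c) (hcb : c ≤ b) :
    ∃ p, HasFactors supp c b p ∧ m = supp a c ::ₘ p := by
  induction h generalizing c with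
  | nil a => exact absurd hac.lt hcb.not_gt
  | @cons a e b m h hm ih =>
    by_cases hec : e = c
    · subst hec
      exact ⟨m, hm, rfl⟩
    · obtain ⟨d, hed, hcd, hd, h1, h2⟩ := hX a e c h hac hec
      obtain ⟨p, hp, rfl⟩ := ih hed (hd b hm.le hcb)
      refine ⟨_, .cons hcd hp, ?_⟩
      rw [h1, h2, Multiset.cons_swap]

/-- The Jordan–Hölder theorem. -/
theorem HasFactors.unique (hX : DiamondProperty supp) {a b : X} {m m' : Multiset L}
    (h : HasFactors supp a b m) (h' : HasFactors supp a b m') : m = m' := by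
  induction h' generalizing m with
  | nil a =>
    cases h with
    | nil => rfl
    | cons h hm => exact absurd h.lt hm.le.not_gt
  | cons h' hm' ih =>
    obtain ⟨p, hp, rfl⟩ := h.exists_of_covBy hX h' hm'.le
    rw [ih hp]

theorem HasFactors.of_chain {l : ℕ} (t : Fin (l + 1) → X)
    (ht : ∀ j : Fin l, t j.castSucc ⋖ t j.succ) :
    HasFactors supp (t 0) (t (Fin.last l))
      (Finset.univ.val.map fun j : Fin l => supp (t j.castSucc) (t j.succ)) := by
  induction l with
  | zero => simpa using HasFactors.nil (supp := supp) (t 0)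
  | succ l ih =>
    have := HasFactors.cons (supp := supp) (ht 0) (ih (fun j => t j.succ) fun j => ht j.succ)
    rw [Fin.univ_succ]
    simpa [Function.comp_def] using this

theorem HasFactors.exists_chain {a b : X} {m : Multiset L} (h : HasFactors supp a b m) :
    ∃ (l : ℕ) (t : Fin (l + 1) → X), (∀ j : Fin l, t j.castSucc ⋖ t j.succ) ∧ t 0 = a ∧
      t (Fin.last l) = b := by
  induction h with
  | nil a => exact ⟨0, fun _ => a, fun j => j.elim0, rfl, rfl⟩
  | @cons a c b m h hm ih =>
    obtain ⟨l, t, ht, h0, h1⟩ := ih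
    refine ⟨l + 1, Fin.cons a t, fun j => ?_, rfl, ?_⟩
    · induction j using Fin.cases with
      | zero => simpa [h0] using h
      | succ j => simpa [← Fin.succ_castSucc] using ht j
    · rw [← Fin.succ_last, Fin.cons_succ, h1]

end JordanHoelder

/-! ### The charts and their intersection -/

section Overlap

open MvPolynomial

/-- The coordinates on a chart. -/
def chartCoord (i : Chart) (j : Fin 2) : ChartRing i := (X j : MvPolynomial (Fin 2) ℂ)

/-- The coordinate ring of a chart as a polynomial ring. -/
def chartPoly (i : Chart) : MvPolynomial (Fin 2) ℂ ≃ₐ[ℂ] ChartRing i :=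
  (AlgEquiv.refl : MvPolynomial (Fin 2) ℂ ≃ₐ[ℂ] MvPolynomial (Fin 2) ℂ)

theorem chartPoly_X (i : Chart) (j : Fin 2) : chartPoly i (X j) = chartCoord i j := rfl

instance (i : Chart) : IsDomain (ChartRing i) :=
  inferInstanceAs (IsDomain (MvPolynomial (Fin 2) ℂ))

theorem chartCoord_ne_zero (i : Chart) (j : Fin 2) : chartCoord i j ≠ 0 :=
  X_ne_zero (R := ℂ) j

instance isLocalization_restrict_one :
    IsLocalization.Away (chartCoord .one 1) OverlapRing where
  map_units y := by
    have h := IsLocalization.map_units (Localization.Away (X 1 : MvPolynomial (Fin 2) ℂ))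
      (M := Submonoid.powers (X 1 : MvPolynomial (Fin 2) ℂ)) y
    exact h
  surj z := by
    have h := IsLocalization.surj (S := Localization.Away (X 1 : MvPolynomial (Fin 2) ℂ))
      (Submonoid.powers (X 1 : MvPolynomial (Fin 2) ℂ)) z
    exact h
  exists_of_eq {a b} h := by
    have h := (IsLocalization.eq_iff_exists (x := a) (y := b)
      (Submonoid.powers (X 1 : MvPolynomial (Fin 2) ℂ))
      (Localization.Away (X 1 : MvPolynomial (Fin 2) ℂ))).mp h
    exact h

theorem restrictHom_coord_one_mul :
    restrictHom .one (chartCoord .one 1) * restrictHom .two (chartCoord .two 1) = 1 := by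
  have h : restrictHom .two (chartCoord .two 1) =
      IsLocalization.Away.invSelf (S := Localization.Away (X 1 : MvPolynomial (Fin 2) ℂ))
        (X 1 : MvPolynomial (Fin 2) ℂ) :=
    (MvPolynomial.aeval_X _ _).trans rfl
  rw [h]
  exact IsLocalization.Away.mul_invSelf (S := Localization.Away (X 1 : MvPolynomial (Fin 2) ℂ))
    (X 1 : MvPolynomial (Fin 2) ℂ)

theorem restrictHom_coord_two_zero :
    restrictHom .two (chartCoord .two 0) =
      restrictHom .one (chartCoord .one 0) * restrictHom .one (chartCoord .one 1) := by
  rw [← map_mul]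
  exact (MvPolynomial.aeval_X _ _).trans rfl

/-- The change of coordinates `x ↦ x w₁`, `w₁ ↦ w₁⁻¹` on the intersection of the charts. -/
def overlapSwap : OverlapRing →+* OverlapRing :=
  IsLocalization.Away.lift (chartCoord .one 1)
    (g := ((restrictHom .two).comp
      ((chartPoly .two).toAlgHom.comp (chartPoly .one).symm.toAlgHom)).toRingHom)
    (IsUnit.of_mul_eq_one_right (restrictHom .one (chartCoord .one 1)) restrictHom_coord_one_mul)

theorem overlapSwap_restrictHom (p : MvPolynomial (Fin 2) ℂ) :
    overlapSwap (restrictHom .one (chartPoly .one p)) = restrictHom .two (chartPoly .two p) :=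
  IsLocalization.Away.lift_eq (chartCoord .one 1) _ (chartPoly .one p)

theorem overlapSwap_coord (j : Fin 2) :
    overlapSwap (restrictHom .one (chartCoord .one j)) = restrictHom .two (chartCoord .two j) :=
  overlapSwap_restrictHom (X j)

/-- A ring map out of this localization is determined by its values on constants and on the two
coordinates, where the involution is a direct computation. -/
theorem overlapSwap_overlapSwap (z : OverlapRing) : overlapSwap (overlapSwap z) = z := by
  have h2 : overlapSwap (restrictHom .two (chartCoord .two 1)) =
      restrictHom .one (chartCoord .one 1) := by
    have h := congrArg overlapSwap restrictHom_coord_one_mul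
    rw [map_mul, map_one, overlapSwap_coord] at h
    have h' := restrictHom_coord_one_mul
    -- Both sides are inverses of `w₀`, hence equal.
    linear_combination (restrictHom .one (chartCoord .one 1)) * h -
      overlapSwap (restrictHom .two (chartCoord .two 1)) * h'
  have key : (overlapSwap.comp overlapSwap).comp
      ((restrictHom .one).toRingHom.comp (chartPoly .one).toAlgHom.toRingHom) =
      (restrictHom .one).toRingHom.comp (chartPoly .one).toAlgHom.toRingHom := by
    refine MvPolynomial.ringHom_ext (fun r => ?_) fun j => ?_
    · change overlapSwap (overlapSwap (restrictHom .one (chartPoly .one (C r)))) =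
        restrictHom .one (chartPoly .one (C r))
      have hC : ∀ i, restrictHom i (chartPoly i (C r)) = algebraMap ℂ OverlapRing r := fun i => by
        rw [← MvPolynomial.algebraMap_eq, AlgEquiv.commutes, AlgHom.commutes]
      rw [overlapSwap_restrictHom, hC, ← hC .one, overlapSwap_restrictHom, hC, hC]
    · change overlapSwap (overlapSwap (restrictHom .one (chartCoord .one j))) =
        restrictHom .one (chartCoord .one j)
      rw [overlapSwap_coord]
      fin_cases j
      · change overlapSwap (restrictHom .two (chartCoord .two 0)) =
          restrictHom .one (chartCoord .one 0)
        rw [restrictHom_coord_two_zero, map_mul, overlapSwap_coord, overlapSwap_coord,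
          restrictHom_coord_two_zero, mul_assoc, restrictHom_coord_one_mul, mul_one]
      · exact h2
  have : overlapSwap.comp overlapSwap = RingHom.id OverlapRing := by
    refine IsLocalization.ringHom_ext (Submonoid.powers (chartCoord .one 1)) ?_
    ext p
    exact DFunLike.congr_fun key ((chartPoly .one).symm p)
  exact DFunLike.congr_fun this z

/-- The change of coordinates as an automorphism. -/
def overlapSwapEquiv : OverlapRing ≃+* OverlapRing where
  __ := overlapSwap
  invFun := overlapSwap
  left_inv := overlapSwap_overlapSwap
  right_inv := overlapSwap_overlapSwap

/-- For the first chart this is injectivity of a localization map of a domain; the second chart is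
carried to the first by the automorphism `overlapSwap`. -/
theorem restrictHom_injective (i : Chart) :
    Function.Injective (algebraMap (ChartRing i) OverlapRing) := by
  have h1 : Function.Injective (algebraMap (ChartRing .one) OverlapRing) :=
    IsLocalization.injective (M := Submonoid.powers (chartCoord .one 1)) OverlapRing
      (powers_le_nonZeroDivisors_of_noZeroDivisors (chartCoord_ne_zero _ _))
  cases i with
  | one => exact h1
  | two =>
    intro p q h
    have h' : overlapSwap (restrictHom .one (chartPoly .one ((chartPoly .two).symm p))) =
        overlapSwap (restrictHom .one (chartPoly .one ((chartPoly .two).symm q))) := by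
      rw [overlapSwap_restrictHom, overlapSwap_restrictHom]
      exact h
    exact h1 (overlapSwapEquiv.injective h')

/-- Obtained for the second chart by transport along `overlapSwap`. From here on both charts can be
treated uniformly, as localizations at their second coordinate. -/
instance isLocalization_restrict (i : Chart) :
    IsLocalization.Away (chartCoord i 1) OverlapRing := by
  cases i with
  | one => infer_instance
  | two =>
    refine IsLocalization.Away.mk _ ?_ (fun z => ?_) fun a b h => ⟨0, ?_⟩
    · exact IsUnit.of_mul_eq_one_right (restrictHom .one (chartCoord .one 1))
        restrictHom_coord_one_mul
    · obtain ⟨n, a, ha⟩ := IsLocalization.Away.surj (chartCoord .one 1) (overlapSwap z)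
      refine ⟨n, chartPoly .two ((chartPoly .one).symm a), ?_⟩
      have h := congrArg overlapSwap ha
      rw [map_mul, map_pow, overlapSwap_overlapSwap] at h
      exact (congrArg (fun t => z * t ^ n) (overlapSwap_coord 1).symm).trans
        (h.trans (overlapSwap_restrictHom ((chartPoly .one).symm a)))
    · rw [restrictHom_injective _ h]

instance : IsDomain OverlapRing :=
  IsLocalization.isDomain_of_le_nonZeroDivisors OverlapRing
    (M := Submonoid.powers (chartCoord .one 1))
    (powers_le_nonZeroDivisors_of_noZeroDivisors (chartCoord_ne_zero _ _))

end Overlap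

/-! ### The lattice of sub-D-modules -/

section Lattice

variable {F : BlowupDMod}

instance (i : Chart) : IsLocalizedModule (Submonoid.powers (chartCoord i 1)) (F.res i) :=
  (isLocalizedModule_iff_isBaseChange _ OverlapRing _).mpr (F.res_isBaseChange i)

namespace SubDMod

/-- The sections of a sub-D-module over the intersection of the charts, generated by those over a
chart. -/
theorem span_res_eq (i : Chart) (N : Submodule (ChartRing i) (F.sec i)) :
    Submodule.span OverlapRing (F.res i '' (N : Set (F.sec i))) =
      N.localized' OverlapRing (Submonoid.powers (chartCoord i 1)) (F.res i) :=
  (Submodule.localized'_eq_span _ _ _ _).symm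

/-- The gluing condition compares two localizations, and localization commutes with sums and with
finite intersections, so lattice operations can be performed chart by chart. -/
instance : Lattice (SubDMod F) where
  sup N N' :=
    { sub := fun i => N.sub i ⊔ N'.sub i
      nabla_mem := fun i D m hm => by
        obtain ⟨a, ha, b, hb, rfl⟩ := Submodule.mem_sup.mp hm
        rw [map_add]
        exact Submodule.add_mem_sup (N.nabla_mem i D a ha) (N'.nabla_mem i D b hb)
      glue := by
        have h := N.glue
        have h' := N'.glue
        rw [span_res_eq, span_res_eq] at h h' ⊢
        have hs : ∀ i, (N.sub i ⊔ N'.sub i).localized' OverlapRing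
            (Submonoid.powers (chartCoord i 1)) (F.res i) =
            (N.sub i).localized' OverlapRing (Submonoid.powers (chartCoord i 1)) (F.res i) ⊔
            (N'.sub i).localized' OverlapRing (Submonoid.powers (chartCoord i 1)) (F.res i) :=
          fun i => map_sup (Submodule.localized'FrameHom OverlapRing
            (Submonoid.powers (chartCoord i 1)) (F.res i)) _ _
        rw [hs, hs, h, h'] }
  inf N N' :=
    { sub := fun i => N.sub i ⊓ N'.sub i
      nabla_mem := fun i D m hm => ⟨N.nabla_mem i D m hm.1, N'.nabla_mem i D m hm.2⟩
      glue := by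
        have h := N.glue
        have h' := N'.glue
        rw [span_res_eq, span_res_eq] at h h' ⊢
        rw [Submodule.localized'_inf, Submodule.localized'_inf, h, h'] }
  le_sup_left N N' i := le_sup_left (a := N.sub i)
  le_sup_right N N' i := le_sup_right (a := N.sub i)
  sup_le N N' N'' h h' i := sup_le (h i) (h' i)
  inf_le_left N N' i := inf_le_left (a := N.sub i)
  inf_le_right N N' i := inf_le_right (a := N.sub i)
  le_inf N N' N'' h h' i := le_inf (h i) (h' i)

theorem sub_sup (N N' : SubDMod F) (i : Chart) : (N ⊔ N').sub i = N.sub i ⊔ N'.sub i := rfl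

theorem sub_inf (N N' : SubDMod F) (i : Chart) : (N ⊓ N').sub i = N.sub i ⊓ N'.sub i := rfl

instance : IsModularLattice (SubDMod F) where
  sup_inf_le_assoc_of_le {x} y z h i := by
    rw [sub_inf, sub_sup, sub_sup, sub_inf]
    exact IsModularLattice.sup_inf_le_assoc_of_le (y.sub i) (h i)

end SubDMod

/-- Removes the quotient module from the definition: a nonzero germ is a section of `N'` that no
function invertible at the point multiplies into `N`. -/
theorem mem_subquotientSupport {N N' : SubDMod F} {p : Blowup} :
    p ∈ subquotientSupport N N' ↔ ∃ (i : Chart) (a : Fin 2 → ℂ), chartPoint i a = p ∧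
      ∃ m ∈ N'.sub i, ∀ r : MvPolynomial (Fin 2) ℂ, MvPolynomial.eval a r ≠ 0 →
        chartPoly i r • m ∉ N.sub i := by
  simp only [subquotientSupport, Set.mem_ofPred_eq, Module.mem_support_iff']
  refine exists_congr fun i => exists_congr fun a => and_congr_right fun _ => ?_
  constructor
  · rintro ⟨m, hm⟩
    obtain ⟨⟨m, hmN⟩, rfl⟩ := Submodule.Quotient.mk_surjective _ m
    refine ⟨m, hmN, fun r hr h => hm (chartPoly i r) hr ?_⟩
    rw [← Submodule.Quotient.mk_smul, Submodule.Quotient.mk_eq_zero]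
    exact h
  · rintro ⟨m, hmN, hm⟩
    refine ⟨Submodule.Quotient.mk ⟨m, hmN⟩, fun r hr h => hm r hr ?_⟩
    rw [← Submodule.Quotient.mk_smul, Submodule.Quotient.mk_eq_zero] at h
    exact h

/-- The second isomorphism theorem `(N + N') / N ≅ N' / (N ∩ N')`, seen on supports. -/
theorem subquotientSupport_sup (N N' : SubDMod F) :
    subquotientSupport N (N ⊔ N') = subquotientSupport (N ⊓ N') N' := by
  ext p
  simp only [mem_subquotientSupport]
  refine exists_congr fun i => exists_congr fun a => and_congr_right fun _ => ?_
  constructor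
  · rintro ⟨m, hm, h⟩
    obtain ⟨x, hx, y, hy, rfl⟩ := Submodule.mem_sup.mp hm
    refine ⟨y, hy, fun r hr hry => h r hr ?_⟩
    rw [smul_add]
    exact add_mem (Submodule.smul_mem _ _ hx) hry.1
  · rintro ⟨y, hy, h⟩
    exact ⟨y, Submodule.mem_sup_right hy, fun r hr hry =>
      h r hr ⟨hry, Submodule.smul_mem _ _ hy⟩⟩

/-- Two distinct covers of `a` meet in `a`. Modularity makes their join cover both, and opposite
sides of the square have isomorphic quotients. -/
theorem subquotientSupport_diamond (F : BlowupDMod) :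
    DiamondProperty (subquotientSupport (F := F)) := by
  intro a c c' h h' hne
  have hi : c ⊓ c' = a := by
    rcases h.eq_or_eq (le_inf h.le h'.le) inf_le_left with h1 | h1
    · exact h1
    · rcases h'.eq_or_eq h.le (inf_eq_left.mp h1) with h2 | h2
      · exact absurd h2 h.ne'
      · exact absurd h2 hne
  refine ⟨c ⊔ c', ?_, ?_, fun b => sup_le, ?_, ?_⟩
  · exact covBy_sup_of_inf_covBy_right (hi ▸ h')
  · exact covBy_sup_of_inf_covBy_left (hi ▸ h)
  · rw [subquotientSupport_sup, hi]
  · rw [sup_comm, subquotientSupport_sup, inf_comm, hi]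

theorem DecompositionSeries.hasFactors (s : DecompositionSeries F) :
    HasFactors subquotientSupport (⊥ : SubDMod F) ⊤ (Finset.univ.val.map s.supp) := by
  rw [← s.first, ← s.last]
  exact HasFactors.of_chain s.term s.covBy

theorem HasFactors.nonempty_decompositionSeries {m : Multiset (Set Blowup)}
    (h : HasFactors subquotientSupport (⊥ : SubDMod F) ⊤ m) :
    Nonempty (DecompositionSeries F) := by
  obtain ⟨l, t, ht, h0, h1⟩ := h.exists_chain
  exact ⟨⟨l, t, ht, h0, h1⟩⟩

theorem DecompositionSeries.map_supp (s : DecompositionSeries F) {m : Multiset (Set Blowup)}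
    (h : HasFactors subquotientSupport (⊥ : SubDMod F) ⊤ m) :
    Finset.univ.val.map s.supp = m :=
  s.hasFactors.unique (subquotientSupport_diamond F) h

end Lattice

/-! ### Submodules of fractions in one variable -/

open Polynomial in
/-- Pairwise non-proportional nonzero affine linear polynomials `a_t + b_t X`. -/
structure LineConfig (ι : Type*) where
  a : ι → ℂ
  b : ι → ℂ
  ne_zero : ∀ t, a t ≠ 0 ∨ b t ≠ 0
  det_ne_zero : ∀ s t, s ≠ t → a s * b t - a t * b s ≠ 0

namespace LineConfig

open Polynomial

variable {ι : Type*} (Λ : LineConfig ι)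

/-- The polynomial `a_t + b_t X`. -/
def line (t : ι) : ℂ[X] := C (Λ.a t) + C (Λ.b t) * X

/-- The zero of `a_t + b_t X`. -/
def root (t : ι) : ℂ := -Λ.a t / Λ.b t

/-- The product of the lines in a finite set. -/
def prod (S : Finset ι) : ℂ[X] := ∏ t ∈ S, Λ.line t

variable {Λ}

theorem line_ne_zero (t : ι) : Λ.line t ≠ 0 := by
  intro h
  have h0 := congrArg (fun p => coeff p 0) h
  have h1 := congrArg (fun p => coeff p 1) h
  simp only [line, coeff_add, coeff_C_zero, coeff_C_mul, coeff_X_zero, coeff_X_one, coeff_zero,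
    mul_zero, add_zero, coeff_C_succ, mul_one, zero_add] at h0 h1
  exact (Λ.ne_zero t).elim (fun h => h h0) fun h => h h1

theorem prod_ne_zero (S : Finset ι) : Λ.prod S ≠ 0 :=
  Finset.prod_ne_zero_iff.mpr fun t _ => line_ne_zero t

theorem isUnit_line {t : ι} (h : Λ.b t = 0) : IsUnit (Λ.line t) := by
  have ha := (Λ.ne_zero t).resolve_right (not_not_intro h)
  simpa [line, h] using ha

theorem line_eq {t : ι} (h : Λ.b t ≠ 0) : Λ.line t = C (Λ.b t) * (X - C (Λ.root t)) := by
  rw [mul_sub, ← C_mul, root, mul_div_cancel₀ _ h, line, C_neg]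
  ring

theorem line_dvd_iff {t : ι} (h : Λ.b t ≠ 0) {p : ℂ[X]} :
    Λ.line t ∣ p ↔ eval (Λ.root t) p = 0 := by
  rw [line_eq h, IsUnit.mul_left_dvd (isUnit_C.mpr h.isUnit), dvd_iff_isRoot, IsRoot]

theorem isCoprime_line_iff {t : ι} (h : Λ.b t ≠ 0) {p : ℂ[X]} :
    IsCoprime (Λ.line t) p ↔ eval (Λ.root t) p ≠ 0 := by
  have hirr : Irreducible (Λ.line t) := by
    refine irreducible_of_degree_eq_one ?_
    rw [line, add_comm]
    exact degree_linear h
  rw [hirr.coprime_iff_not_dvd, line_dvd_iff h]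

theorem eval_root_self {t : ι} (h : Λ.b t ≠ 0) : eval (Λ.root t) (Λ.line t) = 0 :=
  (line_dvd_iff h).mp dvd_rfl

theorem eval_root_ne_zero {s t : ι} (h : Λ.b t ≠ 0) (hst : s ≠ t) :
    eval (Λ.root t) (Λ.line s) ≠ 0 := by
  have := Λ.det_ne_zero s t hst
  simp only [line, root, eval_add, eval_C, eval_mul, eval_X]
  intro h'
  apply this
  field_simp at h'
  linear_combination h'

theorem eval_root_prod_ne_zero {S : Finset ι} {t : ι} (h : Λ.b t ≠ 0) (hS : t ∉ S) :
    eval (Λ.root t) (Λ.prod S) ≠ 0 := by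
  rw [prod, eval_prod]
  exact Finset.prod_ne_zero_iff.mpr fun s hs =>
    eval_root_ne_zero h (fun hst => hS (hst ▸ hs))

variable {K : Type*} [Field K] [Algebra ℂ K] (φ : ℂ[X] →ₐ[ℂ] K)

variable (Λ) in
/-- The fractions whose denominator is a power of `∏_{t ∈ S} (a_t + b_t X)`. -/
def fractions (S : Finset ι) : AddSubgroup K where
  carrier := {g | ∃ (n : ℕ) (r : ℂ[X]), φ (Λ.prod S) ^ n * g = φ r}
  zero_mem' := ⟨0, 0, by simp⟩
  add_mem' := by
    rintro g h ⟨n, r, hg⟩ ⟨m, s, hh⟩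
    refine ⟨n + m, Λ.prod S ^ m * r + Λ.prod S ^ n * s, ?_⟩
    simp only [map_add, map_mul, map_pow, ← hg, ← hh]
    ring
  neg_mem' := by
    rintro g ⟨n, r, hg⟩
    exact ⟨n, -r, by rw [map_neg, ← hg]; ring⟩

variable {φ}

theorem map_mem_fractions (S : Finset ι) (r : ℂ[X]) : φ r ∈ Λ.fractions φ S := ⟨0, r, by simp⟩

theorem one_mem_fractions (S : Finset ι) : (1 : K) ∈ Λ.fractions φ S :=
  ⟨0, 1, by simp⟩

theorem mul_mem_fractions {S : Finset ι} {g h : K} (hg : g ∈ Λ.fractions φ S)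
    (hh : h ∈ Λ.fractions φ S) : g * h ∈ Λ.fractions φ S := by
  obtain ⟨n, r, hg⟩ := hg
  obtain ⟨m, s, hh⟩ := hh
  exact ⟨n + m, r * s, by rw [map_mul, ← hg, ← hh]; ring⟩

theorem fractions_mono {S S' : Finset ι} (h : S ⊆ S') :
    Λ.fractions φ S ≤ Λ.fractions φ S' := by
  classical
  rintro g ⟨n, r, hg⟩
  refine ⟨n, (∏ t ∈ S' \ S, Λ.line t) ^ n * r, ?_⟩
  rw [map_mul, ← hg, prod, prod, ← Finset.prod_sdiff h, map_mul, mul_pow, map_pow]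
  ring

/-! ### Poles along a single line -/

section Injective

variable (hφ : Function.Injective φ)
include hφ

theorem map_line_ne_zero (t : ι) : φ (Λ.line t) ≠ 0 :=
  (map_ne_zero_iff φ hφ).mpr (line_ne_zero t)

theorem map_prod_ne_zero (S : Finset ι) : φ (Λ.prod S) ≠ 0 :=
  (map_ne_zero_iff φ hφ).mpr (prod_ne_zero S)

theorem inv_line_mem_fractions {S : Finset ι} {t : ι} (ht : t ∈ S) :
    (φ (Λ.line t))⁻¹ ∈ Λ.fractions φ S := by
  classical
  refine ⟨1, ∏ s ∈ S.erase t, Λ.line s, ?_⟩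
  rw [prod, ← Finset.mul_prod_erase _ _ ht, map_mul, pow_one, mul_comm, ← mul_assoc,
    inv_mul_cancel₀ (map_line_ne_zero hφ t), one_mul]

theorem inv_prod_mem_fractions (S : Finset ι) : (φ (Λ.prod S))⁻¹ ∈ Λ.fractions φ S :=
  ⟨1, 1, by rw [pow_one, map_one, mul_inv_cancel₀ (map_prod_ne_zero hφ S)]⟩

/-- Clearing denominators gives `L^n r = l_i s`, where `L` does not vanish at the root of `l_i`.
Thus the class of `1 / l_i` modulo fractions without a pole at that root is annihilated only by
multiples of `l_i`. -/
theorem eval_root_of_div_mem {S : Finset ι} {i : ι} (hi : i ∉ S) (hb : Λ.b i ≠ 0) {r : ℂ[X]}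
    (h : φ r * (φ (Λ.line i))⁻¹ ∈ Λ.fractions φ S) : eval (Λ.root i) r = 0 := by
  obtain ⟨n, s, hs⟩ := h
  have h0 := map_line_ne_zero (Λ := Λ) hφ i
  have : Λ.prod S ^ n * r = Λ.line i * s := by
    apply hφ
    rw [map_mul, map_mul, ← hs, map_pow]
    field_simp
  have h1 := congrArg (eval (Λ.root i)) this
  rw [eval_mul, eval_mul, eval_root_self hb, zero_mul, eval_pow] at h1
  exact (mul_eq_zero.mp h1).resolve_left (pow_ne_zero _ (eval_root_prod_ne_zero hb hi))

omit hφ in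
theorem pow_line_mul_mem [DecidableEq ι] {S : Finset ι} {i : ι} {g : K}
    (hg : g ∈ Λ.fractions φ (insert i S)) :
    ∃ n : ℕ, φ (Λ.line i) ^ n * g ∈ Λ.fractions φ S := by
  by_cases hi : i ∈ S
  · rw [Finset.insert_eq_of_mem hi] at hg
    exact ⟨0, by simpa using hg⟩
  · obtain ⟨n, r, hr⟩ := hg
    refine ⟨n, n, r, ?_⟩
    rw [← hr, prod, prod, Finset.prod_insert hi, map_mul]
    ring

-- A constant `a_i + b_i X` is a unit: the proper transform of the line misses this chart, so
-- admitting poles along it changes nothing here.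
omit hφ in
theorem fractions_insert_of_isUnit [DecidableEq ι] {S : Finset ι} {i : ι} (hb : Λ.b i = 0) :
    Λ.fractions φ (insert i S) = Λ.fractions φ S := by
  refine le_antisymm (fun g hg => ?_) (fractions_mono (Finset.subset_insert i S))
  obtain ⟨n, hn⟩ := pow_line_mul_mem hg
  obtain ⟨u, hu⟩ := (isUnit_line hb).exists_right_inv
  have h1 : g = φ (u ^ n) * (φ (Λ.line i) ^ n * g) := by
    rw [← mul_assoc, map_pow, ← mul_pow, ← map_mul, mul_comm u, hu, map_one, one_pow, one_mul]
  rw [h1]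
  exact mul_mem_fractions (map_mem_fractions _ _) hn

end Injective

/-! #### Submodules stable under a connection -/

variable (φ) in
/-- A `ℂ[X]`-submodule of `K` which is stable under `δ + θ`. -/
structure IsStable (δ : Derivation ℂ K K) (θ : K) (N : AddSubgroup K) : Prop where
  mul_mem : ∀ (p : ℂ[X]) {g : K}, g ∈ N → φ p * g ∈ N
  nabla_mem : ∀ {g : K}, g ∈ N → δ g + θ * g ∈ N

variable (Λ φ) in
/-- The logarithmic derivative `∑_{t ∈ T} γ_t b_t / (a_t + b_t X)`. -/
def logForm (T : Finset ι) (γ : ι → ℂ) : K :=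
  ∑ t ∈ T, algebraMap ℂ K (γ t * Λ.b t) * (φ (Λ.line t))⁻¹

section Stable

variable (hφ : Function.Injective φ) {δ : Derivation ℂ K K}
  (hδ : ∀ p, δ (φ p) = φ (derivative p)) {T : Finset ι} {γ : ι → ℂ}

theorem logForm_mem_fractions (hφ : Function.Injective φ) {S : Finset ι} (hT : T ⊆ S) :
    Λ.logForm φ T γ ∈ Λ.fractions φ S := by
  refine sum_mem fun t ht => mul_mem_fractions ?_ (inv_line_mem_fractions hφ (hT ht))
  rw [← φ.commutes]
  exact map_mem_fractions _ _

include hφ hδ in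
theorem isStable_fractions {S : Finset ι} (hT : T ⊆ S) :
    IsStable φ δ (Λ.logForm φ T γ) (Λ.fractions φ S) where
  mul_mem p _ hg := mul_mem_fractions (map_mem_fractions S p) hg
  nabla_mem {g} hg := by
    refine add_mem ?_ (mul_mem_fractions (logForm_mem_fractions hφ hT) hg)
    obtain ⟨n, r, hr⟩ := hg
    have h0 := map_prod_ne_zero (Λ := Λ) hφ S
    have h1 : g = φ r * ((φ (Λ.prod S))⁻¹) ^ n := by
      rw [← hr, mul_right_comm, ← mul_pow, mul_inv_cancel₀ h0, one_pow, one_mul]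
    have hinv : ∀ k : ℕ, ((φ (Λ.prod S))⁻¹) ^ k ∈ Λ.fractions φ S := fun k => by
      induction k with
      | zero => simpa using one_mem_fractions S
      | succ k ih => rw [pow_succ]; exact mul_mem_fractions ih (inv_prod_mem_fractions hφ S)
    rw [h1, Derivation.leibniz, Derivation.leibniz_pow, Derivation.leibniz_inv, hδ, hδ]
    simp only [smul_eq_mul, nsmul_eq_mul]
    have hm := fun p => map_mem_fractions (Λ := Λ) (φ := φ) S p
    refine add_mem (mul_mem_fractions (hm _) ?_) (mul_mem_fractions (hinv n) (hm _))
    have hn : (n : K) = φ (n : ℂ[X]) := by simp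
    rw [hn]
    refine mul_mem_fractions (hm _) (mul_mem_fractions (hinv _) ?_)
    rw [neg_mul]
    refine neg_mem (mul_mem_fractions (hinv 2) (hm _))

/-- Bézout. This is the tool for removing a factor from the numerator of an element of `N`. -/
theorem IsStable.mem_of_isCoprime {θ : K} {N : AddSubgroup K} (hN : IsStable φ δ θ N)
    {p q : ℂ[X]} (h : IsCoprime p q) {g : K} (hp : φ p * g ∈ N) (hq : φ q * g ∈ N) : g ∈ N := by
  obtain ⟨a, b, hab⟩ := h
  have : g = φ a * (φ p * g) + φ b * (φ q * g) := by
    rw [← mul_assoc, ← mul_assoc, ← add_mul, ← map_mul, ← map_mul, ← map_add, hab, map_one,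
      one_mul]
  rw [this]
  exact add_mem (hN.mul_mem a hp) (hN.mul_mem b hq)

variable (Λ) in
/-- The numerator of the logarithmic derivative of `∏_{t ∈ T} (a_t + b_t X)^{m + γ_t}`. -/
def logNumerator [DecidableEq ι] (T : Finset ι) (γ : ι → ℂ) (m : ℂ) : ℂ[X] :=
  ∑ t ∈ T, C ((m + γ t) * Λ.b t) * Λ.prod (T.erase t)

-- With `L` the product over `T`, this yields `(δ + θ)(L^m) = L^(m-1) * logNumerator m`, which turns
-- questions on the connection into questions on a polynomial.
include hφ in
theorem map_logNumerator [DecidableEq ι] (m : ℂ) :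
    φ (Λ.logNumerator T γ m) =
      algebraMap ℂ K m * φ (derivative (Λ.prod T)) + φ (Λ.prod T) * Λ.logForm φ T γ := by
  have hd : derivative (Λ.prod T) = ∑ t ∈ T, C (Λ.b t) * Λ.prod (T.erase t) := by
    rw [prod, derivative_prod_finset]
    refine Finset.sum_congr rfl fun t _ => ?_
    rw [mul_comm, prod]
    congr 1
    simp [line]
  rw [hd, logNumerator, logForm, map_sum, map_sum, Finset.mul_sum, Finset.mul_sum,
    ← Finset.sum_add_distrib]
  refine Finset.sum_congr rfl fun t ht => ?_
  have h0 := map_line_ne_zero (Λ := Λ) hφ t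
  have h1 : Λ.prod T = Λ.line t * Λ.prod (T.erase t) := (Finset.mul_prod_erase _ _ ht).symm
  have hC : ∀ c : ℂ, φ (C c) = algebraMap ℂ K c := φ.commutes
  rw [h1]
  simp only [map_mul, hC, map_add]
  field_simp

include hφ in
theorem exists_map_eq_prod_mul_logForm {S : Finset ι} (hT : T ⊆ S) :
    ∃ q : ℂ[X], φ (Λ.prod S) * Λ.logForm φ T γ = φ q := by
  classical
  refine ⟨Λ.prod (S \ T) * Λ.logNumerator T γ 0, ?_⟩
  rw [map_mul, map_logNumerator hφ, map_zero, zero_mul, zero_add, ← mul_assoc, ← map_mul, prod,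
    prod, prod, Finset.prod_sdiff hT]

/-- At the root of `l_t` every summand except the one of `t` vanishes, and that one is `(m + γ_t)
b_t` times values of the other lines, hence nonzero. Constant lines are units and impose no
condition. -/
theorem isCoprime_logNumerator [DecidableEq ι] {m : ℂ} (hγ : ∀ t ∈ T, m + γ t ≠ 0) :
    IsCoprime (Λ.prod T) (Λ.logNumerator T γ m) := by
  refine IsCoprime.prod_left fun t ht => ?_
  by_cases hb : Λ.b t = 0
  · exact (isCoprime_one_left (x := Λ.logNumerator T γ m)).of_isCoprime_of_dvd_left
      (isUnit_line hb).dvd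
  · rw [isCoprime_line_iff hb, logNumerator, eval_finsetSum, Finset.sum_eq_single_of_mem t ht]
    · rw [eval_mul, eval_C]
      exact mul_ne_zero (mul_ne_zero (hγ t ht) hb)
        (eval_root_prod_ne_zero hb (Finset.notMem_erase t T))
    · intro s _ hst
      have hdvd : Λ.line t ∣ Λ.prod (T.erase s) :=
        Finset.dvd_prod_of_mem _ (Finset.mem_erase.mpr ⟨hst.symm, ht⟩)
      rw [eval_mul, (line_dvd_iff hb).mp hdvd, mul_zero]

include hφ hδ in
/-- If no exponent is an integer, the module of fractions is irreducible. -/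
theorem IsStable.eq_fractions {N : AddSubgroup K} (hN : IsStable φ δ (Λ.logForm φ T γ) N)
    (hγ : ∀ t ∈ T, ∀ z : ℤ, γ t ≠ z) (hle : N ≤ Λ.fractions φ T) (hne : N ≠ ⊥) :
    N = Λ.fractions φ T := by
  classical
  set L := φ (Λ.prod T) with hL
  have h0 : L ≠ 0 := map_prod_ne_zero hφ T
  have hθ := map_logNumerator (Λ := Λ) (γ := γ) (T := T) hφ 0
  rw [map_zero, zero_mul, zero_add, ← hL] at hθ
  -- a power of the denominator lies in `N`
  have step1 : ∀ (d : ℕ) (n : ℕ) (r : ℂ[X]), r.natDegree ≤ d → r ≠ 0 → L ^ n * φ r ∈ N →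
      ∃ n : ℕ, L ^ n ∈ N := by
    intro d
    induction d with
    | zero =>
      intro n r hr hr0 hmem
      obtain ⟨c, rfl⟩ := natDegree_eq_zero.mp (Nat.le_zero.mp hr)
      have hc : c ≠ 0 := fun h => hr0 (by rw [h, C_0])
      refine ⟨n, ?_⟩
      have := hN.mul_mem (C c⁻¹) hmem
      rwa [mul_left_comm, ← map_mul, ← C_mul, inv_mul_cancel₀ hc, C_1, map_one, mul_one] at this
    | succ d ih =>
      intro n r hr hr0 hmem
      by_cases hd : derivative r = 0
      · have hdeg := derivative_eq_zero.mp hd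
        obtain ⟨c, rfl⟩ := natDegree_eq_zero.mp hdeg
        have hc : c ≠ 0 := fun h => hr0 (by rw [h, C_0])
        refine ⟨n, ?_⟩
        have := hN.mul_mem (C c⁻¹) hmem
        rwa [mul_left_comm, ← map_mul, ← C_mul, inv_mul_cancel₀ hc, C_1, map_one, mul_one] at this
      · refine ih (n + 1) (derivative r) ?_ hd ?_
        · have := natDegree_derivative_lt (p := r) (fun h => hd (by
            obtain ⟨c, rfl⟩ := natDegree_eq_zero.mp h
            simp))
          omega
        · have h1 := hN.mul_mem (Λ.prod T) (hN.nabla_mem hmem)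
          have h2 := hN.mul_mem (Λ.logNumerator T γ n) hmem
          -- Subtracting the contribution of `L^n` from `L (δ + θ)(L^n r)` leaves `L^(n+1) r'`: the
          -- degree of the numerator drops at the cost of a further factor `L`.
          have h3 : L ^ (n + 1) * φ (derivative r) =
              φ (Λ.prod T) * (δ (L ^ n * φ r) + Λ.logForm φ T γ * (L ^ n * φ r)) -
              φ (Λ.logNumerator T γ n) * (L ^ n * φ r) := by
            rw [map_logNumerator hφ, Derivation.leibniz, Derivation.leibniz_pow, hL, hδ, hδ]
            simp only [smul_eq_mul, nsmul_eq_mul, map_natCast]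
            -- The power rule contains the truncated exponent `n - 1`, so `n = 0` needs its own
            -- computation.
            rcases n with - | n
            · simp; ring
            · simp only [Nat.add_sub_cancel]
              ring
          rw [h3]
          exact sub_mem h1 h2
  -- Both `L * L^(m-1)` and `logNumerator m * L^(m-1) = (δ + θ)(L^m)` lie in `N`. Since no `m + γ_t`
  -- vanishes, the two multipliers are coprime, so every integral exponent can be lowered.
  have step2 : ∀ m : ℤ, L ^ m ∈ N → L ^ (m - 1) ∈ N := by
    intro m hm
    refine hN.mem_of_isCoprime (isCoprime_logNumerator (γ := γ) (T := T) (Λ := Λ) (m := m) ?_)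
      ?_ ?_
    · intro t ht h
      exact hγ t ht (-m) (by push_cast; linear_combination h)
    · rw [← hL, zpow_sub_one₀ h0, mul_comm, mul_assoc, inv_mul_cancel₀ h0, mul_one]
      exact hm
    · have h1 := hN.nabla_mem hm
      have h2 : φ (Λ.logNumerator T γ m) * L ^ (m - 1) =
          δ (L ^ m) + Λ.logForm φ T γ * L ^ m := by
        rw [map_logNumerator hφ, Derivation.leibniz_zpow, hL, hδ, ← hL, zpow_sub_one₀ h0]
        simp only [smul_eq_mul, zsmul_eq_mul, map_intCast]
        field_simp
      rw [h2]
      exact h1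
  obtain ⟨g, hg, hg0⟩ : ∃ g ∈ N, g ≠ 0 := by
    by_contra! h
    exact hne ((AddSubgroup.eq_bot_iff_forall N).mpr h)
  obtain ⟨n, r, hr⟩ := hle hg
  have hr0 : r ≠ 0 := by
    rintro rfl
    rw [map_zero] at hr
    exact (mul_ne_zero (pow_ne_zero n h0) hg0) hr
  obtain ⟨k, hk⟩ := step1 r.natDegree 0 r le_rfl hr0 (by
    rw [pow_zero, one_mul, ← hr, ← map_pow]
    exact hN.mul_mem _ hg)
  have step3 : ∀ j : ℕ, L ^ ((k : ℤ) - j) ∈ N := by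
    intro j
    induction j with
    | zero => simpa using hk
    | succ j ih =>
      have := step2 _ ih
      rwa [show (k : ℤ) - j - 1 = (k : ℤ) - (j + 1 : ℕ) by push_cast; ring] at this
  refine le_antisymm hle fun g hg => ?_
  obtain ⟨n, r, hr⟩ := hg
  have h1 := hN.mul_mem r (step3 (k + n))
  rw [← hr, show (k : ℤ) - (k + n : ℕ) = -(n : ℤ) by push_cast; ring, zpow_neg, zpow_natCast] at h1
  convert h1 using 1
  rw [← hL, mul_right_comm, mul_inv_cancel₀ (pow_ne_zero n h0), one_mul]

include hφ hδ in
/-- The fractions with a pole along one more line, modulo those without, are irreducible. -/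
theorem IsStable.eq_fractions_insert [DecidableEq ι] {N : AddSubgroup K}
    (hN : IsStable φ δ (Λ.logForm φ T γ) N) {S : Finset ι} (hT : T ⊆ S) {i : ι} (hi : i ∉ S)
    (hb : Λ.b i ≠ 0) (hle : N ≤ Λ.fractions φ (insert i S)) (hge : Λ.fractions φ S ≤ N)
    (hne : N ≠ Λ.fractions φ S) : N = Λ.fractions φ (insert i S) := by
  set L := φ (Λ.prod S) with hL
  set l := φ (Λ.line i) with hl
  have h0 : L ≠ 0 := map_prod_ne_zero hφ S
  have l0 : l ≠ 0 := map_line_ne_zero hφ i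
  have hins : φ (Λ.prod (insert i S)) = l * L := by
    rw [prod, Finset.prod_insert hi, map_mul]
    rfl
  have hcop : ∀ n m : ℕ, IsCoprime (Λ.line i ^ n) (Λ.prod S ^ m) := fun n m =>
    ((isCoprime_line_iff hb).mpr (eval_root_prod_ne_zero hb hi)).pow
  -- Take an element of `N` with a pole of exact order `n + 1` along the new line. Its numerator `r`
  -- is coprime to `l`; lowering the pole to order one shows `r * l⁻¹ ∈ N`, while `l * l⁻¹ = 1 ∈ N`
  -- is given.
  have step1 : l⁻¹ ∈ N := by
    obtain ⟨g, hg, hgS⟩ : ∃ g ∈ N, g ∉ Λ.fractions φ S := by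
      by_contra! h
      exact hne (le_antisymm h hge)
    obtain ⟨m, r, hr⟩ := hle hg
    rw [hins] at hr
    have hex : ∃ n : ℕ, l ^ n * g ∈ Λ.fractions φ S := pow_line_mul_mem (hle hg)
    obtain ⟨n, hn, hmin⟩ : ∃ n : ℕ, l ^ (n + 1) * g ∈ Λ.fractions φ S ∧
        l ^ n * g ∉ Λ.fractions φ S := by
      classical
      have h1 := Nat.find_spec hex
      rcases hk : Nat.find hex with - | n
      · rw [hk, pow_zero, one_mul] at h1
        exact absurd h1 hgS
      · rw [hk] at h1
        exact ⟨n, h1, Nat.find_min hex (by omega)⟩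
    obtain ⟨m, r, hr⟩ := hn
    have hcr : IsCoprime (Λ.line i) r := by
      rw [isCoprime_line_iff hb]
      intro h
      obtain ⟨s, rfl⟩ := (line_dvd_iff hb).mpr h
      refine hmin ⟨m, s, mul_left_cancel₀ l0 ?_⟩
      rw [map_mul] at hr
      rw [← hl] at hr
      rw [← hr]
      ring
    refine hN.mem_of_isCoprime hcr ?_ ?_
    · rw [← hl, mul_inv_cancel₀ l0]
      exact hge (one_mem_fractions S)
    · have h1 := hN.mul_mem (Λ.prod S ^ m * Λ.line i ^ n) hg
      convert h1 using 1
      rw [← hr, map_mul, map_pow, map_pow, ← hl, ← hL, pow_succ]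
      field_simp
  -- Differentiation raises the pole order. As `T ⊆ S`, the form `θ` becomes a polynomial `q` after
  -- multiplication by `L`, and `i ∉ S`, so `L (δ + θ) l^-(j+1)` equals `-(j+1) b_i L l^-(j+2)` up
  -- to `q * l^-(j+1)`. The factor `L` is then removed by coprimality with `l`.
  have step2 : ∀ j : ℕ, l⁻¹ ^ j ∈ N := by
    intro j
    induction j with
    | zero => simpa using hge (one_mem_fractions S)
    | succ j ih =>
      rcases j with - | j
      · simpa using step1
      refine hN.mem_of_isCoprime (p := Λ.line i) (q := Λ.prod S) ?_ ?_ ?_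
      · simpa using hcop 1 1
      · rw [← hl, pow_succ', ← mul_assoc, mul_inv_cancel₀ l0, one_mul]
        exact ih
      · have h1 := hN.mul_mem (Λ.prod S) (hN.nabla_mem ih)
        obtain ⟨q, hq⟩ := exists_map_eq_prod_mul_logForm (Λ := Λ) (γ := γ) hφ hT
        have h2 := hN.mul_mem q ih
        have hc : (algebraMap ℂ K) ((j + 1 : ℕ) * Λ.b i) ≠ 0 := by
          rw [Ne, map_eq_zero]
          exact mul_ne_zero (Nat.cast_ne_zero.mpr (Nat.succ_ne_zero j)) hb
        have hd : δ (l⁻¹ ^ (j + 1)) =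
            - (algebraMap ℂ K) ((j + 1 : ℕ) * Λ.b i) * l⁻¹ ^ (j + 2) := by
          rw [Derivation.leibniz_pow, Derivation.leibniz_inv, hl, hδ, line]
          simp only [derivative_add, derivative_C, derivative_C_mul, derivative_X, mul_one, zero_add,
            smul_eq_mul, nsmul_eq_mul, Nat.add_sub_cancel, map_mul, map_natCast]
          rw [show φ (C (Λ.b i)) = algebraMap ℂ K (Λ.b i) from φ.commutes _]
          ring
        have h3 := hN.mul_mem (C ((j + 1 : ℕ) * Λ.b i)⁻¹) (sub_mem h2 h1)
        rw [show φ (C ((j + 1 : ℕ) * Λ.b i)⁻¹) = algebraMap ℂ K ((j + 1 : ℕ) * Λ.b i)⁻¹ from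
          φ.commutes _, map_inv₀, hd, ← hq] at h3
        convert h3 using 1
        rw [mul_add, ← hL, eq_inv_mul_iff_mul_eq₀ hc]
        ring
  refine le_antisymm hle fun g hg => ?_
  obtain ⟨n, r, hr⟩ := hg
  rw [hins, mul_pow] at hr
  -- Separate the two kinds of poles: `l^n g` has none along the new line, and `L^n g` has poles
  -- only there.
  refine hN.mem_of_isCoprime (hcop n n) ?_ ?_
  · refine hge ⟨n, r, ?_⟩
    rw [← hr, map_pow]
    ring
  · have := hN.mul_mem r (step2 n)
    rw [← hr] at this
    convert this using 1
    have h1 : l ^ n * l⁻¹ ^ n = 1 := by rw [← mul_pow, mul_inv_cancel₀ l0, one_pow]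
    rw [map_pow, ← hL]
    linear_combination (-(L ^ n * g)) * h1

end Stable

end LineConfig

/-! ### Graded submodules of fractions in two variables -/

open MvPolynomial in
/-- An embedding of the polynomial ring in two variables into a field, with extensions of the
partial derivatives to the field. -/
structure PlaneEmbedding (K : Type*) [Field K] [Algebra ℂ K] where
  toAlgHom : MvPolynomial (Fin 2) ℂ →ₐ[ℂ] K
  injective : Function.Injective toAlgHom
  der : Fin 2 → Derivation ℂ K K
  der_apply : ∀ v p, der v (toAlgHom p) = toAlgHom (pderiv v p)

namespace PlaneEmbedding

open MvPolynomial

variable {K : Type*} [Field K] [Algebra ℂ K] (ε : PlaneEmbedding K)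

/-- Polynomials in the second variable, as elements of the field. -/
def snd : Polynomial ℂ →ₐ[ℂ] K :=
  ε.toAlgHom.comp (Polynomial.aeval (X 1))

/-- The first variable, as an element of the field. -/
def fst : K := ε.toAlgHom (X 0)

theorem fst_ne_zero : ε.fst ≠ 0 :=
  (map_ne_zero_iff _ ε.injective).mpr (X_ne_zero 0)

theorem snd_apply (p : Polynomial ℂ) : ε.snd p = ε.toAlgHom (Polynomial.aeval (X 1) p) := rfl

theorem snd_X : ε.snd Polynomial.X = ε.toAlgHom (X 1) := by
  rw [snd_apply, Polynomial.aeval_X]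

theorem snd_injective : Function.Injective ε.snd := by
  refine ε.injective.comp fun p q h => ?_
  have h' := congrArg (MvPolynomial.aeval (fun _ : Fin 2 => (Polynomial.X : Polynomial ℂ))) h
  simpa [← Polynomial.aeval_algHom_apply] using h'

theorem der_one_snd (p : Polynomial ℂ) : ε.der 1 (ε.snd p) = ε.snd (Polynomial.derivative p) := by
  rw [snd_apply, ε.der_apply, snd_apply]
  congr 1
  rw [Derivation.map_aeval, pderiv_X_self, smul_eq_mul, mul_one]

theorem der_zero_snd (p : Polynomial ℂ) : ε.der 0 (ε.snd p) = 0 := by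
  rw [snd_apply, ε.der_apply]
  rw [Derivation.map_aeval, pderiv_X_of_ne (by decide), smul_zero, map_zero]

theorem der_zero_fst : ε.der 0 ε.fst = 1 := by
  rw [fst, ε.der_apply, pderiv_X_self, map_one]

theorem der_one_fst : ε.der 1 ε.fst = 0 := by
  rw [fst, ε.der_apply, pderiv_X_of_ne (by decide), map_zero]

theorem der_zero_fst_zpow_mul (j : ℤ) {q : K} (hq : ε.der 0 q = 0) :
    ε.der 0 (ε.fst ^ j * q) = j * (ε.fst ^ (j - 1) * q) := by
  rw [Derivation.leibniz, hq, Derivation.leibniz_zpow, der_zero_fst]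
  simp only [smul_eq_mul, zsmul_eq_mul]
  ring

theorem der_one_fst_zpow_mul (j : ℤ) (q : K) :
    ε.der 1 (ε.fst ^ j * q) = ε.fst ^ j * ε.der 1 q := by
  rw [Derivation.leibniz, Derivation.leibniz_zpow, der_one_fst]
  simp only [smul_eq_mul]
  ring

/-! ### Stable submodules and homogeneous components -/

variable {ι : Type*} {Λ : LineConfig ι}

/-- Differentiate `L^n q = r`, in which `L` and `r` do not involve the first variable. Being killed
by `∂_u` is what singles out the coefficients of a homogeneous expansion. -/
theorem der_zero_of_mem_fractions {S : Finset ι} {q : K} (hq : q ∈ Λ.fractions ε.snd S) :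
    ε.der 0 q = 0 := by
  obtain ⟨n, r, hr⟩ := hq
  have h := congrArg (ε.der 0) hr
  rw [der_zero_snd, ← map_pow, Derivation.leibniz, der_zero_snd, smul_zero, add_zero,
    smul_eq_mul] at h
  exact (mul_eq_zero.mp h).resolve_left
    ((map_ne_zero_iff _ ε.snd_injective).mpr (pow_ne_zero _ (LineConfig.prod_ne_zero S)))

/-- A submodule over the polynomial ring which is stable under the connection `∂ + θ`. -/
structure IsStable (θ : Fin 2 → K) (N : AddSubgroup K) : Prop where
  mul_mem : ∀ (p : MvPolynomial (Fin 2) ℂ) {g : K}, g ∈ N → ε.toAlgHom p * g ∈ N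
  nabla_mem : ∀ (v : Fin 2) {g : K}, g ∈ N → ε.der v g + θ v * g ∈ N

theorem isStable_bot (θ : Fin 2 → K) : ε.IsStable θ ⊥ where
  mul_mem p _ h := by simp_all
  nabla_mem v _ h := by simp_all

variable {ε} {θ : Fin 2 → K} {γ : ℂ} {N : AddSubgroup K}

/-- A stable submodule contains the homogeneous components of its elements. -/
theorem IsStable.component_mem (hN : ε.IsStable θ N) (hθ : θ 0 = algebraMap ℂ K γ * ε.fst⁻¹)
    {κ : Type*} {e : κ → ℤ} (he : Function.Injective e) (s : Finset κ) {q : κ → K}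
    (hq : ∀ k ∈ s, ε.der 0 (q k) = 0) (h : ∑ k ∈ s, ε.fst ^ e k * q k ∈ N) :
    ∀ k ∈ s, ε.fst ^ e k * q k ∈ N := by
  classical
  have hu := ε.fst_ne_zero
  induction s using Finset.induction_on generalizing q with
  | empty => simp
  | insert k0 s hk0 ih =>
    have hs : ∀ k ∈ s, ε.fst ^ e k * q k ∈ N := by
      -- The operator `u (∂_u + θ_0) - (e k0 + γ)` kills the component `k0` and multiplies the
      -- component `k` by `e k - e k0`, nonzero for `k ≠ k0` as `e` is injective.
      have h1 := sub_mem (hN.mul_mem (X 0) (hN.nabla_mem 0 h))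
        (hN.mul_mem (C ((e k0 : ℂ) + γ)) h)
      have hE : ∀ k ∈ insert k0 s, ε.toAlgHom (X 0) *
          (ε.der 0 (ε.fst ^ e k * q k) + θ 0 * (ε.fst ^ e k * q k)) -
          ε.toAlgHom (C ((e k0 : ℂ) + γ)) * (ε.fst ^ e k * q k) =
          ε.fst ^ e k * (((e k - e k0 : ℤ) : K) * q k) := by
        intro k hk
        rw [ε.der_zero_fst_zpow_mul _ (hq k hk), hθ, ← fst, ← MvPolynomial.algebraMap_eq,
          AlgHom.commutes, zpow_sub_one₀ hu]
        simp only [map_add, map_intCast, Int.cast_sub]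
        field_simp
        ring
      rw [map_sum, Finset.mul_sum, ← Finset.sum_add_distrib, Finset.mul_sum, Finset.mul_sum,
        ← Finset.sum_sub_distrib, Finset.sum_congr rfl hE, Finset.sum_insert hk0, sub_self,
        Int.cast_zero, zero_mul, mul_zero, zero_add] at h1
      intro k hk
      have h2 := ih (q := fun k => ((e k - e k0 : ℤ) : K) * q k) (fun k hk => by
        rw [Derivation.leibniz, hq k (Finset.mem_insert_of_mem hk)]
        simp) h1 k hk
      have hne : ((e k - e k0 : ℤ) : ℂ) ≠ 0 := by
        rw [Int.cast_ne_zero, sub_ne_zero]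
        exact fun h => hk0 (he h ▸ hk)
      have h3 := hN.mul_mem (C ((e k - e k0 : ℤ) : ℂ)⁻¹) h2
      rw [← MvPolynomial.algebraMap_eq, AlgHom.commutes, map_inv₀, map_intCast] at h3
      have hne' : ((e k - e k0 : ℤ) : K) ≠ 0 := by
        rw [← map_intCast (algebraMap ℂ K)]
        exact (map_ne_zero _).mpr hne
      convert h3 using 1
      field_simp
    rw [Finset.sum_insert hk0] at h
    intro k hk
    rcases Finset.mem_insert.mp hk with rfl | hk
    · exact (add_mem_cancel_right (sum_mem hs)).mp h
    · exact hs k hk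

/-! ### Graded submodules -/

variable (ε) in
/-- The sums of products `u ^ j * q` with `q ∈ C j`, where `u` is the first variable. -/
def graded (C : ℤ → AddSubgroup K) : AddSubgroup K :=
  AddSubgroup.closure {g | ∃ (j : ℤ) (q : K), q ∈ C j ∧ g = ε.fst ^ j * q}

variable {C C' : ℤ → AddSubgroup K}

theorem zpow_mul_mem_graded {j : ℤ} {q : K} (hq : q ∈ C j) : ε.fst ^ j * q ∈ ε.graded C :=
  AddSubgroup.subset_closure ⟨j, q, hq, rfl⟩

theorem graded_le : ε.graded C ≤ N ↔ ∀ j, ∀ q ∈ C j, ε.fst ^ j * q ∈ N := by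
  rw [graded, AddSubgroup.closure_le]
  constructor
  · exact fun h j q hq => h ⟨j, q, hq, rfl⟩
  · rintro h _ ⟨j, q, hq, rfl⟩
    exact h j q hq

theorem graded_mono (h : ∀ j, C j ≤ C' j) : ε.graded C ≤ ε.graded C' :=
  graded_le.mpr fun j _ hq => zpow_mul_mem_graded (h j hq)

theorem graded_bot : ε.graded (fun _ => ⊥) = ⊥ := by
  rw [eq_bot_iff, graded_le]
  rintro j q hq
  rw [AddSubgroup.mem_bot] at hq ⊢
  rw [hq, mul_zero]

theorem exists_eq_sum_of_mem_graded {g : K} (hg : g ∈ ε.graded C) :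
    ∃ q : ℤ →₀ K, (∀ j, q j ∈ C j) ∧ g = q.sum fun j x => ε.fst ^ j * x := by
  classical
  induction hg using AddSubgroup.closure_induction with
  | mem g hg =>
    obtain ⟨j, q, hq, rfl⟩ := hg
    refine ⟨Finsupp.single j q, fun k => ?_, by simp⟩
    by_cases h : j = k
    · subst h
      simpa using hq
    · rw [Finsupp.single_eq_of_ne' h]
      exact zero_mem _
  | zero => exact ⟨0, fun _ => zero_mem _, by simp⟩
  | add g h _ _ ihg ihh =>
    obtain ⟨q, hq, rfl⟩ := ihg
    obtain ⟨q', hq', rfl⟩ := ihh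
    refine ⟨q + q', fun j => add_mem (hq j) (hq' j), ?_⟩
    rw [Finsupp.sum_add_index' (by simp) (by intros; ring)]
  | neg g _ ih =>
    obtain ⟨q, hq, rfl⟩ := ih
    refine ⟨-q, fun j => neg_mem (hq j), ?_⟩
    rw [Finsupp.sum_neg_index (by simp), Finsupp.sum, Finsupp.sum, ← Finset.sum_neg_distrib]
    simp

/-- The elements of a graded submodule of a given degree. -/
theorem mem_of_zpow_mul_mem_graded (hC : ∀ j, ∀ q ∈ C j, ε.der 0 q = 0) {j : ℤ} {q : K}
    (hq : ε.der 0 q = 0) (h : ε.fst ^ j * q ∈ ε.graded C) : q ∈ C j := by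
  classical
  obtain ⟨f, hf, hsum⟩ := exists_eq_sum_of_mem_graded h
  have hu := ε.fst_ne_zero
  have h0 : ∑ k ∈ insert j f.support, ε.fst ^ k * (f k - if k = j then q else 0) = 0 := by
    simp only [mul_sub, Finset.sum_sub_distrib]
    rw [Finset.sum_subset (Finset.subset_insert j f.support)
      (f := fun k => ε.fst ^ k * f k) (fun k _ hk => by
        rw [Finsupp.notMem_support_iff.mp hk, mul_zero]) |>.symm]
    rw [Finsupp.sum] at hsum
    rw [← hsum]
    simp
  -- Uniqueness of homogeneous expansions is the component statement for the zero submodule, which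
  -- is stable for every connection form; the form with `γ = 0` is chosen.
  have hmem := (ε.isStable_bot fun v => if v = 0 then algebraMap ℂ K 0 * ε.fst⁻¹ else 0).component_mem
    (γ := 0) (by simp) (e := fun k : ℤ => k) Function.injective_id (insert j f.support)
    (q := fun k => f k - if k = j then q else 0) (fun k _ => by
      rw [map_sub, hC k _ (hf k)]
      split_ifs
      · rw [hq, sub_zero]
      · rw [map_zero, sub_zero]) (by rw [h0]; exact zero_mem _) j (Finset.mem_insert_self _ _)
  rw [AddSubgroup.mem_bot, if_pos rfl] at hmem
  have := (mul_eq_zero.mp hmem).resolve_left (zpow_ne_zero _ hu)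
  rw [← sub_eq_zero.mp this]
  exact hf j

/-- The compatibility conditions on the homogeneous components of a stable submodule. -/
structure IsAdmissible (ε : PlaneEmbedding K) (γ : ℂ) (η : K) (C : ℤ → AddSubgroup K) : Prop where
  isStable : ∀ j, LineConfig.IsStable ε.snd (ε.der 1) η (C j)
  der_zero : ∀ j, ∀ q ∈ C j, ε.der 0 q = 0
  le_succ : ∀ j, C j ≤ C (j + 1)
  succ_le : ∀ j : ℤ, (j + 1 : ℂ) + γ ≠ 0 → C (j + 1) ≤ C j

/-- Functions of `w` and `∂_w` preserve degrees, `u` raises the degree by one, and `∂_u + γ/u` sends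
`u^j q` to `(j + γ) u^(j-1) q`. The last requires a descent of components only when `j + γ ≠ 0`,
which is the condition imposed. -/
theorem IsAdmissible.isStable_graded (hC : ε.IsAdmissible γ (θ 1) C)
    (hθ : θ 0 = algebraMap ℂ K γ * ε.fst⁻¹) : ε.IsStable θ (ε.graded C) where
  mul_mem p := by
    have hu := ε.fst_ne_zero
    induction p using MvPolynomial.induction_on with
    | C a =>
      intro g hg
      refine (graded_le (N := (ε.graded C).comap (AddMonoidHom.mulLeft _))).mpr
        (fun j q hq => ?_) hg
      rw [AddSubgroup.mem_comap, AddMonoidHom.coe_mulLeft, mul_left_comm]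
      refine zpow_mul_mem_graded ?_
      have := (hC.isStable j).mul_mem (Polynomial.C a) hq
      rwa [← Polynomial.algebraMap_eq, AlgHom.commutes, ← ε.toAlgHom.commutes,
        MvPolynomial.algebraMap_eq] at this
    | add p p' hp hp' =>
      intro g hg
      rw [map_add, add_mul]
      exact add_mem (hp hg) (hp' hg)
    | mul_X p i hp =>
      intro g hg
      rw [map_mul, mul_assoc]
      refine hp ?_
      refine (graded_le (N := (ε.graded C).comap (AddMonoidHom.mulLeft _))).mpr
        (fun j q hq => ?_) hg
      rw [AddSubgroup.mem_comap, AddMonoidHom.coe_mulLeft]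
      fin_cases i
      · change ε.fst * (ε.fst ^ j * q) ∈ ε.graded C
        rw [← mul_assoc, ← zpow_one_add₀ hu, add_comm]
        exact zpow_mul_mem_graded (hC.le_succ j hq)
      · change ε.toAlgHom (X 1) * (ε.fst ^ j * q) ∈ ε.graded C
        rw [mul_left_comm, ← snd_X]
        exact zpow_mul_mem_graded ((hC.isStable j).mul_mem _ hq)
  nabla_mem v g hg := by
    have hu := ε.fst_ne_zero
    refine (graded_le (N := (ε.graded C).comap
      ((ε.der v).toLinearMap.toAddMonoidHom + AddMonoidHom.mulLeft (θ v)))).mpr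
        (fun j q hq => ?_) hg
    change ε.der v (ε.fst ^ j * q) + θ v * (ε.fst ^ j * q) ∈ ε.graded C
    fin_cases v
    · change ε.der 0 (ε.fst ^ j * q) + θ 0 * (ε.fst ^ j * q) ∈ ε.graded C
      have h : ε.der 0 (ε.fst ^ j * q) + θ 0 * (ε.fst ^ j * q) =
          algebraMap ℂ K (j + γ) * (ε.fst ^ (j - 1) * q) := by
        rw [der_zero_fst_zpow_mul _ _ (hC.der_zero j q hq), hθ, map_add, map_intCast,
          zpow_sub_one₀ hu]
        ring
      rw [h]
      by_cases h0 : (j + γ : ℂ) = 0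
      · rw [h0, map_zero, zero_mul]
        exact zero_mem _
      · rw [mul_left_comm]
        refine zpow_mul_mem_graded ?_
        rw [← ε.snd.commutes]
        refine (hC.isStable _).mul_mem _ (hC.succ_le (j - 1) ?_ ?_)
        · push_cast
          rwa [sub_add_cancel]
        · rwa [sub_add_cancel]
    · change ε.der 1 (ε.fst ^ j * q) + θ 1 * (ε.fst ^ j * q) ∈ ε.graded C
      rw [der_one_fst_zpow_mul, mul_left_comm, ← mul_add]
      exact zpow_mul_mem_graded ((hC.isStable j).nabla_mem hq)

/-- The elements of degree `j` of a submodule. -/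
def _root_.AddSubgroup.component (ε : PlaneEmbedding K) (N : AddSubgroup K) (j : ℤ) :
    AddSubgroup K :=
  N.comap (AddMonoidHom.mulLeft (ε.fst ^ j))

theorem mem_component {j : ℤ} {q : K} : q ∈ N.component ε j ↔ ε.fst ^ j * q ∈ N := Iff.rfl

theorem IsStable.component (hN : ε.IsStable θ N) (j : ℤ) :
    LineConfig.IsStable ε.snd (ε.der 1) (θ 1) (N.component ε j) where
  mul_mem p q hq := by
    rw [mem_component, mul_left_comm, snd_apply]
    exact hN.mul_mem _ hq
  nabla_mem {q} hq := by
    rw [mem_component, mul_add, mul_left_comm, ← der_one_fst_zpow_mul]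
    exact hN.nabla_mem 1 hq

theorem IsStable.component_le_succ (hN : ε.IsStable θ N) (j : ℤ) :
    N.component ε j ≤ N.component ε (j + 1) := fun q hq => by
  rw [mem_component, add_comm, zpow_one_add₀ ε.fst_ne_zero, mul_assoc]
  exact hN.mul_mem (X 0) hq

/-- The connection in the direction of `u` maps `u^(j+1) q` to `(j + 1 + γ) u^j q`, and the scalar
can be inverted. -/
theorem IsStable.mem_component_of_succ (hN : ε.IsStable θ N)
    (hθ : θ 0 = algebraMap ℂ K γ * ε.fst⁻¹) {j : ℤ} (hj : (j + 1 : ℂ) + γ ≠ 0) {q : K}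
    (hq0 : ε.der 0 q = 0) (hq : q ∈ N.component ε (j + 1)) : q ∈ N.component ε j := by
  have h := hN.mul_mem (MvPolynomial.C ((j + 1 : ℂ) + γ)⁻¹) (hN.nabla_mem 0 hq)
  have hc : algebraMap ℂ K ((j + 1 : ℂ) + γ) ≠ 0 := (map_ne_zero _).mpr hj
  have hu := ε.fst_ne_zero
  rw [AddMonoidHom.coe_mulLeft, ε.der_zero_fst_zpow_mul _ hq0, hθ, ← MvPolynomial.algebraMap_eq,
    AlgHom.commutes, map_inv₀] at h
  rw [mem_component]
  convert h using 1
  rw [eq_inv_mul_iff_mul_eq₀ hc, add_sub_cancel_right, zpow_add_one₀ hu]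
  simp only [map_add, map_intCast, map_one, Int.cast_add, Int.cast_one]
  field_simp

/-- If the components of `C` and `C'` differ only in the degrees in `J`, where they are consecutive
stable submodules independent of the degree, and the degrees in `J` are linked, then no stable
submodule lies strictly between. -/
theorem IsStable.eq_graded_or (hN : ε.IsStable θ N) (hθ : θ 0 = algebraMap ℂ K γ * ε.fst⁻¹)
    {J : Set ℤ} [J.OrdConnected] (hJ : ∀ j ∈ J, j + 1 ∈ J → (j + 1 : ℂ) + γ ≠ 0)
    {low high : AddSubgroup K} (hlow : ∀ j ∈ J, C j = low) (hhigh : ∀ j ∈ J, C' j = high)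
    (hCC' : ∀ j ∉ J, C j = C' j) (h0 : ∀ j, ∀ q ∈ C' j, ε.der 0 q = 0) (hle : low ≤ high)
    (hhs : LineConfig.IsStable ε.snd (ε.der 1) (θ 1) high)
    (hirr : ∀ P, LineConfig.IsStable ε.snd (ε.der 1) (θ 1) P → low ≤ P → P ≤ high →
      P = low ∨ P = high)
    (hC : ε.graded C ≤ N) (hC' : N ≤ ε.graded C') : N = ε.graded C ∨ N = ε.graded C' := by
  by_cases hne : J.Nonempty
  swap
  · rw [Set.not_nonempty_iff_eq_empty] at hne
    have : C = C' := funext fun j => hCC' j (by simp [hne])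
    exact Or.inl (le_antisymm (this ▸ hC') hC)
  obtain ⟨j0, hj0⟩ := hne
  -- A component of `N` also contains coefficients that depend on `u`; intersecting with `high`
  -- keeps only those killed by `∂_u`. On `J` the result does not depend on the degree, so
  -- irreducibility in one variable decides all degrees at once.
  set P : ℤ → AddSubgroup K := fun j => N.component ε j ⊓ high with hP
  have hsucc : ∀ j ∈ J, j + 1 ∈ J → P j = P (j + 1) := fun j hj hj1 =>
    le_antisymm (inf_le_inf_right _ (hN.component_le_succ j)) fun q hq =>
      ⟨hN.mem_component_of_succ hθ (hJ j hj hj1) (h0 j q (hhigh j hj ▸ hq.2)) hq.1, hq.2⟩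
  have hconst' : ∀ j ∈ J, ∀ j' ∈ J, j ≤ j' → P j = P j' := by
    intro j hj j' hj' hjj'
    induction j', hjj' using Int.leInduction with
    | base => rfl
    | succ k hk ih =>
      have hkJ : k ∈ J := Set.OrdConnected.out ‹_› hj hj' ⟨hk, by omega⟩
      rw [ih hkJ, hsucc k hkJ hj']
  have hconst : ∀ j ∈ J, P j = P j0 := fun j hj =>
    (le_total j j0).elim (hconst' j hj j0 hj0) fun h => (hconst' j0 hj0 j hj h).symm
  rcases hirr (P j0) ⟨fun p _ hq => ⟨(hN.component j0).mul_mem p hq.1, hhs.mul_mem p hq.2⟩,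
      fun hq => ⟨(hN.component j0).nabla_mem hq.1, hhs.nabla_mem hq.2⟩⟩
      (le_inf (fun q hq => hC (zpow_mul_mem_graded (hlow j0 hj0 ▸ hq))) hle) inf_le_right
    with h | h
  · left
    refine le_antisymm (fun g hg => ?_) hC
    obtain ⟨f, hf, rfl⟩ := exists_eq_sum_of_mem_graded (hC' hg)
    have hmem := hN.component_mem hθ (e := fun k : ℤ => k) Function.injective_id f.support
      (q := f) (fun k _ => h0 k _ (hf k)) hg
    refine sum_mem fun j hj => zpow_mul_mem_graded ?_
    by_cases hjJ : j ∈ J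
    · rw [hlow j hjJ, ← h, ← hconst j hjJ]
      exact ⟨hmem j hj, hhigh j hjJ ▸ hf j⟩
    · rw [hCC' j hjJ]
      exact hf j
  · right
    refine le_antisymm hC' (graded_le.mpr fun j q hq => ?_)
    by_cases hjJ : j ∈ J
    · rw [hhigh j hjJ, ← h, ← hconst j hjJ] at hq
      exact hq.1
    · rw [← hCC' j hjJ] at hq
      exact hC (zpow_mul_mem_graded hq)

/-! #### Coefficients of polynomials -/

theorem _root_.MvPolynomial.exists_eq_sum_X_pow_mul (r : MvPolynomial (Fin 2) ℂ) :
    ∃ f : ℕ →₀ Polynomial ℂ, r = f.sum fun k p => X 0 ^ k * Polynomial.aeval (X 1) p := by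
  induction r using MvPolynomial.induction_on with
  | C a => exact ⟨Finsupp.single 0 (Polynomial.C a), by simp [MvPolynomial.algebraMap_eq]⟩
  | add p q hp hq =>
    obtain ⟨f, rfl⟩ := hp
    obtain ⟨g, rfl⟩ := hq
    refine ⟨f + g, ?_⟩
    rw [Finsupp.sum_add_index' (by simp) (by intros; rw [map_add, mul_add])]
  | mul_X p i hp =>
    obtain ⟨f, rfl⟩ := hp
    fin_cases i
    · refine ⟨f.mapDomain (· + 1), ?_⟩
      rw [Finsupp.sum_mapDomain_index (by simp) (by intros; rw [map_add, mul_add]),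
        Finsupp.sum_mul]
      refine Finsupp.sum_congr fun k _ => ?_
      simp only [Fin.zero_eta]
      ring
    · refine ⟨f.mapRange (· * Polynomial.X) (by simp), ?_⟩
      rw [Finsupp.sum_mapRange_index (by simp), Finsupp.sum_mul]
      refine Finsupp.sum_congr fun k _ => ?_
      simp only [Fin.mk_one, map_mul, Polynomial.aeval_X]
      ring

/-- A multiple of the homogeneous element `u ^ j * q` lies in a graded submodule only if its
coefficients do. -/
theorem eval_eq_zero_of_mul_mem_graded (hC : ∀ j, ∀ q ∈ C j, ε.der 0 q = 0)
    (hs : ε.IsStable θ (ε.graded C)) (hθ : θ 0 = algebraMap ℂ K γ * ε.fst⁻¹) {j : ℤ} {q : K}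
    (hq : ε.der 0 q = 0) {a : Fin 2 → ℂ}
    (ha : ∀ k : ℕ, (a 0 = 0 ∧ k ≠ 0) ∨
      ∀ p : Polynomial ℂ, ε.snd p * q ∈ C (j + k) → p.eval (a 1) = 0)
    {r : MvPolynomial (Fin 2) ℂ} (h : ε.toAlgHom r * (ε.fst ^ j * q) ∈ ε.graded C) :
    eval a r = 0 := by
  obtain ⟨f, rfl⟩ := r.exists_eq_sum_X_pow_mul
  have hsnd : ∀ p, ε.der 0 (ε.snd p * q) = 0 := fun p => by
    rw [Derivation.leibniz, hq, ε.der_zero_snd, smul_zero, smul_zero, add_zero]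
  have heq : ε.toAlgHom (f.sum fun k p => X 0 ^ k * Polynomial.aeval (X 1) p) *
      (ε.fst ^ j * q) = ∑ k ∈ f.support, ε.fst ^ (j + k : ℤ) * (ε.snd (f k) * q) := by
    rw [Finsupp.sum, map_sum, Finset.sum_mul]
    refine Finset.sum_congr rfl fun k _ => ?_
    rw [map_mul, map_pow, zpow_add₀ ε.fst_ne_zero, zpow_natCast, snd_apply, ← fst]
    ring
  rw [heq] at h
  have hmem := hs.component_mem hθ (e := fun k : ℕ => j + k) (fun k k' hk => by simpa using hk)
    f.support (q := fun k => ε.snd (f k) * q) (fun k _ => hsnd _) h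
  rw [Finsupp.sum, map_sum]
  refine Finset.sum_eq_zero fun k hk => ?_
  rw [map_mul, map_pow, eval_X]
  rcases ha k with ⟨h0, hk0⟩ | hk'
  · rw [h0, zero_pow hk0, zero_mul]
  · have h1 := hk' _ (mem_of_zpow_mul_mem_graded hC (hsnd _) (hmem k hk))
    have h2 : eval a (Polynomial.aeval (X 1) (f k) : MvPolynomial (Fin 2) ℂ) =
        (f k).eval (a 1) := by
      rw [← MvPolynomial.coe_aeval_eq_eval, RingHom.coe_coe, ← Polynomial.aeval_algHom_apply]
      simp
    rw [h2, h1, mul_zero]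

/-! #### All fractions -/

variable (ε Λ) in
/-- The fractions whose denominator is a power of `u ∏_{t ∈ S} (a_t + b_t w)`. -/
def planeFractions (S : Finset ι) : Subring K where
  carrier := {g | ∃ (n : ℕ) (r : MvPolynomial (Fin 2) ℂ),
    (ε.fst * ε.snd (Λ.prod S)) ^ n * g = ε.toAlgHom r}
  zero_mem' := ⟨0, 0, by simp⟩
  one_mem' := ⟨0, 1, by simp⟩
  add_mem' := by
    rintro g h ⟨n, r, hg⟩ ⟨m, s, hh⟩
    refine ⟨n + m, (X 0 * Polynomial.aeval (X 1) (Λ.prod S)) ^ m * r +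
      (X 0 * Polynomial.aeval (X 1) (Λ.prod S)) ^ n * s, ?_⟩
    simp only [map_add, map_mul, map_pow, ← hg, ← hh, ← snd_apply,
      show ε.toAlgHom (X 0) = ε.fst from rfl]
    ring
  neg_mem' := by
    rintro g ⟨n, r, hg⟩
    exact ⟨n, -r, by rw [map_neg, ← hg]; ring⟩
  mul_mem' := by
    rintro g h ⟨n, r, hg⟩ ⟨m, s, hh⟩
    exact ⟨n + m, r * s, by rw [map_mul, ← hg, ← hh]; ring⟩

theorem toAlgHom_mem_planeFractions (S : Finset ι) (r : MvPolynomial (Fin 2) ℂ) :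
    ε.toAlgHom r ∈ ε.planeFractions Λ S := ⟨0, r, by simp⟩

theorem inv_mem_planeFractions {S : Finset ι} {r s : MvPolynomial (Fin 2) ℂ} (hr : r ≠ 0)
    (h : r * s = X 0 * Polynomial.aeval (X 1) (Λ.prod S)) :
    (ε.toAlgHom r)⁻¹ ∈ ε.planeFractions Λ S := by
  refine ⟨1, s, ?_⟩
  have h0 : ε.toAlgHom r ≠ 0 := (map_ne_zero_iff _ ε.injective).mpr hr
  rw [pow_one, fst, snd_apply, ← map_mul, ← h, map_mul, mul_comm, ← mul_assoc,
    inv_mul_cancel₀ h0, one_mul]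

theorem fst_zpow_mem_planeFractions (S : Finset ι) (j : ℤ) :
    ε.fst ^ j ∈ ε.planeFractions Λ S := by
  rcases j with j | j
  · rw [Int.ofNat_eq_natCast, zpow_natCast]
    exact pow_mem (toAlgHom_mem_planeFractions S _) _
  · rw [zpow_negSucc, ← inv_pow]
    exact pow_mem (inv_mem_planeFractions (X_ne_zero 0) rfl) _

theorem line_zpow_mem_planeFractions {S : Finset ι} {t : ι} (ht : t ∈ S) (j : ℤ) :
    ε.snd (Λ.line t) ^ j ∈ ε.planeFractions Λ S := by
  classical
  rcases j with j | j
  · rw [Int.ofNat_eq_natCast, zpow_natCast, snd_apply]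
    exact pow_mem (toAlgHom_mem_planeFractions S _) _
  · rw [zpow_negSucc, ← inv_pow, snd_apply]
    refine pow_mem (inv_mem_planeFractions (r := Polynomial.aeval (X 1) (Λ.line t))
      (s := X 0 * Polynomial.aeval (X 1) (Λ.prod (S.erase t))) ?_ ?_) _
    · intro h
      have h1 : ε.snd (Λ.line t) = 0 := by rw [snd_apply, h, map_zero]
      exact LineConfig.map_line_ne_zero ε.snd_injective t h1
    · rw [mul_left_comm, ← map_mul, LineConfig.prod, LineConfig.prod, Finset.mul_prod_erase _ _ ht]

/-- Expand the numerator in powers of `u`. This identifies the whole D-module with the graded module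
having the same component in every degree. -/
theorem graded_fractions (S : Finset ι) :
    ε.graded (fun _ => Λ.fractions ε.snd S) = (ε.planeFractions Λ S).toAddSubgroup := by
  have hu := ε.fst_ne_zero
  have hL : ε.snd (Λ.prod S) ≠ 0 := LineConfig.map_prod_ne_zero ε.snd_injective S
  refine le_antisymm (graded_le.mpr fun j q hq => ?_) fun g hg => ?_
  · refine (ε.planeFractions Λ S).mul_mem (fst_zpow_mem_planeFractions S j) ?_
    obtain ⟨n, r, hr⟩ := hq
    refine ⟨n, X 0 ^ n * Polynomial.aeval (X 1) r, ?_⟩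
    rw [map_mul, ← snd_apply, ← hr, map_pow, ← fst]
    ring
  · obtain ⟨n, r, hr⟩ := hg
    obtain ⟨f, rfl⟩ := r.exists_eq_sum_X_pow_mul
    have h1 : g = ∑ k ∈ f.support, ε.fst ^ ((k : ℤ) - n) *
        (ε.snd (f k) * (ε.snd (Λ.prod S))⁻¹ ^ n) := by
      have h2 : (ε.fst * ε.snd (Λ.prod S)) ^ n ≠ 0 := pow_ne_zero _ (mul_ne_zero hu hL)
      refine mul_left_cancel₀ h2 (hr.trans ?_)
      rw [Finsupp.sum, map_sum, Finset.mul_sum]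
      refine Finset.sum_congr rfl fun k _ => ?_
      rw [map_mul, map_pow, zpow_sub₀ hu, zpow_natCast, zpow_natCast, ← snd_apply, ← fst, mul_pow,
        inv_pow]
      field_simp
    rw [h1]
    refine sum_mem fun k _ => zpow_mul_mem_graded (LineConfig.mul_mem_fractions
      (LineConfig.map_mem_fractions S _) ?_)
    generalize n = m
    induction m with
    | zero => simpa using LineConfig.one_mem_fractions S
    | succ m ih =>
      rw [pow_succ]
      exact LineConfig.mul_mem_fractions ih
        (LineConfig.inv_prod_mem_fractions ε.snd_injective S)

end PlaneEmbedding

/-! ### The function field of the blow-up -/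

section FunctionField

open MvPolynomial

/-- The field of rational functions on the blow-up. -/
abbrev BlowupField : Type := FractionRing OverlapRing

/-- The inclusion of the functions on a chart into the function field. -/
def chartIncl (i : Chart) : MvPolynomial (Fin 2) ℂ →ₐ[ℂ] BlowupField :=
  (IsScalarTower.toAlgHom ℂ OverlapRing BlowupField).comp
    ((restrictHom i).comp (chartPoly i).toAlgHom)

theorem chartIncl_apply (i : Chart) (p : MvPolynomial (Fin 2) ℂ) :
    chartIncl i p = algebraMap OverlapRing BlowupField (restrictHom i (chartPoly i p)) := rfl

theorem chartIncl_injective (i : Chart) : Function.Injective (chartIncl i) :=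
  (IsFractionRing.injective OverlapRing BlowupField).comp
    ((restrictHom_injective i).comp (chartPoly i).injective)

theorem chartIncl_one_mul_two : chartIncl .one (X 1) * chartIncl .two (X 1) = 1 := by
  rw [chartIncl_apply, chartIncl_apply, ← map_mul, chartPoly_X, chartPoly_X,
    restrictHom_coord_one_mul, map_one]

theorem chartIncl_two_X_zero :
    chartIncl .two (X 0) = chartIncl .one (X 0) * chartIncl .one (X 1) := by
  simp only [chartIncl_apply, chartPoly_X]
  rw [restrictHom_coord_two_zero, map_mul]

/-- The partial derivatives on the first chart as derivations of the intersection of the charts. -/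
def overlapDer (v : Fin 2) : Derivation ℂ OverlapRing OverlapRing :=
  extendDerivation (Submonoid.powers (X 1 : MvPolynomial (Fin 2) ℂ)) (pderiv v)

theorem overlapDer_apply (v : Fin 2) (p : MvPolynomial (Fin 2) ℂ) :
    overlapDer v (restrictHom .one (chartPoly .one p)) =
      restrictHom .one (chartPoly .one (pderiv v p)) :=
  extendDerivation_algebraMap (Submonoid.powers (X 1 : MvPolynomial (Fin 2) ℂ)) (pderiv v) p

/-- The partial derivatives on the first chart as derivations of the function field. -/
def fieldDer (v : Fin 2) : Derivation ℂ BlowupField BlowupField :=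
  extendDerivation (nonZeroDivisors OverlapRing) (overlapDer v)

theorem fieldDer_apply (v : Fin 2) (p : MvPolynomial (Fin 2) ℂ) :
    fieldDer v (chartIncl .one p) = chartIncl .one (pderiv v p) := by
  rw [chartIncl_apply, fieldDer, extendDerivation_algebraMap, overlapDer_apply]
  rfl

/-- A derivation extending a derivation of the polynomial ring on the variables extends it. -/
theorem derivation_apply_algHom {L : Type*} [Field L] [Algebra ℂ L]
    (φ : MvPolynomial (Fin 2) ℂ →ₐ[ℂ] L) (D : Derivation ℂ L L)
    (D' : Derivation ℂ (MvPolynomial (Fin 2) ℂ) (MvPolynomial (Fin 2) ℂ))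
    (h : ∀ j, D (φ (X j)) = φ (D' (X j))) (p : MvPolynomial (Fin 2) ℂ) :
    D (φ p) = φ (D' p) := by
  induction p using MvPolynomial.induction_on with
  | C a =>
    rw [← MvPolynomial.algebraMap_eq, AlgHom.commutes, Derivation.map_algebraMap,
      Derivation.map_algebraMap, map_zero]
  | add p q hp hq => rw [map_add, map_add, map_add, map_add, hp, hq]
  | mul_X p j hp =>
    rw [map_mul, Derivation.leibniz, Derivation.leibniz, map_add, hp, h]
    simp only [smul_eq_mul, map_mul]

/-- The partial derivatives on a chart as derivations of the function field. -/
def chartFieldDer : Chart → Fin 2 → Derivation ℂ BlowupField BlowupField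
  | .one, v => fieldDer v
  -- The chain rule for `x = y w₀`, `w₁ = w₀⁻¹`: `∂_y = w₁⁻¹ ∂_x` and `∂_w₀ = x w₁ ∂_x - w₁² ∂_w₁`.
  | .two, v => ![(chartIncl .one (X 1))⁻¹ • fieldDer 0,
      (chartIncl .one (X 0) * chartIncl .one (X 1)) • fieldDer 0 -
        chartIncl .one (X 1) ^ 2 • fieldDer 1] v

/-- The embedding of the functions on a chart into the function field. -/
def chartEmbedding (i : Chart) : PlaneEmbedding BlowupField where
  toAlgHom := chartIncl i
  injective := chartIncl_injective i
  der := chartFieldDer i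
  der_apply v p := by
    cases i with
    | one => exact fieldDer_apply v p
    | two =>
      have hw : chartIncl .one (X 1) ≠ 0 :=
        (map_ne_zero_iff _ (chartIncl_injective _)).mpr (X_ne_zero 1)
      have h0 : ∀ v, fieldDer v (chartIncl .two (X 0)) =
          chartIncl .one (X 0) * chartIncl .one (pderiv v (X 1)) +
          chartIncl .one (X 1) * chartIncl .one (pderiv v (X 0)) := fun v => by
        rw [chartIncl_two_X_zero, Derivation.leibniz, fieldDer_apply, fieldDer_apply]
        rfl
      have h1 : ∀ v, fieldDer v (chartIncl .two (X 1)) =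
          -(chartIncl .one (X 1))⁻¹ ^ 2 * chartIncl .one (pderiv v (X 1)) := fun v => by
        rw [eq_inv_of_mul_eq_one_right chartIncl_one_mul_two, Derivation.leibniz_inv,
          fieldDer_apply]
        rfl
      refine derivation_apply_algHom _ _ _ (fun j => ?_) p
      fin_cases v <;> fin_cases j
      · simp [chartFieldDer, h0, hw]
      · simp [chartFieldDer, h1]
      · simp [chartFieldDer, h0]
        ring
      · simp [chartFieldDer, h1, hw]

theorem chartEmbedding_toAlgHom (i : Chart) : (chartEmbedding i).toAlgHom = chartIncl i := rfl

/-- The other chart. -/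
def Chart.other : Chart → Chart
  | .one => .two
  | .two => .one

/-- The second coordinate on a chart, as a rational function on the blow-up. -/
def chartSnd (i : Chart) : BlowupField := chartIncl i (X 1)

theorem chartSnd_ne_zero (i : Chart) : chartSnd i ≠ 0 :=
  (map_ne_zero_iff _ (chartIncl_injective _)).mpr (X_ne_zero 1)

theorem chartSnd_other (i : Chart) : chartSnd i.other = (chartSnd i)⁻¹ := by
  cases i with
  | one => exact eq_inv_of_mul_eq_one_right chartIncl_one_mul_two
  | two => exact eq_inv_of_mul_eq_one_left chartIncl_one_mul_two

theorem chartEmbedding_fst_other (i : Chart) :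
    (chartEmbedding i.other).fst = (chartEmbedding i).fst * chartSnd i := by
  cases i with
  | one => exact chartIncl_two_X_zero
  | two =>
    change chartIncl .one (X 0) = chartIncl .two (X 0) * chartIncl .two (X 1)
    rw [chartIncl_two_X_zero, mul_assoc, chartIncl_one_mul_two, mul_one]

/-- The configuration with the two coordinates exchanged. -/
def LineConfig.swap {ι : Type*} (Λ : LineConfig ι) : LineConfig ι where
  a := Λ.b
  b := Λ.a
  ne_zero t := (Λ.ne_zero t).symm
  det_ne_zero s t hst := by
    have := Λ.det_ne_zero s t hst
    intro h
    apply this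
    linear_combination -h

/-- The equations on a chart of the proper transforms of the lines `a_t x + b_t y = 0`. -/
def chartLines {ι : Type*} (Λ : LineConfig ι) : Chart → LineConfig ι
  | .one => Λ
  | .two => Λ.swap

theorem chartEmbedding_snd_line {ι : Type*} (Λ : LineConfig ι) (i : Chart) (t : ι) :
    (chartEmbedding i).snd ((chartLines Λ i).line t) =
      algebraMap ℂ _ ((chartLines Λ i).a t) + algebraMap ℂ _ ((chartLines Λ i).b t) *
        chartSnd i := by
  rw [LineConfig.line, map_add, map_mul, PlaneEmbedding.snd_X]
  have hC : ∀ c, (chartEmbedding i).snd (Polynomial.C c) = algebraMap ℂ BlowupField c :=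
    (chartEmbedding i).snd.commutes
  rw [hC, hC]
  rfl

theorem chartEmbedding_line_other {ι : Type*} (Λ : LineConfig ι) (i : Chart) (t : ι) :
    (chartEmbedding i.other).snd ((chartLines Λ i.other).line t) =
      (chartEmbedding i).snd ((chartLines Λ i).line t) * chartSnd i.other := by
  have h := chartSnd_ne_zero i
  rw [chartEmbedding_snd_line, chartEmbedding_snd_line, chartSnd_other]
  cases i with
  | one =>
    simp only [chartLines, Chart.other, LineConfig.swap] at h ⊢
    field_simp
    ring
  | two =>
    simp only [chartLines, Chart.other, LineConfig.swap] at h ⊢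
    field_simp
    ring

theorem chartEmbedding_prod_other {ι : Type*} (Λ : LineConfig ι) (i : Chart) (S : Finset ι) :
    (chartEmbedding i.other).snd ((chartLines Λ i.other).prod S) =
      (chartEmbedding i).snd ((chartLines Λ i).prod S) * chartSnd i.other ^ S.card := by
  rw [LineConfig.prod, LineConfig.prod, map_prod, map_prod,
    Finset.prod_congr rfl fun t _ => chartEmbedding_line_other Λ i t, Finset.prod_mul_distrib,
    Finset.prod_const]

/-- A polynomial in `w` becomes a polynomial in `w⁻¹` after division by a high power of `w`; on a
monomial the exponent is its degree. -/
theorem exists_pow_chartSnd_mul_snd (i : Chart) (r : Polynomial ℂ) :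
    ∃ (d : ℕ) (r' : Polynomial ℂ),
      chartSnd i.other ^ d * (chartEmbedding i).snd r = (chartEmbedding i.other).snd r' := by
  have hw : (chartEmbedding i.other).snd Polynomial.X = chartSnd i.other :=
    PlaneEmbedding.snd_X _
  induction r using Polynomial.induction_on' with
  | add p q hp hq =>
    obtain ⟨d, p', hp⟩ := hp
    obtain ⟨d', q', hq⟩ := hq
    refine ⟨d + d', Polynomial.X ^ d' * p' + Polynomial.X ^ d * q', ?_⟩
    simp only [map_add, map_mul, map_pow, ← hp, ← hq, hw]
    ring
  | monomial n c =>
    refine ⟨n, Polynomial.C c, ?_⟩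
    have hC : ∀ i, (chartEmbedding i).snd (Polynomial.C c) = algebraMap ℂ BlowupField c :=
      fun i => (chartEmbedding i).snd.commutes c
    have hw' : (chartEmbedding i).snd Polynomial.X = chartSnd i := PlaneEmbedding.snd_X _
    have h := chartSnd_ne_zero i
    rw [← Polynomial.C_mul_X_pow_eq_monomial, map_mul, map_pow, hC, hC, hw', chartSnd_other, inv_pow]
    field_simp

/-- A fraction becomes a fraction on the other chart after multiplication with a power of the
coordinate. -/
theorem exists_pow_chartSnd_mul_mem_fractions {ι : Type*} (Λ : LineConfig ι) (i : Chart)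
    (S : Finset ι) (m : ℤ) {q : BlowupField}
    (hq : q ∈ (chartLines Λ i).fractions (chartEmbedding i).snd S) :
    ∃ M : ℕ, chartSnd i.other ^ M * (chartSnd i.other ^ m * q) ∈
      (chartLines Λ i.other).fractions (chartEmbedding i.other).snd S := by
  obtain ⟨n, r, hr⟩ := hq
  obtain ⟨d, r', hr'⟩ := exists_pow_chartSnd_mul_snd i r
  have h0 := chartSnd_ne_zero i.other
  have hw : (chartEmbedding i.other).snd Polynomial.X = chartSnd i.other :=
    PlaneEmbedding.snd_X _
  refine ⟨d + m.natAbs, n, Polynomial.X ^ (S.card * n + (m.natAbs + m).toNat) * r', ?_⟩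
  have hm : chartSnd i.other ^ m.natAbs * chartSnd i.other ^ m =
      chartSnd i.other ^ (m.natAbs + m).toNat := by
    rw [← zpow_natCast, ← zpow_natCast, ← zpow_add₀ h0, Int.toNat_of_nonneg (by omega)]
  rw [chartEmbedding_prod_other, map_mul, map_pow, hw, ← hr', ← hr, pow_add _ (S.card * n), ← hm]
  ring

end FunctionField

/-! ### Elementary steps between modules of fractions -/

section Steps

variable {ι : Type*} {K : Type*} [Field K] [Algebra ℂ K]

/-- The module of fractions with poles along `S`, or the zero module. -/
def LineConfig.level (Λ : LineConfig ι) (φ : Polynomial ℂ →ₐ[ℂ] K) :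
    WithBot (Finset ι) → AddSubgroup K :=
  WithBot.recBotCoe ⊥ (Λ.fractions φ)

/-- The elementary steps: from zero to the fractions with poles along `T`, and adding one line to
the poles. The last argument is the added line. -/
inductive LevelStep [DecidableEq ι] (T : Finset ι) : WithBot (Finset ι) → WithBot (Finset ι) → Option ι → Prop
  | base : LevelStep T ⊥ T none
  | insert (S : Finset ι) (i : ι) (hT : T ⊆ S) (hi : i ∉ S) :
      LevelStep T S (insert i S : Finset ι) (some i)

variable {T : Finset ι} {low high : WithBot (Finset ι)} {l : Option ι}
  {Λ : LineConfig ι} {φ : Polynomial ℂ →ₐ[ℂ] K}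

namespace LineConfig

theorem level_bot : Λ.level φ ⊥ = ⊥ := rfl

theorem level_coe (S : Finset ι) : Λ.level φ S = Λ.fractions φ S := rfl

theorem level_mono {x y : WithBot (Finset ι)} (h : x ≤ y) : Λ.level φ x ≤ Λ.level φ y := by
  induction x with
  | bot => exact bot_le
  | coe S =>
    induction y with
    | bot => simp at h
    | coe S' => exact fractions_mono (WithBot.coe_le_coe.mp h)

theorem level_le_fractions [Fintype ι] (x : WithBot (Finset ι)) :
    Λ.level φ x ≤ Λ.fractions φ Finset.univ := by
  induction x with
  | bot => exact bot_le
  | coe S => exact fractions_mono (Finset.subset_univ S)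

end LineConfig

variable [DecidableEq ι]

theorem LevelStep.le (h : LevelStep T low high l) : low ≤ high := by
  cases h with
  | base => exact bot_le
  | insert S i hT hi => exact WithBot.coe_le_coe.mpr (Finset.subset_insert i S)

variable (hφ : Function.Injective φ)
include hφ

/-- The two irreducibility results in one variable together. An added line which is constant on the
chart gives `low` and `high` the same module there, so only the first alternative is needed. -/
theorem LevelStep.eq_or {δ : Derivation ℂ K K} {γ : ι → ℂ}
    (hδ : ∀ p, δ (φ p) = φ (Polynomial.derivative p)) (hγ : ∀ t ∈ T, ∀ z : ℤ, γ t ≠ z)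
    (h : LevelStep T low high l) {P : AddSubgroup K}
    (hP : LineConfig.IsStable φ δ (Λ.logForm φ T γ) P) (h1 : Λ.level φ low ≤ P)
    (h2 : P ≤ Λ.level φ high) : P = Λ.level φ low ∨ P = Λ.level φ high := by
  cases h with
  | base =>
    by_cases h0 : P = ⊥
    · exact Or.inl h0
    · exact Or.inr (hP.eq_fractions hφ hδ hγ h2 h0)
  | insert S i hT hi =>
    by_cases hb : Λ.b i = 0
    · rw [LineConfig.level_coe, LineConfig.fractions_insert_of_isUnit hb] at h2
      exact Or.inl (le_antisymm h2 h1)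
    · by_cases h0 : P = Λ.fractions φ S
      · exact Or.inl h0
      · exact Or.inr (hP.eq_fractions_insert hφ hδ hT hi hb h2 h1 h0)

/-- The witnesses are `1` for the base step, where the quotient is torsion-free, and `1 / l_i` for
an added line, whose class is annihilated only by polynomials vanishing at the root. -/
theorem LevelStep.exists_mem (h : LevelStep T low high l) {z : ℂ}
    (hz : ∀ t ∈ l, (Λ.line t).eval z = 0) :
    ∃ q ∈ Λ.level φ high, ∀ p : Polynomial ℂ, φ p * q ∈ Λ.level φ low → p.eval z = 0 := by
  cases h with
  | base =>
    refine ⟨1, LineConfig.one_mem_fractions T, fun p hp => ?_⟩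
    rw [mul_one, LineConfig.level_bot, AddSubgroup.mem_bot, map_eq_zero_iff φ hφ] at hp
    rw [hp, Polynomial.eval_zero]
  | insert S i hT hi =>
    have hzi := hz i rfl
    have hb : Λ.b i ≠ 0 := by
      intro hb
      have := Λ.ne_zero i
      simp_all [LineConfig.line]
    have hzr : z = Λ.root i := by
      rw [LineConfig.line_eq hb] at hzi
      simpa [hb, sub_eq_zero] using hzi
    refine ⟨(φ (Λ.line i))⁻¹,
      LineConfig.inv_line_mem_fractions hφ (Finset.mem_insert_self i S), fun p hp => ?_⟩
    rw [hzr]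
    exact LineConfig.eval_root_of_div_mem hφ hi hb hp

omit hφ in
theorem LevelStep.pow_line_mul_mem {i : ι} (h : LevelStep T low high (some i)) {q : K}
    (hq : q ∈ Λ.level φ high) : ∃ n : ℕ, φ (Λ.line i) ^ n * q ∈ Λ.level φ low := by
  cases h with
  | insert S i hT hi => exact LineConfig.pow_line_mul_mem hq

end Steps

/-- Stability of `G` under `c` makes it additive in `g` that a power of `c` carries `g` into `G`.
Hence homogeneous elements suffice, as used both for gluing and for bounding supports. -/
theorem PlaneEmbedding.exists_pow_mul_mem {K : Type*} [Field K] [Algebra ℂ K]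
    {ε : PlaneEmbedding K} {C : ℤ → AddSubgroup K} {G : AddSubgroup K} {c : K}
    (hG : ∀ g ∈ G, c * g ∈ G) (h : ∀ j, ∀ q ∈ C j, ∃ M : ℕ, c ^ M * (ε.fst ^ j * q) ∈ G) {g : K}
    (hg : g ∈ ε.graded C) : ∃ M : ℕ, c ^ M * g ∈ G := by
  have hpow : ∀ (n : ℕ), ∀ g ∈ G, c ^ n * g ∈ G := fun n g hg => by
    induction n with
    | zero => simpa using hg
    | succ n ih => rw [pow_succ', mul_assoc]; exact hG _ ih
  induction hg using AddSubgroup.closure_induction with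
  | mem g hg =>
    obtain ⟨j, q, hq, rfl⟩ := hg
    exact h j q hq
  | zero => exact ⟨0, by simp⟩
  | add g g' _ _ h h' =>
    obtain ⟨n, h⟩ := h
    obtain ⟨n', h'⟩ := h'
    refine ⟨n + n', ?_⟩
    rw [mul_add]
    refine add_mem ?_ ?_
    · rw [pow_add, mul_comm (c ^ n), mul_assoc]
      exact hpow _ _ h
    · rw [pow_add, mul_assoc]
      exact hpow _ _ h'
  | neg g _ h =>
    obtain ⟨n, h⟩ := h
    exact ⟨n, by rw [mul_neg]; exact neg_mem h⟩

/-! ### D-modules on the blow-up inside the function field -/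

open MvPolynomial

/-- The partial derivatives on a chart. -/
def chartDer (i : Chart) (v : Fin 2) : Derivation ℂ (ChartRing i) (ChartRing i) :=
  (pderiv v : Derivation ℂ (MvPolynomial (Fin 2) ℂ) (MvPolynomial (Fin 2) ℂ))

theorem derivation_eq_sum_chartDer (i : Chart) (D : Derivation ℂ (ChartRing i) (ChartRing i)) :
    D = ∑ v, D (chartCoord i v) • chartDer i v := by
  let D' : Derivation ℂ (MvPolynomial (Fin 2) ℂ) (MvPolynomial (Fin 2) ℂ) := D
  have h : D' = ∑ v, D' (X v) • pderiv v := by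
    refine MvPolynomial.derivation_ext fun j => ?_
    fin_cases j <;> simp [Fin.sum_univ_two]
  exact h

/-- A realization of a D-module on the blow-up as rational functions with poles along the lines and
the exceptional divisor, with a connection with residues `γ` along the exceptional divisor and `η t`
along the lines `t ∈ T`, in terms of a generator `e i` on each chart. -/
structure BlowupModel (F : BlowupDMod) {ι : Type} [Fintype ι] [DecidableEq ι]
    (Λ : LineConfig ι) where
  toField : F.overlap →ₗ[OverlapRing] BlowupField
  injective : Function.Injective toField
  e : Chart → BlowupField
  e_ne_zero : ∀ i, e i ≠ 0
  κ : ℤ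
  e_other : ∀ i : Chart, e i = e i.other * chartSnd i.other ^ κ
  γ : ℂ
  T : Finset ι
  η : ι → ℂ
  η_int : ∀ t ∈ T, ∀ z : ℤ, η t ≠ z
  res_injective : ∀ i, Function.Injective (F.res i)
  range : ∀ i g, g ∈ (chartEmbedding i).planeFractions (chartLines Λ i) Finset.univ ↔
    ∃ m, e i * g = toField (F.res i m)
  nabla : ∀ i v m, ((e i)⁻¹ * toField (F.res i (DMod.nabla (chartDer i v) m))) =
    (chartEmbedding i).der v ((e i)⁻¹ * toField (F.res i m)) +
    (![algebraMap ℂ BlowupField γ * (chartEmbedding i).fst⁻¹,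
      (chartLines Λ i).logForm (chartEmbedding i).snd T η] : Fin 2 → BlowupField) v *
        ((e i)⁻¹ * toField (F.res i m))

namespace BlowupModel

variable {F : BlowupDMod} {ι : Type} [Fintype ι] [DecidableEq ι] {Λ : LineConfig ι}
  (m : BlowupModel F Λ)

/-- The connection form on a chart. -/
def form (i : Chart) : Fin 2 → BlowupField :=
  ![algebraMap ℂ BlowupField m.γ * (chartEmbedding i).fst⁻¹,
      (chartLines Λ i).logForm (chartEmbedding i).snd m.T m.η]

theorem form_zero (i : Chart) :
    m.form i 0 = algebraMap ℂ BlowupField m.γ * (chartEmbedding i).fst⁻¹ := rfl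

/-- Sections over a chart as rational functions. -/
def val (i : Chart) : F.sec i →+ BlowupField :=
  (AddMonoidHom.mulLeft (m.e i)⁻¹).comp
    (m.toField.toAddMonoidHom.comp (F.res i).toAddMonoidHom)

theorem val_apply (i : Chart) (x : F.sec i) :
    m.val i x = (m.e i)⁻¹ * m.toField (F.res i x) := rfl

theorem val_injective (i : Chart) : Function.Injective (m.val i) := fun x y h => by
  rw [val_apply, val_apply] at h
  exact m.res_injective i (m.injective (mul_left_cancel₀ (inv_ne_zero (m.e_ne_zero i)) h))

theorem toField_smul (i : Chart) (p : MvPolynomial (Fin 2) ℂ) (z : F.overlap) :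
    m.toField (chartPoly i p • z) = chartIncl i p * m.toField z := by
  rw [← algebraMap_smul OverlapRing (chartPoly i p) z, map_smul, Algebra.smul_def]
  rfl

theorem val_smul (i : Chart) (p : MvPolynomial (Fin 2) ℂ) (x : F.sec i) :
    m.val i (chartPoly i p • x) = chartIncl i p * m.val i x := by
  rw [val_apply, map_smul, toField_smul, val_apply]
  ring

theorem val_nabla (i : Chart) (v : Fin 2) (x : F.sec i) :
    m.val i (DMod.nabla (chartDer i v) x) =
      (chartEmbedding i).der v (m.val i x) + m.form i v * m.val i x :=
  m.nabla i v x

/-- The filtration of the components by levels is compatible with the D-module structure. -/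
structure Admissible (lev : ℤ → WithBot (Finset ι)) : Prop where
  subset : ∀ j (S : Finset ι), lev j = S → m.T ⊆ S
  le_succ : ∀ j, lev j ≤ lev (j + 1)
  succ_le : ∀ j : ℤ, (j + 1 : ℂ) + m.γ ≠ 0 → lev (j + 1) ≤ lev j

variable (Λ) in
/-- The rational functions with components in the given levels. -/
def gradedLevel (i : Chart) (lev : ℤ → WithBot (Finset ι)) : AddSubgroup BlowupField :=
  (chartEmbedding i).graded fun j => (chartLines Λ i).level (chartEmbedding i).snd (lev j)

/-! ### Sub-D-modules defined by levels -/

variable {m} {lev lev' : ℤ → WithBot (Finset ι)}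

omit [Fintype ι] [DecidableEq ι] in
theorem gradedLevel_mono (h : ∀ j, lev j ≤ lev' j) (i : Chart) :
    gradedLevel Λ i lev ≤ gradedLevel Λ i lev' :=
  PlaneEmbedding.graded_mono fun j => LineConfig.level_mono (h j)

omit [DecidableEq ι] in
theorem gradedLevel_le_planeFractions (i : Chart) (lev : ℤ → WithBot (Finset ι)) :
    gradedLevel Λ i lev ≤
      ((chartEmbedding i).planeFractions (chartLines Λ i) Finset.univ).toAddSubgroup := by
  rw [← PlaneEmbedding.graded_fractions]
  exact PlaneEmbedding.graded_mono fun j => LineConfig.level_le_fractions _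

theorem exists_val_eq (m : BlowupModel F Λ) {i : Chart} {g : BlowupField}
    (hg : g ∈ gradedLevel Λ i lev) : ∃ x, m.val i x = g := by
  obtain ⟨x, hx⟩ := (m.range i g).mp (gradedLevel_le_planeFractions i lev hg)
  exact ⟨x, by rw [val_apply, ← hx, inv_mul_cancel_left₀ (m.e_ne_zero i)]⟩

omit [DecidableEq ι] in
theorem level_der_zero (i : Chart) (x : WithBot (Finset ι)) (q : BlowupField)
    (hq : q ∈ (chartLines Λ i).level (chartEmbedding i).snd x) : (chartEmbedding i).der 0 q = 0 :=
  (chartEmbedding i).der_zero_of_mem_fractions (LineConfig.level_le_fractions x hq)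

theorem isStable_level {x : WithBot (Finset ι)} (hx : ∀ S : Finset ι, x = S → m.T ⊆ S)
    (i : Chart) : LineConfig.IsStable (chartEmbedding i).snd ((chartEmbedding i).der 1)
      (m.form i 1) ((chartLines Λ i).level (chartEmbedding i).snd x) := by
  induction x with
  | bot =>
    exact ⟨fun p g hg => by simp_all [LineConfig.level_bot],
      fun hg => by simp_all [LineConfig.level_bot]⟩
  | coe S =>
    exact LineConfig.isStable_fractions (chartEmbedding i).snd_injective
      (chartEmbedding i).der_one_snd (hx S rfl)

theorem Admissible.isStable (h : m.Admissible lev) (i : Chart) :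
    (chartEmbedding i).IsStable (m.form i) (gradedLevel Λ i lev) :=
  PlaneEmbedding.IsAdmissible.isStable_graded
    { isStable := fun j => isStable_level (h.subset j) i
      der_zero := fun _ => level_der_zero i _
      le_succ := fun j => LineConfig.level_mono (h.le_succ j)
      succ_le := fun j hj => LineConfig.level_mono (h.succ_le j hj) } (m.form_zero i)

/-- The heart of gluing: passing to the other chart multiplies a homogeneous element by an integral
power of `w` and preserves its degree in `u` and its level, so only poles at `w = 0` can appear. -/
theorem Admissible.exists_pow_mul_mem (h : m.Admissible lev) (i : Chart) {g : BlowupField}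
    (hg : g ∈ gradedLevel Λ i lev) : ∃ M : ℕ,
      chartSnd i.other ^ M * ((m.e i.other)⁻¹ * m.e i * g) ∈ gradedLevel Λ i.other lev := by
  have key := PlaneEmbedding.exists_pow_mul_mem (G := (gradedLevel Λ i.other lev).comap
    (AddMonoidHom.mulLeft ((m.e i.other)⁻¹ * m.e i))) (c := chartSnd i.other) (fun g hg => ?_)
    (fun j q hq => ?_) hg
  · obtain ⟨M, hM⟩ := key
    refine ⟨M, ?_⟩
    rwa [AddSubgroup.mem_comap, AddMonoidHom.coe_mulLeft, mul_left_comm] at hM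
  · rw [AddSubgroup.mem_comap, AddMonoidHom.coe_mulLeft, mul_left_comm]
    exact (h.isStable i.other).mul_mem (X 1) hg
  -- Of the exponent `κ + j`, the part `κ` comes from comparing generators and `j` from `u^j`, since
  -- the equations of `E` on the charts differ by one factor of the coordinate.
  · have hM : ∃ M : ℕ, chartSnd i.other ^ M * (chartSnd i.other ^ (m.κ + j) * q) ∈
        (chartLines Λ i.other).level (chartEmbedding i.other).snd (lev j) := by
      generalize lev j = x at hq
      induction x with
      | bot =>
        rw [LineConfig.level_bot, AddSubgroup.mem_bot] at hq
        subst hq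
        exact ⟨0, by simp⟩
      | coe S => exact exists_pow_chartSnd_mul_mem_fractions Λ i S _ hq
    obtain ⟨M, hM⟩ := hM
    refine ⟨M, ?_⟩
    rw [AddSubgroup.mem_comap, AddMonoidHom.coe_mulLeft]
    have hmem : (chartEmbedding i.other).fst ^ j * (chartSnd i.other ^ M *
        (chartSnd i.other ^ (m.κ + j) * q)) ∈ gradedLevel Λ i.other lev :=
      PlaneEmbedding.zpow_mul_mem_graded hM
    convert hmem using 1
    have h0 := m.e_ne_zero i.other
    have hw := chartSnd_ne_zero i.other
    have hi : i.other.other = i := by cases i <;> rfl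
    have hu := chartEmbedding_fst_other i.other
    rw [hi] at hu
    rw [m.e_other i, hu, mul_zpow, zpow_add₀ hw]
    field_simp

/-- The sections of a sub-D-module with components in the given levels. -/
def Admissible.sections (h : m.Admissible lev) (i : Chart) : Submodule (ChartRing i) (F.sec i) where
  __ := (gradedLevel Λ i lev).comap (m.val i)
  smul_mem' p x hx := by
    change m.val i (p • x) ∈ gradedLevel Λ i lev
    have := m.val_smul i ((chartPoly i).symm p) x
    rw [AlgEquiv.apply_symm_apply] at this
    rw [this]
    exact (h.isStable i).mul_mem _ hx

/-- The power of the coordinate needed to reach the other chart is invertible on the intersection.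
-/
theorem Admissible.res_mem_span (h : m.Admissible lev) {i : Chart} {x : F.sec i}
    (hx : x ∈ h.sections i) : F.res i x ∈ Submodule.span OverlapRing
      (F.res i.other '' (h.sections i.other : Set (F.sec i.other))) := by
  obtain ⟨M, hM⟩ := h.exists_pow_mul_mem i hx
  obtain ⟨y, hy⟩ := m.exists_val_eq hM
  have h0 := m.e_ne_zero i.other
  have hy' : chartCoord i.other 1 ^ M • F.res i x = F.res i.other y := by
    apply m.injective
    have h1 := m.toField_smul i.other (X 1 ^ M) (F.res i x)
    rw [map_pow, chartPoly_X, map_pow] at h1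
    rw [h1]
    rw [val_apply, val_apply] at hy
    have h2 := congrArg (fun z => m.e i.other * z) hy
    simp only [mul_inv_cancel_left₀ h0] at h2
    rw [h2]
    have h3 := m.e_ne_zero i
    change chartSnd i.other ^ M * _ = _
    field_simp
  have hunit : IsUnit (algebraMap (ChartRing i.other) OverlapRing (chartCoord i.other 1 ^ M)) := by
    rw [map_pow]
    exact (IsLocalization.Away.algebraMap_isUnit (chartCoord i.other 1)).pow M
  rw [← algebraMap_smul OverlapRing (chartCoord i.other 1 ^ M)] at hy'
  rw [← Submodule.smul_mem_iff_of_isUnit _ hunit, hy']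
  refine Submodule.subset_span ⟨y, ?_, rfl⟩
  change m.val _ y ∈ gradedLevel Λ i.other lev
  rw [hy]
  exact hM

/-- The sub-D-module with components in the given levels. -/
def Admissible.subDMod (h : m.Admissible lev) : SubDMod F where
  sub := h.sections
  nabla_mem i D x hx := by
    rw [derivation_eq_sum_chartDer i D, map_sum, AddMonoidHom.finsetSum_apply]
    refine sum_mem fun v _ => ?_
    rw [map_smul]
    refine Submodule.smul_mem _ _ ?_
    change m.val i _ ∈ gradedLevel Λ i lev
    rw [val_nabla]
    exact (h.isStable i).nabla_mem v hx
  glue := by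
    refine le_antisymm (Submodule.span_le.mpr ?_) (Submodule.span_le.mpr ?_)
    · rintro _ ⟨x, hx, rfl⟩
      exact h.res_mem_span (i := .one) hx
    · rintro _ ⟨x, hx, rfl⟩
      exact h.res_mem_span (i := .two) hx

theorem Admissible.mem_subDMod (h : m.Admissible lev) {i : Chart} {x : F.sec i} :
    x ∈ h.subDMod.sub i ↔ m.val i x ∈ gradedLevel Λ i lev := Iff.rfl

theorem Admissible.subDMod_mono (h : m.Admissible lev) (h' : m.Admissible lev')
    (hle : ∀ j, lev j ≤ lev' j) : h.subDMod ≤ h'.subDMod := fun i _ hx =>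
  gradedLevel_mono hle i hx

/-- The points of the blow-up on a line, on the exceptional divisor, or both. -/
def _root_.LineConfig.locus {ι : Type} (Λ : LineConfig ι) (U : Prop) (l : Option ι) :
    Set Blowup :=
  {p | ∃ (i : Chart) (a : Fin 2 → ℂ), chartPoint i a = p ∧ (U → a 0 = 0) ∧
    ∀ t ∈ l, ((chartLines Λ i).line t).eval (a 1) = 0}

/-- An elementary step between two families of levels, in the degrees `J`. The proposition `U`
says that `J` is bounded above by `j₀`, and that hence the quotient is supported on the exceptional
divisor. -/
structure IsStep (m : BlowupModel F Λ) (lev lev' : ℤ → WithBot (Finset ι)) (J : Set ℤ) (j₀ : ℤ)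
    (U : Prop) (l : Option ι) : Prop where
  ordConnected : J.OrdConnected
  linked : ∀ j ∈ J, j + 1 ∈ J → (j + 1 : ℂ) + m.γ ≠ 0
  mem : j₀ ∈ J
  bounded : U → ∀ j ∈ J, j ≤ j₀
  unbounded : ¬ U → ∀ k : ℕ, j₀ + k ∈ J
  eq_off : ∀ j ∉ J, lev j = lev' j
  step : ∃ low high, LevelStep m.T low high l ∧ (∀ j ∈ J, lev j = low) ∧ ∀ j ∈ J, lev' j = high

/-! ### Supports and irreducibility of elementary steps -/

variable {J : Set ℤ} {j₀ : ℤ} {U : Prop} {l : Option ι}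

theorem IsStep.le (hs : IsStep m lev lev' J j₀ U l) (j : ℤ) : lev j ≤ lev' j := by
  by_cases hj : j ∈ J
  · obtain ⟨low, high, h, h1, h2⟩ := hs.step
    rw [h1 j hj, h2 j hj]
    exact h.le
  · exact (hs.eq_off j hj).le

/-- An element witnessing that a point lies in the support of an elementary step. -/
theorem IsStep.exists_mem (hs : IsStep m lev lev' J j₀ U l) (h : m.Admissible lev)
    (h' : m.Admissible lev') {i : Chart} {a : Fin 2 → ℂ} (h0 : U → a 0 = 0)
    (hl : ∀ t ∈ l, ((chartLines Λ i).line t).eval (a 1) = 0) :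
    ∃ x ∈ h'.subDMod.sub i, ∀ r : MvPolynomial (Fin 2) ℂ, eval a r ≠ 0 →
      chartPoly i r • x ∉ h.subDMod.sub i := by
  obtain ⟨low, high, hst, h1, h2⟩ := hs.step
  obtain ⟨q, hq, hqp⟩ := hst.exists_mem (Λ := chartLines Λ i)
    (chartEmbedding i).snd_injective hl
  have hmem : (chartEmbedding i).fst ^ j₀ * q ∈ gradedLevel Λ i lev' :=
    PlaneEmbedding.zpow_mul_mem_graded (by rw [h2 j₀ hs.mem]; exact hq)
  obtain ⟨x, hx⟩ := m.exists_val_eq hmem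
  refine ⟨x, by rw [h'.mem_subDMod, hx]; exact hmem, fun r hr hrx => hr ?_⟩
  rw [h.mem_subDMod, val_smul, hx] at hrx
  refine PlaneEmbedding.eval_eq_zero_of_mul_mem_graded (fun j => level_der_zero i (lev j))
    (h.isStable i) (m.form_zero i) (level_der_zero i high q hq) (fun k => ?_) hrx
  -- For degrees in `J` the witness forces the coefficient of `r` to vanish at `a 1`. A degree `j₀ +
  -- k` leaves `J` only if `U` holds and `k ≠ 0`, and then `a 0 ^ k = 0`.
  by_cases hk : j₀ + k ∈ J
  · exact Or.inr fun p hp => hqp p (by rwa [h1 _ hk] at hp)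
  · by_cases hU : U
    · refine Or.inl ⟨h0 hU, ?_⟩
      rintro rfl
      exact hk (by simpa using hs.mem)
    · exact absurd (hs.unbounded hU k) hk

/-- Away from `E`, a power of `u` moves a section beyond the degrees where the modules differ, if
these are bounded above. Away from the line, a power of its equation cancels the new poles. The
remaining points are in the support by the witness of `IsStep.exists_mem`. -/
theorem IsStep.support (hs : IsStep m lev lev' J j₀ U l) (h : m.Admissible lev)
    (h' : m.Admissible lev') :
    subquotientSupport h.subDMod h'.subDMod = Λ.locus U l := by
  ext p
  rw [mem_subquotientSupport]
  refine exists_congr fun i => exists_congr fun a => and_congr_right fun _ => ?_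
  constructor
  swap
  · rintro ⟨h0, hl⟩
    exact hs.exists_mem h h' h0 hl
  rintro ⟨x, hx, hr⟩
  obtain ⟨low, high, hst, h1, h2⟩ := hs.step
  refine ⟨fun hU => ?_, fun t ht => ?_⟩
  · by_contra h0
    obtain ⟨M, hM⟩ := PlaneEmbedding.exists_pow_mul_mem (c := (chartEmbedding i).fst)
      (G := gradedLevel Λ i lev) (fun g hg => (h.isStable i).mul_mem (X 0) hg)
      (fun j q hq => by
        have hmono : ∀ n : ℕ, lev' j ≤ lev' (j + n) := fun n => by
          induction n with
          | zero => simp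
          | succ n ih =>
            rw [Nat.cast_succ, ← add_assoc]
            exact ih.trans (h'.le_succ _)
        -- Enough factors `u` to go past `j₀`; truncation gives the power `0` when `j` is already
        -- larger.
        refine ⟨(j₀ - j + 1).toNat, ?_⟩
        rw [← mul_assoc, ← zpow_natCast, ← zpow_add₀ (PlaneEmbedding.fst_ne_zero _), add_comm]
        refine PlaneEmbedding.zpow_mul_mem_graded ?_
        rw [hs.eq_off _ fun hJ => by have := hs.bounded hU _ hJ; omega]
        exact LineConfig.level_mono (hmono _) hq) hx
    refine hr (X 0 ^ M) (by rw [map_pow, eval_X]; exact pow_ne_zero M h0) ?_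
    rw [h.mem_subDMod, val_smul, map_pow]
    exact hM
  · by_contra h0
    obtain rfl : l = some t := ht
    obtain ⟨M, hM⟩ := PlaneEmbedding.exists_pow_mul_mem
      (c := (chartEmbedding i).snd ((chartLines Λ i).line t))
      (G := gradedLevel Λ i lev) (fun g hg => (h.isStable i).mul_mem _ hg)
      (fun j q hq => by
        by_cases hj : j ∈ J
        · rw [h2 j hj] at hq
          obtain ⟨n, hn⟩ := hst.pow_line_mul_mem hq
          refine ⟨n, ?_⟩
          rw [mul_left_comm]
          exact PlaneEmbedding.zpow_mul_mem_graded (by rw [h1 j hj]; exact hn)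
        · refine ⟨0, ?_⟩
          rw [pow_zero, one_mul]
          exact PlaneEmbedding.zpow_mul_mem_graded (by rw [hs.eq_off j hj]; exact hq)) hx
    refine hr (Polynomial.aeval (X 1) ((chartLines Λ i).line t) ^ M) ?_ ?_
    · rw [map_pow]
      refine pow_ne_zero _ ?_
      rw [← MvPolynomial.coe_aeval_eq_eval, RingHom.coe_coe, ← Polynomial.aeval_algHom_apply]
      simpa using h0
    · rw [h.mem_subDMod, val_smul, map_pow]
      exact hM

/-- On one chart `val` turns `N` into a stable group of rational functions, to which `eq_graded_or`
applies. The choice between the alternatives may still depend on the chart. -/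
theorem IsStep.eq_or_chart (hs : IsStep m lev lev' J j₀ U l) (h : m.Admissible lev)
    (h' : m.Admissible lev') {N : SubDMod F} (h1 : h.subDMod ≤ N) (h2 : N ≤ h'.subDMod)
    (i : Chart) : N.sub i = h.subDMod.sub i ∨ N.sub i = h'.subDMod.sub i := by
  obtain ⟨low, high, hst, hlow, hhigh⟩ := hs.step
  have := hs.ordConnected
  have hN : (chartEmbedding i).IsStable (m.form i) ((N.sub i).toAddSubgroup.map (m.val i)) :=
    { mul_mem := by
        rintro p _ ⟨x, hx, rfl⟩
        exact ⟨chartPoly i p • x, (N.sub i).smul_mem _ hx, m.val_smul i p x⟩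
      nabla_mem := by
        rintro v _ ⟨x, hx, rfl⟩
        exact ⟨DMod.nabla (chartDer i v) x, N.nabla_mem i _ x hx, m.val_nabla i v x⟩ }
  have hhs : LineConfig.IsStable (chartEmbedding i).snd ((chartEmbedding i).der 1)
      (m.form i 1) ((chartLines Λ i).level (chartEmbedding i).snd high) :=
    isStable_level (fun S hS => h'.subset j₀ S ((hhigh j₀ hs.mem).trans hS)) i
  have hmap : ∀ {lev : ℤ → WithBot (Finset ι)} (h : m.Admissible lev),
      (N.sub i).toAddSubgroup.map (m.val i) = gradedLevel Λ i lev → N.sub i = h.subDMod.sub i := by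
    intro lev h heq
    ext x
    rw [h.mem_subDMod, ← heq]
    exact ⟨fun hx => ⟨x, hx, rfl⟩, by
      rintro ⟨y, hy, hxy⟩
      rwa [← m.val_injective i hxy]⟩
  refine (hN.eq_graded_or (m.form_zero i) hs.linked
    (low := (chartLines Λ i).level (chartEmbedding i).snd low)
    (high := (chartLines Λ i).level (chartEmbedding i).snd high)
    (C := fun j => (chartLines Λ i).level (chartEmbedding i).snd (lev j))
    (C' := fun j => (chartLines Λ i).level (chartEmbedding i).snd (lev' j))
    (fun j hj => by rw [hlow j hj]) (fun j hj => by rw [hhigh j hj])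
    (fun j hj => by rw [hs.eq_off j hj]) (fun j => level_der_zero i _)
    (LineConfig.level_mono hst.le) hhs ?_ ?_ ?_).imp (hmap h) (hmap h')
  · intro P hP
    exact hst.eq_or (chartEmbedding i).snd_injective (chartEmbedding i).der_one_snd m.η_int hP
  · intro g hg
    obtain ⟨x, rfl⟩ := m.exists_val_eq hg
    exact ⟨x, h1 i hg, rfl⟩
  · rintro _ ⟨x, hx, rfl⟩
    exact h2 i hx

theorem IsStep.sub_eq_of_b_eq_zero {t : ι} (hs : IsStep m lev lev' J j₀ U (some t))
    (h : m.Admissible lev) (h' : m.Admissible lev') {i : Chart} (hb : (chartLines Λ i).b t = 0) :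
    h.subDMod.sub i = h'.subDMod.sub i := by
  obtain ⟨low, high, hst, hlow, hhigh⟩ := hs.step
  have heq : (chartLines Λ i).level (chartEmbedding i).snd low =
      (chartLines Λ i).level (chartEmbedding i).snd high := by
    cases hst with
    | insert S t hT ht => exact (LineConfig.fractions_insert_of_isUnit hb).symm
  have hg : gradedLevel Λ i lev = gradedLevel Λ i lev' := by
    unfold gradedLevel
    congr 1
    funext j
    by_cases hj : j ∈ J
    · rw [hlow j hj, hhigh j hj, heq]
    · rw [hs.eq_off j hj]
  ext x
  rw [h.mem_subDMod, h'.mem_subDMod, hg]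

/-- If the two modules of an elementary step differ on the first chart at a point of the
intersection of the charts, they differ on the intersection. -/
theorem IsStep.span_ne (hs : IsStep m lev lev' J j₀ U l) (h : m.Admissible lev)
    (h' : m.Admissible lev') {a : Fin 2 → ℂ} (h0 : U → a 0 = 0) (ha : a 1 ≠ 0)
    (hl : ∀ t ∈ l, ((chartLines Λ .one).line t).eval (a 1) = 0) :
    Submodule.span OverlapRing (F.res .one '' (h.subDMod.sub .one : Set (F.sec .one))) ≠
      Submodule.span OverlapRing (F.res .one '' (h'.subDMod.sub .one : Set (F.sec .one))) := by
  intro heq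
  obtain ⟨x, hx, hr⟩ := hs.exists_mem h h' h0 hl
  have hmem : F.res .one x ∈ Submodule.span OverlapRing
      (F.res .one '' (h.subDMod.sub .one : Set (F.sec .one))) := by
    rw [heq]
    exact Submodule.subset_span ⟨x, hx, rfl⟩
  rw [SubDMod.span_res_eq, Submodule.mem_localized'] at hmem
  obtain ⟨y, hy, ⟨_, M, rfl⟩, hs'⟩ := hmem
  rw [IsLocalizedModule.mk'_eq_iff] at hs'
  change F.res .one y = chartCoord .one 1 ^ M • F.res .one x at hs'
  rw [← map_smul] at hs'
  refine hr (X 1 ^ M) (by rw [map_pow, eval_X]; exact pow_ne_zero M ha) ?_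
  rw [map_pow, chartPoly_X, ← m.res_injective .one hs']
  exact hy

/-- Strictness is tested at a point of `E`, on the line if there is one. A module strictly between
would be the lower one on one chart and the upper one on the other, so by gluing both agree on the
intersection. This is impossible if the support meets the intersection. Otherwise the line is a
coordinate axis, its proper transform misses one chart, where both modules agree, and the other
chart alone decides. -/
theorem IsStep.covBy (hs : IsStep m lev lev' J j₀ U l) (h : m.Admissible lev)
    (h' : m.Admissible lev') : h.subDMod ⋖ h'.subDMod := by
  have hle : h.subDMod ≤ h'.subDMod := h.subDMod_mono h' hs.le
  have hor := fun N => hs.eq_or_chart h h' (N := N)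
  refine ⟨lt_of_le_of_ne hle fun heq => ?_, fun N h1 h2 => ?_⟩
  · have hne : ∃ (i : Chart) (z : ℂ), ∀ t ∈ l, ((chartLines Λ i).line t).eval z = 0 := by
      rcases l with - | t
      · exact ⟨.one, 0, by simp⟩
      · by_cases hb : Λ.b t = 0
        · have ha : Λ.swap.b t ≠ 0 := (Λ.ne_zero t).resolve_right (not_not_intro hb)
          exact ⟨.two, Λ.swap.root t, fun s hs => by
            obtain rfl : t = s := by simpa using hs
            exact LineConfig.eval_root_self ha⟩
        · exact ⟨.one, Λ.root t, fun s hs => by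
            obtain rfl : t = s := by simpa using hs
            exact LineConfig.eval_root_self hb⟩
    obtain ⟨i, z, hz⟩ := hne
    obtain ⟨x, hx, hr⟩ := hs.exists_mem h h' (i := i) (a := ![0, z]) (fun _ => rfl) hz
    refine hr 1 (by simp) ?_
    rwa [map_one, one_smul, heq]
  · have hext : ∀ M M' : SubDMod F, M.sub .one = M'.sub .one → M.sub .two = M'.sub .two →
        M = M' := fun M M' h1 h2 => SubDMod.ext (funext fun i => by cases i <;> assumption)
    have hn1 : ¬ (N.sub .one = h.subDMod.sub .one ∧ N.sub .two = h.subDMod.sub .two) :=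
      fun hh => h1.ne (hext _ _ hh.1 hh.2).symm
    have hn2 : ¬ (N.sub .one = h'.subDMod.sub .one ∧ N.sub .two = h'.subDMod.sub .two) :=
      fun hh => h2.ne (hext _ _ hh.1 hh.2)
    have hspan : Submodule.span OverlapRing (F.res .one ''
          (h.subDMod.sub .one : Set (F.sec .one))) =
        Submodule.span OverlapRing (F.res .one ''
          (h'.subDMod.sub .one : Set (F.sec .one))) := by
      have hg := N.glue
      have hg1 := h.subDMod.glue
      have hg2 := h'.subDMod.glue
      rcases hor N h1.le h2.le .one with h3 | h3 <;> rcases hor N h1.le h2.le .two with h4 | h4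
      · exact absurd ⟨h3, h4⟩ hn1
      · rw [h3, h4] at hg
        rw [hg, hg2]
      · rw [h3, h4] at hg
        rw [hg, hg1]
      · exact absurd ⟨h3, h4⟩ hn2
    have hunit : ∀ (i : Chart), h.subDMod.sub i = h'.subDMod.sub i → False := by
      intro i hi
      cases i with
      | one =>
        rcases hor N h1.le h2.le .two with h4 | h4 <;> rcases hor N h1.le h2.le .one with h3 | h3
        · exact hn1 ⟨h3, h4⟩
        · exact hn1 ⟨h3.trans hi.symm, h4⟩
        · exact hn2 ⟨h3.trans hi, h4⟩
        · exact hn2 ⟨h3, h4⟩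
      | two =>
        rcases hor N h1.le h2.le .one with h4 | h4 <;> rcases hor N h1.le h2.le .two with h3 | h3
        · exact hn1 ⟨h4, h3⟩
        · exact hn1 ⟨h4, h3.trans hi.symm⟩
        · exact hn2 ⟨h4, h3.trans hi⟩
        · exact hn2 ⟨h4, h3⟩
    rcases l with - | t
    · exact hs.span_ne h h' (a := ![0, 1]) (fun _ => rfl) one_ne_zero (by simp) hspan
    · by_cases hb : Λ.b t = 0
      · exact hunit .one (hs.sub_eq_of_b_eq_zero h h' hb)
      by_cases ha : Λ.a t = 0
      · exact hunit .two (hs.sub_eq_of_b_eq_zero h h' ha)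
      refine hs.span_ne h h' (a := ![0, Λ.root t]) (fun _ => rfl)
        (div_ne_zero (neg_ne_zero.mpr ha) hb) (fun s hs => ?_) hspan
      obtain rfl : t = s := by simpa using hs
      exact LineConfig.eval_root_self hb

end BlowupModel

/-! ### Proper transforms of lines -/

section Geometry

open MvPolynomial

theorem eval_pullCoord (i : Chart) (a : Fin 2 → ℂ) (j : Fin 2) :
    eval a (pullCoord i j) = a 0 * homCoord i a j := by
  cases i <;> fin_cases j <;> simp [pullCoord, homCoord]

theorem chartPoint_down (i : Chart) (a : Fin 2 → ℂ) : (chartPoint i a).down = a 0 • homCoord i a := by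
  funext j
  change eval a (pullCoord i j) = a 0 * homCoord i a j
  exact eval_pullCoord i a j

theorem chartPoint_mem_excDivisor {i : Chart} {a : Fin 2 → ℂ} :
    chartPoint i a ∈ excDivisor ↔ a 0 = 0 := by
  change (chartPoint i a).down = 0 ↔ _
  rw [chartPoint_down, smul_eq_zero, or_iff_left (homCoord_ne_zero i a)]

theorem exists_chartPoint_eq (p : Blowup) : ∃ (i : Chart) (a : Fin 2 → ℂ), chartPoint i a = p := by
  obtain ⟨⟨z, L⟩, h⟩ := p
  replace h : z 0 * L.rep 1 = z 1 * L.rep 0 := h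
  by_cases h0 : L.rep 0 = 0
  · have h1 : L.rep 1 ≠ 0 := fun h1 => L.rep_nonzero (by
      ext j
      fin_cases j
      · exact h0
      · exact h1)
    refine ⟨.two, ![z 1, L.rep 0 / L.rep 1], Subtype.ext (Prod.ext ?_ ?_)⟩
    · ext j
      refine (eval_pullCoord _ _ j).trans ?_
      fin_cases j
      · simp only [homCoord, h0, zero_div]
        rw [h0, mul_zero] at h
        simpa using ((mul_eq_zero.mp h).resolve_right h1).symm
      · simp [homCoord]
    · change Projectivization.mk ℂ (homCoord .two ![z 1, L.rep 0 / L.rep 1]) _ = L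
      conv_rhs => rw [← L.mk_rep]
      rw [Projectivization.mk_eq_mk_iff']
      refine ⟨(L.rep 1)⁻¹, ?_⟩
      ext j
      fin_cases j
      · simp [homCoord, div_eq_inv_mul]
      · simp [homCoord, h1]
  · refine ⟨.one, ![z 0, L.rep 1 / L.rep 0], Subtype.ext (Prod.ext ?_ ?_)⟩
    · ext j
      refine (eval_pullCoord _ _ j).trans ?_
      fin_cases j
      · simp [homCoord]
      · simp only [homCoord, Matrix.cons_val_zero, Matrix.cons_val_one, Fin.mk_one]
        field_simp
        linear_combination h
    · change Projectivization.mk ℂ (homCoord .one ![z 0, L.rep 1 / L.rep 0]) _ = L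
      conv_rhs => rw [← L.mk_rep]
      rw [Projectivization.mk_eq_mk_iff']
      refine ⟨(L.rep 0)⁻¹, ?_⟩
      ext j
      fin_cases j
      · simp [homCoord, h0]
      · simp [homCoord, div_eq_inv_mul]

namespace LineConfig

variable {ι : Type} (Λ : LineConfig ι)

/-- The linear form `a_t x + b_t y`. -/
def form (t : ι) : PlaneRing := C (Λ.a t) * X 0 + C (Λ.b t) * X 1

theorem eval_form (t : ι) (z : Fin 2 → ℂ) : eval z (Λ.form t) = Λ.a t * z 0 + Λ.b t * z 1 := by
  simp [form]

/-- The points of the blow-up in the direction of the line `a_t x + b_t y = 0`. -/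
def strictLine (t : ι) : Set Blowup :=
  {p | eval p.1.2.rep (Λ.form t) = 0}

theorem eval_homCoord_form (t : ι) (i : Chart) (a : Fin 2 → ℂ) :
    eval (homCoord i a) (Λ.form t) = ((chartLines Λ i).line t).eval (a 1) := by
  rw [eval_form]
  cases i
  · simp [homCoord, chartLines, line]
  · simp [homCoord, chartLines, line, swap, add_comm]

variable {Λ} {t : ι}

theorem chartPoint_mem_strictLine {i : Chart} {a : Fin 2 → ℂ} :
    chartPoint i a ∈ Λ.strictLine t ↔ ((chartLines Λ i).line t).eval (a 1) = 0 := by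
  obtain ⟨u, hu⟩ :=
    Projectivization.exists_smul_eq_mk_rep ℂ (homCoord i a) (homCoord_ne_zero i a)
  change eval (Projectivization.mk ℂ (homCoord i a) (homCoord_ne_zero i a)).rep (Λ.form t) = 0 ↔ _
  rw [← hu, ← eval_homCoord_form, eval_form, eval_form]
  have : Λ.a t * (u • homCoord i a) 0 + Λ.b t * (u • homCoord i a) 1 =
      (u : ℂ) * (Λ.a t * homCoord i a 0 + Λ.b t * homCoord i a 1) := by
    simp only [Pi.smul_apply, Units.smul_def, smul_eq_mul]
    ring
  rw [this, mul_eq_zero, or_iff_right u.ne_zero]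

/-- Removes the choice of a chart: both conditions depend only on the point, through its image in
the plane and its direction. -/
theorem locus_eq (U : Prop) (l : Option ι) :
    Λ.locus U l = {p | (U → p ∈ excDivisor) ∧ ∀ t ∈ l, p ∈ Λ.strictLine t} := by
  ext p
  constructor
  · rintro ⟨i, a, rfl, h, h'⟩
    exact ⟨fun hU => chartPoint_mem_excDivisor.mpr (h hU),
      fun t ht => chartPoint_mem_strictLine.mpr (h' t ht)⟩
  · rintro ⟨h, h'⟩
    obtain ⟨i, a, rfl⟩ := exists_chartPoint_eq p
    exact ⟨i, a, rfl, fun hU => chartPoint_mem_excDivisor.mp (h hU),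
      fun t ht => chartPoint_mem_strictLine.mp (h' t ht)⟩

/-- The set of points in the direction of the line is closed and contains the part of the inverse
image off `E`. Conversely, the line through one of its points with `w` fixed meets `E` only at `u =
0`, so equations valid off `E` extend across `E`. -/
theorem properTransform_form (t : ι) : properTransform (Λ.form t) = Λ.strictLine t := by
  have hgen : ∀ (i : Chart) (a : Fin 2 → ℂ), a 0 ≠ 0 → chartPoint i a ∈ Λ.strictLine t →
      chartPoint i a ∈ {p : Blowup | eval p.down (Λ.form t) = 0 ∧ p ∉ excDivisor} := by
    intro i a ha h
    refine ⟨?_, fun h0 => ha (chartPoint_mem_excDivisor.mp h0)⟩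
    rw [chartPoint_mem_strictLine, ← eval_homCoord_form, eval_form] at h
    rw [chartPoint_down, eval_form]
    simp only [Pi.smul_apply, smul_eq_mul]
    linear_combination a 0 * h
  apply subset_antisymm
  · refine Set.sInter_subset_of_mem ⟨fun i => ⟨{Polynomial.aeval (X 1) ((chartLines Λ i).line t)},
      fun a => ?_⟩, ?_⟩
    · rw [chartPoint_mem_strictLine]
      simp only [Set.mem_singleton_iff, forall_eq]
      rw [← MvPolynomial.coe_aeval_eq_eval, RingHom.coe_coe, ← Polynomial.aeval_algHom_apply]
      simp
    · rintro p ⟨h, hE⟩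
      obtain ⟨i, a, rfl⟩ := exists_chartPoint_eq p
      rw [chartPoint_mem_excDivisor] at hE
      rw [chartPoint_down, eval_form] at h
      rw [chartPoint_mem_strictLine, ← eval_homCoord_form, eval_form]
      simp only [Pi.smul_apply, smul_eq_mul] at h
      exact mul_left_cancel₀ hE (by linear_combination h)
  · rintro p hp Z ⟨hZ, hsub⟩
    obtain ⟨i, a, rfl⟩ := exists_chartPoint_eq p
    obtain ⟨S, hS⟩ := hZ i
    rw [hS]
    intro f hf
    have hvan : ∀ z : ℂ, z ≠ 0 → eval ![z, a 1] f = 0 := fun z hz => by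
      refine (hS ![z, a 1]).mp (hsub (hgen i _ hz ?_)) f hf
      rw [chartPoint_mem_strictLine] at hp ⊢
      exact hp
    have heval : ∀ z : ℂ, (aeval ![Polynomial.X, Polynomial.C (a 1)] f : Polynomial ℂ).eval z =
        eval ![z, a 1] f := fun z => by
      have : ((Polynomial.aeval z).comp (aeval ![Polynomial.X, Polynomial.C (a 1)]) :
          MvPolynomial (Fin 2) ℂ →ₐ[ℂ] ℂ) = aeval ![z, a 1] := by
        refine MvPolynomial.algHom_ext fun j => ?_
        fin_cases j <;> simp
      simpa using DFunLike.congr_fun this f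
    -- On this line the equation is a polynomial in `u` with infinitely many zeros.
    have hzero : (aeval ![Polynomial.X, Polynomial.C (a 1)] f : Polynomial ℂ) = 0 := by
      refine Polynomial.eq_zero_of_infinite_isRoot _ (Set.Infinite.mono (s := {0}ᶜ) ?_
        (Set.finite_singleton (0 : ℂ)).infinite_compl)
      intro z hz
      exact (heval z).trans (hvan z hz)
    have ha : a = ![a 0, a 1] := by
      ext j
      fin_cases j <;> rfl
    rw [ha, ← heval, hzero, Polynomial.eval_zero]

/-- Proper transforms of different lines are disjoint, so a point on one lies on no other, and it
may be chosen on `E` or off it. Such points separate the possible supports. -/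
theorem exists_mem_strictLine_iff (Λ : LineConfig ι) (t : ι) (E : Prop) :
    ∃ p : Blowup, (p ∈ excDivisor ↔ E) ∧ ∀ s, p ∈ Λ.strictLine s ↔ s = t := by
  classical
  obtain ⟨i, hi⟩ : ∃ i, (chartLines Λ i).b t ≠ 0 := by
    rcases Λ.ne_zero t with h | h
    · exact ⟨.two, h⟩
    · exact ⟨.one, h⟩
  refine ⟨chartPoint i ![if E then 0 else 1, (chartLines Λ i).root t], ?_, fun s => ?_⟩
  · rw [chartPoint_mem_excDivisor]
    by_cases h : E <;> simp [h]
  · rw [chartPoint_mem_strictLine]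
    constructor
    · intro h
      by_contra hst
      exact eval_root_ne_zero hi hst h
    · rintro rfl
      exact eval_root_self hi

theorem locus_false_none : Λ.locus False none = Set.univ := by simp [locus_eq]

theorem locus_true_none : Λ.locus True none = excDivisor := by simp [locus_eq]

theorem locus_false_some (t : ι) : Λ.locus False (some t) = properTransform (Λ.form t) := by
  simp [locus_eq, properTransform_form]

theorem locus_true_some (t : ι) :
    Λ.locus True (some t) = properTransform (Λ.form t) ∩ excDivisor := by
  ext p
  simp [locus_eq, properTransform_form, and_comm]

/-- Needed to turn multiplicities in a multiset of supports into statements of unique existence.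
Conditions along `E` are separated by points off `E`, those along a line by points on a different
line. -/
theorem locus_injective [Nontrivial ι] {U U' : Prop} {l l' : Option ι}
    (h : Λ.locus U l = Λ.locus U' l') : (U ↔ U') ∧ l = l' := by
  have key : ∀ {U U' : Prop} {l l' : Option ι}, Λ.locus U l = Λ.locus U' l' →
      (U → U') ∧ ∀ t ∈ l, t ∈ l' := by
    intro U U' l l' h
    rw [locus_eq, locus_eq] at h
    constructor
    · intro hU
      by_contra hU'
      obtain ⟨s, hs⟩ : ∃ s, ∀ t ∈ l', t = s := by
        rcases l' with - | s
        · exact ⟨Classical.arbitrary ι, by simp⟩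
        · exact ⟨s, fun t ht => by simpa using ht.symm⟩
      obtain ⟨p, hp, hps⟩ := Λ.exists_mem_strictLine_iff s False
      have : p ∈ {p | (U → p ∈ excDivisor) ∧ ∀ t ∈ l, p ∈ Λ.strictLine t} := by
        rw [h]
        exact ⟨fun h => absurd h hU', fun t ht => (hps t).mpr (hs t ht)⟩
      exact hp.mp (this.1 hU)
    · intro t ht
      rcases l' with - | s
      · obtain ⟨r, hr⟩ := exists_ne t
        obtain ⟨p, hp, hps⟩ := Λ.exists_mem_strictLine_iff r True
        have : p ∈ {p | (U → p ∈ excDivisor) ∧ ∀ t ∈ l, p ∈ Λ.strictLine t} := by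
          rw [h]
          exact ⟨fun _ => hp.mpr trivial, by simp⟩
        exact absurd ((hps t).mp (this.2 t ht)).symm hr
      · obtain ⟨p, hp, hps⟩ := Λ.exists_mem_strictLine_iff s True
        have : p ∈ {p | (U → p ∈ excDivisor) ∧ ∀ t ∈ l, p ∈ Λ.strictLine t} := by
          rw [h]
          refine ⟨fun _ => hp.mpr trivial, fun t ht => ?_⟩
          obtain rfl : s = t := by simpa using ht
          exact (hps s).mpr rfl
        rw [(hps t).mp (this.2 t ht)]
        rfl
  refine ⟨⟨(key h).1, (key h.symm).1⟩, ?_⟩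
  exact Option.ext fun t => ⟨(key h).2 t, (key h.symm).2 t⟩

end LineConfig

end Geometry

/-! ### Logarithmic derivatives -/

section LogDerivative

variable {K : Type*} [Field K] [Algebra ℂ K] (D : Derivation ℂ K K)

/-- The logarithmic derivative of an element of a field. -/
def Derivation.dlog (x : K) : K := D x * x⁻¹

theorem Derivation.dlog_mul {x y : K} (hx : x ≠ 0) (hy : y ≠ 0) :
    D.dlog (x * y) = D.dlog x + D.dlog y := by
  simp only [dlog, leibniz, smul_eq_mul]
  field_simp
  ring

theorem Derivation.dlog_zpow {x : K} (hx : x ≠ 0) (n : ℤ) : D.dlog (x ^ n) = n * D.dlog x := by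
  simp only [dlog, leibniz_zpow, smul_eq_mul, zsmul_eq_mul]
  rw [zpow_sub_one₀ hx]
  have := zpow_ne_zero n hx
  field_simp

theorem Derivation.dlog_prod {ι : Type*} (s : Finset ι) {f : ι → K} (hf : ∀ t, f t ≠ 0) :
    D.dlog (∏ t ∈ s, f t) = ∑ t ∈ s, D.dlog (f t) := by
  classical
  induction s using Finset.induction_on with
  | empty => simp [dlog]
  | insert t s ht ih =>
    rw [Finset.prod_insert ht, Finset.sum_insert ht,
      D.dlog_mul (hf t) (Finset.prod_ne_zero_iff.mpr fun s _ => hf s), ih]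

end LogDerivative

/-! ### Localizations inside a field -/

section TensorLocalization

variable {A B L : Type*} [CommRing A] [CommRing B] [Algebra A B] [Field L] [Algebra A L]
  [Algebra B L] [IsScalarTower A B L]

/-- The map from a localization to a field in which the denominator is not zero. -/
def awayToField (P : A) (hP : algebraMap A L P ≠ 0) : Localization.Away P →ₐ[A] L :=
  IsLocalization.liftAlgHom (M := Submonoid.powers P) (f := Algebra.ofId A L) (by
    rintro ⟨_, n, rfl⟩
    change IsUnit (algebraMap A L (P ^ n))
    rw [map_pow]
    exact (pow_ne_zero n hP).isUnit)

/-- Every tensor becomes `b ⊗ 1` after multiplication by a power of `P`. If its image is zero then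
`b = 0`, and `P` acts invertibly on the tensor product. -/
theorem tensorAway_injective (hB : Function.Injective (algebraMap B L)) (P : A)
    (hP : algebraMap A L P ≠ 0) :
    Function.Injective
      (LinearMap.liftBaseChange B (awayToField P hP).toLinearMap :
        B ⊗[A] Localization.Away P →ₗ[B] L) := by
  rw [injective_iff_map_eq_zero]
  intro z hz
  have hex : ∃ (n : ℕ) (b : B), P ^ n • z = b ⊗ₜ[A] (1 : Localization.Away P) := by
    clear hz
    induction z with
    | zero => exact ⟨0, 0, by simp⟩
    | tmul b x =>
      obtain ⟨n, a, ha⟩ := IsLocalization.Away.surj P x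
      refine ⟨n, a • b, ?_⟩
      rw [← TensorProduct.tmul_smul, Algebra.smul_def, map_pow, mul_comm, ha,
        TensorProduct.smul_tmul, Algebra.smul_def, mul_one]
    | add z w hz hw =>
      obtain ⟨n, b, hz⟩ := hz
      obtain ⟨m, c, hw⟩ := hw
      refine ⟨n + m, P ^ m • b + P ^ n • c, ?_⟩
      rw [smul_add, TensorProduct.add_tmul, ← TensorProduct.smul_tmul', ← TensorProduct.smul_tmul',
        ← hz, ← hw, smul_smul, smul_smul, ← pow_add, ← pow_add, add_comm m n]
  obtain ⟨n, b, h⟩ := hex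
  have h1 := congrArg (LinearMap.liftBaseChange B (awayToField P hP).toLinearMap) h
  rw [LinearMap.map_smul_of_tower, hz, smul_zero, LinearMap.liftBaseChange_tmul,
    AlgHom.toLinearMap_apply, map_one, Algebra.smul_def, mul_one] at h1
  rw [hB (h1.symm.trans (map_zero _).symm), TensorProduct.zero_tmul] at h
  have hu : IsUnit (algebraMap A (B ⊗[A] Localization.Away P) (P ^ n)) := by
    have h2 := (IsLocalization.Away.algebraMap_isUnit (S := Localization.Away P) P).map
      (Algebra.TensorProduct.includeRight : Localization.Away P →ₐ[A] B ⊗[A] Localization.Away P)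
    rw [AlgHom.commutes] at h2
    rw [map_pow]
    exact h2.pow n
  exact hu.mul_right_eq_zero.mp ((Algebra.smul_def _ _).symm.trans h)

theorem awayToField_ringInverse {P : A} (hP : algebraMap A L P ≠ 0) {x : Localization.Away P}
    (hx : IsUnit x) : awayToField P hP (Ring.inverse x) = (awayToField P hP x)⁻¹ := by
  refine eq_inv_of_mul_eq_one_left ?_
  rw [← map_mul, Ring.inverse_mul_cancel _ hx, map_one]

end TensorLocalization

/-! ### The inverse image of `M_α^β` as rational functions -/

section PullbackModel

open MvPolynomial

variable {ι : Type} [Fintype ι] [DecidableEq ι] (Λ : LineConfig ι) (β : ι → ℂ)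

theorem algebraMap_plane_field (i : Chart) (f : PlaneRing) :
    algebraMap PlaneRing BlowupField f =
      algebraMap OverlapRing BlowupField
        (algebraMap (ChartRing i) OverlapRing (algebraMap PlaneRing (ChartRing i) f)) := by
  rw [← IsScalarTower.algebraMap_apply PlaneRing (ChartRing i) OverlapRing,
    ← IsScalarTower.algebraMap_apply PlaneRing OverlapRing BlowupField]

/-- Rational functions on the plane, with a derivation of the function field of the blow-up. -/
theorem chartEmbedding_der_plane (i : Chart) (v : Fin 2) (f : PlaneRing) :
    (chartEmbedding i).der v (algebraMap PlaneRing BlowupField f) =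
      ∑ j, algebraMap OverlapRing BlowupField (algebraMap (ChartRing i) OverlapRing
        (chartDer i v (algebraMap PlaneRing (ChartRing i) (X j)))) *
          algebraMap PlaneRing BlowupField (pderiv j f) := by
  rw [algebraMap_plane_field i]
  have h := (chartEmbedding i).der_apply v
    ((chartPoly i).symm (algebraMap PlaneRing (ChartRing i) f))
  refine h.trans ?_
  change algebraMap OverlapRing BlowupField (algebraMap (ChartRing i) OverlapRing
    (chartDer i v (algebraMap PlaneRing (ChartRing i) f))) = _
  rw [derivation_chain_rule, map_sum, map_sum]
  refine Finset.sum_congr rfl fun j _ => ?_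
  rw [Algebra.smul_def, map_mul, map_mul, ← algebraMap_plane_field, mul_comm]

namespace LineConfig

-- The single factor `u` contributed by every line is the reason why the exponent along `E` is the
-- sum of all `β_t`.
omit [Fintype ι] [DecidableEq ι] in
theorem algebraMap_form (i : Chart) (t : ι) :
    algebraMap PlaneRing BlowupField (Λ.form t) =
      (chartEmbedding i).fst * (chartEmbedding i).snd ((chartLines Λ i).line t) := by
  have key : ∀ z, algebraMap PlaneRing BlowupField (C z) = algebraMap ℂ BlowupField z := fun z =>
    (IsScalarTower.algebraMap_apply ℂ PlaneRing BlowupField z).symm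
  have h : ∀ j, algebraMap PlaneRing BlowupField (X j) = chartIncl i (pullCoord i j) := by
    intro j
    rw [algebraMap_plane_field i]
    have : algebraMap PlaneRing (ChartRing i) (X j) = chartPoly i (pullCoord i j) :=
      MvPolynomial.aeval_X _ _
    rw [this]
    rfl
  rw [form, map_add, map_mul, map_mul, key, key, h, h, chartEmbedding_snd_line, chartSnd,
    PlaneEmbedding.fst, chartEmbedding_toAlgHom]
  cases i with
  | one =>
    simp only [pullCoord, chartLines, Matrix.cons_val_zero, Matrix.cons_val_one, map_mul]
    ring
  | two =>
    simp only [pullCoord, chartLines, swap, Matrix.cons_val_zero, Matrix.cons_val_one, map_mul]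
    ring

omit [Fintype ι] [DecidableEq ι] in
theorem algebraMap_form_ne_zero (t : ι) : algebraMap PlaneRing BlowupField (Λ.form t) ≠ 0 := by
  rw [Λ.algebraMap_form .one]
  exact mul_ne_zero (PlaneEmbedding.fst_ne_zero _)
    (map_line_ne_zero (PlaneEmbedding.snd_injective _) t)

theorem algebraMap_prod_form_ne_zero :
    algebraMap PlaneRing BlowupField (∏ t, Λ.form t) ≠ 0 := by
  rw [map_prod]
  exact Finset.prod_ne_zero_iff.mpr fun t _ => Λ.algebraMap_form_ne_zero t

/-- The elements `g α^β` of `M_α^β` as the rational functions `g`. -/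
def planeVal : Localization.Away (∏ t, Λ.form t) →ₐ[PlaneRing] BlowupField :=
  awayToField _ Λ.algebraMap_prod_form_ne_zero

/-- The elements `b ⊗ g α^β` of the inverse image of `M_α^β` as the rational functions `b g`. -/
def overlapVal : OverlapRing ⊗[PlaneRing] Twisted Λ.form β →ₗ[OverlapRing] BlowupField :=
  (LinearMap.liftBaseChange OverlapRing Λ.planeVal.toLinearMap :
    OverlapRing ⊗[PlaneRing] Localization.Away (∏ t, Λ.form t) →ₗ[OverlapRing] BlowupField)

theorem overlapVal_injective : Function.Injective (Λ.overlapVal β) :=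
  tensorAway_injective (IsFractionRing.injective OverlapRing BlowupField) _
    Λ.algebraMap_prod_form_ne_zero

theorem overlapVal_tmul (b : OverlapRing) (g : Localization.Away (∏ t, Λ.form t)) :
    Λ.overlapVal β (b ⊗ₜ[PlaneRing] (show Twisted Λ.form β from g)) =
      algebraMap OverlapRing BlowupField b * Λ.planeVal g :=
  (LinearMap.liftBaseChange_tmul OverlapRing _ _ _).trans (Algebra.smul_def _ _)

/-- Sections of the inverse image of `M_α^β` over a chart as rational functions. -/
def chartVal (i : Chart) : ChartRing i ⊗[PlaneRing] Twisted Λ.form β →+ BlowupField :=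
  (Λ.overlapVal β).toAddMonoidHom.comp
    ((blowupPullback (Twisted Λ.form β)).res i).toAddMonoidHom

theorem chartVal_tmul (i : Chart) (b : ChartRing i) (g : Localization.Away (∏ t, Λ.form t)) :
    Λ.chartVal β i (b ⊗ₜ[PlaneRing] (show Twisted Λ.form β from g)) =
      algebraMap OverlapRing BlowupField (algebraMap (ChartRing i) OverlapRing b) *
        Λ.planeVal g :=
  overlapVal_tmul Λ β _ g

-- A localization is flat, so the inclusion of functions stays injective after tensoring.
omit [DecidableEq ι] in
theorem blowupPullback_res_injective (i : Chart) :
    Function.Injective ((blowupPullback (Twisted Λ.form β)).res i) := by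
  have hflat : Module.Flat PlaneRing (Twisted Λ.form β) :=
    inferInstanceAs (Module.Flat PlaneRing (Localization.Away (∏ t, Λ.form t)))
  exact Module.Flat.rTensor_preserves_injective_linearMap (M := Twisted Λ.form β)
    (IsScalarTower.toAlgHom PlaneRing (ChartRing i) OverlapRing).toLinearMap
    (restrictHom_injective i)

/-- Derivations of the function field on rational functions of the plane. -/
theorem der_planeVal (i : Chart) (v : Fin 2) (g : Localization.Away (∏ t, Λ.form t)) :
    (chartEmbedding i).der v (Λ.planeVal g) =
      ∑ j, algebraMap OverlapRing BlowupField (algebraMap (ChartRing i) OverlapRing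
        (chartDer i v (algebraMap PlaneRing (ChartRing i) (X j)))) *
          Λ.planeVal (extendDerivation (Submonoid.powers (∏ t, Λ.form t)) (pderiv j) g) := by
  set c : Fin 2 → BlowupField := fun j => algebraMap OverlapRing BlowupField
    (algebraMap (ChartRing i) OverlapRing
      (chartDer i v (algebraMap PlaneRing (ChartRing i) (X j)))) with hc
  have hA : ∀ f : PlaneRing, (chartEmbedding i).der v (algebraMap PlaneRing BlowupField f) =
      ∑ j, c j * Λ.planeVal (extendDerivation (Submonoid.powers (∏ t, Λ.form t)) (pderiv j)
        (algebraMap _ _ f)) := fun f => by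
    rw [chartEmbedding_der_plane]
    refine Finset.sum_congr rfl fun j _ => ?_
    rw [extendDerivation_algebraMap, AlgHom.commutes]
  -- The formula holds for polynomials, and both sides obey the Leibniz rule; comparing them on `g *
  -- s = a` and cancelling `s` gives it for `g`.
  obtain ⟨n, a, ha⟩ := IsLocalization.Away.surj (∏ t, Λ.form t) g
  rw [← map_pow] at ha
  set s := (∏ t, Λ.form t) ^ n with hs
  have hs0 : algebraMap PlaneRing BlowupField s ≠ 0 := by
    rw [hs, map_pow]
    exact pow_ne_zero n Λ.algebraMap_prod_form_ne_zero
  have h1 := congrArg Λ.planeVal ha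
  rw [map_mul, AlgHom.commutes, AlgHom.commutes] at h1
  have h2 := hA a
  rw [← h1, Derivation.leibniz, hA s] at h2
  simp only [← ha, Derivation.leibniz, map_add, smul_eq_mul, map_mul, mul_add,
    Finset.sum_add_distrib, AlgHom.commutes] at h2
  refine mul_left_cancel₀ hs0 ?_
  have h3 : Λ.planeVal g * ∑ j, c j * Λ.planeVal (extendDerivation
      (Submonoid.powers (∏ t, Λ.form t)) (pderiv j) (algebraMap _ _ s)) =
      ∑ j, c j * (Λ.planeVal g * Λ.planeVal (extendDerivation
      (Submonoid.powers (∏ t, Λ.form t)) (pderiv j) (algebraMap _ _ s))) := by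
    rw [Finset.mul_sum]
    exact Finset.sum_congr rfl fun j _ => by ring
  have h4 : algebraMap PlaneRing BlowupField s * ∑ j, c j * Λ.planeVal (extendDerivation
      (Submonoid.powers (∏ t, Λ.form t)) (pderiv j) g) =
      ∑ j, c j * (algebraMap PlaneRing BlowupField s * Λ.planeVal (extendDerivation
      (Submonoid.powers (∏ t, Λ.form t)) (pderiv j) g)) := by
    rw [Finset.mul_sum]
    exact Finset.sum_congr rfl fun j _ => by ring
  rw [h4]
  rw [h3] at h2
  linear_combination h2

theorem planeVal_logDer (j : Fin 2) : Λ.planeVal (logDer Λ.form β (pderiv j)) =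
    ∑ t, algebraMap ℂ BlowupField (β t) * (algebraMap PlaneRing BlowupField (pderiv j (Λ.form t)) *
      (algebraMap PlaneRing BlowupField (Λ.form t))⁻¹) := by
  rw [logDer, map_sum]
  refine Finset.sum_congr rfl fun t _ => ?_
  have hsm : ∀ (z : ℂ) (x : Localization.Away (∏ t, Λ.form t)),
      Λ.planeVal (z • x) = algebraMap ℂ BlowupField z * Λ.planeVal x := fun z x => by
    rw [← algebraMap_smul PlaneRing z x, map_smul, algebraMap_smul, Algebra.smul_def]
  rw [hsm, map_mul, AlgHom.commutes, planeVal, awayToField_ringInverse _ (isUnit_factor _ t),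
    AlgHom.commutes]

/-- The connection on the inverse image of `M_α^β` in terms of rational functions. -/
theorem chartVal_nabla (i : Chart) (v : Fin 2)
    (x : ChartRing i ⊗[PlaneRing] Twisted Λ.form β) :
    Λ.chartVal β i (DMod.nabla (chartDer i v) x) =
      (chartEmbedding i).der v (Λ.chartVal β i x) +
        (∑ t, algebraMap ℂ BlowupField (β t) *
          ((chartEmbedding i).der v).dlog (algebraMap PlaneRing BlowupField (Λ.form t))) *
        Λ.chartVal β i x := by
  induction x with
  | zero => simp
  | add x y hx hy =>
    rw [map_add, map_add, hx, hy, map_add, map_add]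
    ring
  | tmul b g =>
    have hlog : (∑ t, algebraMap ℂ BlowupField (β t) *
          ((chartEmbedding i).der v).dlog (algebraMap PlaneRing BlowupField (Λ.form t))) =
        ∑ j, algebraMap OverlapRing BlowupField (algebraMap (ChartRing i) OverlapRing
          (chartDer i v (algebraMap PlaneRing (ChartRing i) (X j)))) *
            Λ.planeVal (logDer Λ.form β (pderiv j)) := by
      simp only [planeVal_logDer, Derivation.dlog, chartEmbedding_der_plane, Finset.mul_sum,
        Finset.sum_mul]
      rw [Finset.sum_comm]
      exact Finset.sum_congr rfl fun j _ => Finset.sum_congr rfl fun t _ => by ring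
    have hb : (chartEmbedding i).der v (algebraMap OverlapRing BlowupField
        (algebraMap (ChartRing i) OverlapRing b)) = algebraMap OverlapRing BlowupField
        (algebraMap (ChartRing i) OverlapRing (chartDer i v b)) :=
      (chartEmbedding i).der_apply v ((chartPoly i).symm b)
    change Λ.chartVal β i (inverseImageNabla (chartDer i v) _) = _
    rw [inverseImageNabla_tmul, map_add, map_sum]
    have hsum : ∀ j, Λ.chartVal β i ((b * chartDer i v (algebraMap PlaneRing (ChartRing i) (X j)))
        ⊗ₜ[PlaneRing] DMod.nabla (pderiv (R := ℂ) j) g) =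
        algebraMap OverlapRing BlowupField (algebraMap (ChartRing i) OverlapRing b) *
        (algebraMap OverlapRing BlowupField (algebraMap (ChartRing i) OverlapRing
          (chartDer i v (algebraMap PlaneRing (ChartRing i) (X j)))) *
          Λ.planeVal (extendDerivation (Submonoid.powers (∏ t, Λ.form t)) (pderiv j) g) +
        algebraMap OverlapRing BlowupField (algebraMap (ChartRing i) OverlapRing
          (chartDer i v (algebraMap PlaneRing (ChartRing i) (X j)))) *
            Λ.planeVal (logDer Λ.form β (pderiv j)) * Λ.planeVal g) := by
      intro j
      refine (Λ.chartVal_tmul β i _ (twistedNabla Λ.form β (pderiv j) g)).trans ?_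
      have h : ∀ g : Localization.Away (∏ t, Λ.form t),
          Λ.planeVal (twistedNabla Λ.form β (pderiv j) g) =
            Λ.planeVal (extendDerivation (Submonoid.powers (∏ t, Λ.form t)) (pderiv j) g) +
              Λ.planeVal (logDer Λ.form β (pderiv j)) * Λ.planeVal g := fun g => by
        rw [twistedNabla_apply, map_add, map_mul, mul_comm (Λ.planeVal g)]
      rw [h g, map_mul, map_mul]
      ring
    have hg : ∀ b' : ChartRing i, Λ.chartVal β i (b' ⊗ₜ[PlaneRing] g) =
        algebraMap OverlapRing BlowupField (algebraMap (ChartRing i) OverlapRing b') *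
          Λ.planeVal g := fun b' => Λ.chartVal_tmul β i b' g
    rw [Finset.sum_congr rfl fun j _ => hsum j, ← Finset.mul_sum, Finset.sum_add_distrib,
      ← Finset.sum_mul, ← hlog, hg, hg, Derivation.leibniz, hb, Λ.der_planeVal i v g]
    simp only [smul_eq_mul]
    ring

omit [DecidableEq ι] in
theorem algebraMap_prod_form (i : Chart) : algebraMap PlaneRing BlowupField (∏ t, Λ.form t) =
    (chartEmbedding i).fst ^ Fintype.card ι *
      (chartEmbedding i).snd ((chartLines Λ i).prod Finset.univ) := by
  rw [map_prod, Finset.prod_congr rfl fun t _ => Λ.algebraMap_form i t, Finset.prod_mul_distrib,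
    Finset.prod_const, Finset.card_univ, LineConfig.prod, map_prod]

theorem mem_range_chartVal [Nonempty ι] (i : Chart) (g : BlowupField) :
    g ∈ (chartEmbedding i).planeFractions (chartLines Λ i) Finset.univ ↔
      ∃ x, g = Λ.chartVal β i x := by
  have hP := Λ.algebraMap_prod_form_ne_zero
  constructor
  · rintro ⟨n, r, hr⟩
    -- The product of the forms is `u^(k+1) ∏ l_t`, while the given denominator is a power of `u ∏
    -- l_t`; the missing factors `u^(k n)` go into the numerator. At least one line is needed for a
    -- pole along `E`.
    obtain ⟨k, hk⟩ : ∃ k, Fintype.card ι = k + 1 := Nat.exists_eq_succ_of_ne_zero Fintype.card_ne_zero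
    refine ⟨_, .trans ?_ (Λ.chartVal_tmul β i (chartPoly i (X 0 ^ (k * n) * r))
      (IsLocalization.Away.invSelf (∏ t, Λ.form t) ^ n)).symm⟩
    have hinv : Λ.planeVal (IsLocalization.Away.invSelf (∏ t, Λ.form t)) =
        (algebraMap PlaneRing BlowupField (∏ t, Λ.form t))⁻¹ := by
      refine eq_inv_of_mul_eq_one_right ?_
      rw [← Λ.planeVal.commutes, ← map_mul, IsLocalization.Away.mul_invSelf, map_one]
    rw [map_pow, hinv]
    change g = chartIncl i (X 0 ^ (k * n) * r) * _
    rw [← chartEmbedding_toAlgHom, map_mul, ← hr, inv_pow, eq_mul_inv_iff_mul_eq₀ (pow_ne_zero n hP),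
      Λ.algebraMap_prod_form i, hk, map_pow, ← PlaneEmbedding.fst]
    ring
  · rintro ⟨x, rfl⟩
    induction x with
    | zero => rw [map_zero]; exact zero_mem _
    | add x y hx hy => rw [map_add]; exact add_mem hx hy
    | tmul b g =>
      have hg : Λ.chartVal β i (b ⊗ₜ[PlaneRing] g) =
        algebraMap OverlapRing BlowupField (algebraMap (ChartRing i) OverlapRing b) *
          Λ.planeVal g := Λ.chartVal_tmul β i b g
      have hincl : ∀ b' : ChartRing i, algebraMap OverlapRing BlowupField
          (algebraMap (ChartRing i) OverlapRing b') ∈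
          (chartEmbedding i).planeFractions (chartLines Λ i) Finset.univ := fun b' =>
        PlaneEmbedding.toAlgHom_mem_planeFractions _ ((chartPoly i).symm b')
      rw [hg]
      refine mul_mem (hincl b) ?_
      obtain ⟨n, a, ha⟩ := IsLocalization.Away.surj (∏ t, Λ.form t)
        (show Localization.Away (∏ t, Λ.form t) from g)
      have h1 := congrArg Λ.planeVal ha
      rw [map_mul, map_pow, AlgHom.commutes, AlgHom.commutes] at h1
      rw [(eq_mul_inv_iff_mul_eq₀ (pow_ne_zero n hP)).mpr h1]
      refine mul_mem ?_ ?_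
      · rw [algebraMap_plane_field i]
        exact hincl _
      · rw [← inv_pow]
        refine pow_mem ?_ n
        rw [Λ.algebraMap_prod_form i, mul_inv, ← zpow_natCast, ← zpow_neg, LineConfig.prod,
          map_prod, ← Finset.prod_inv_distrib]
        refine mul_mem (PlaneEmbedding.fst_zpow_mem_planeFractions _ _) (prod_mem fun t _ => ?_)
        rw [← zpow_neg_one]
        exact PlaneEmbedding.line_zpow_mem_planeFractions (Finset.mem_univ t) _

/-- The generator of the inverse image of `M_α^β` on a chart which differs from `α^β` by integral
powers of the equations of the divisors. -/
def generator (i : Chart) (z : ℤ) (n : ι → ℤ) : BlowupField :=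
  (chartEmbedding i).fst ^ z * ∏ t, (chartEmbedding i).snd ((chartLines Λ i).line t) ^ n t

variable {Λ} in
omit [DecidableEq ι] in
theorem generator_ne_zero (i : Chart) (z : ℤ) (n : ι → ℤ) : Λ.generator i z n ≠ 0 :=
  mul_ne_zero (zpow_ne_zero _ (PlaneEmbedding.fst_ne_zero _))
    (Finset.prod_ne_zero_iff.mpr fun t _ => zpow_ne_zero _
      (map_line_ne_zero (PlaneEmbedding.snd_injective _) t))

omit [DecidableEq ι] in
theorem generator_mem (i : Chart) (z : ℤ) (n : ι → ℤ) :
    Λ.generator i z n ∈ (chartEmbedding i).planeFractions (chartLines Λ i) Finset.univ :=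
  mul_mem (PlaneEmbedding.fst_zpow_mem_planeFractions _ _) (prod_mem fun t _ =>
    PlaneEmbedding.line_zpow_mem_planeFractions (Finset.mem_univ t) _)

omit [DecidableEq ι] in
theorem inv_generator (i : Chart) (z : ℤ) (n : ι → ℤ) :
    (Λ.generator i z n)⁻¹ = Λ.generator i (-z) (-n) := by
  simp only [generator, mul_inv, ← zpow_neg, ← Finset.prod_inv_distrib, Pi.neg_apply]

/-- Each `l_t` changes by one factor of the coordinate and so does `u`, in opposite directions. The
total exponent is the `κ` of the model. -/
theorem generator_other (i : Chart) (z : ℤ) (n : ι → ℤ) :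
    Λ.generator i z n = Λ.generator i.other z n * chartSnd i.other ^ (z - ∑ t, n t) := by
  have hi : i.other.other = i := by cases i <;> rfl
  have hu := chartEmbedding_fst_other i.other
  have hw := chartSnd_ne_zero i.other
  rw [hi] at hu
  have hprod : ∏ t, (chartEmbedding i.other).snd ((chartLines Λ i.other).line t) ^ n t =
      (∏ t, (chartEmbedding i).snd ((chartLines Λ i).line t) ^ n t) *
        chartSnd i.other ^ (∑ t, n t) := by
    rw [Finset.prod_congr rfl fun t _ => by rw [chartEmbedding_line_other, mul_zpow],
      Finset.prod_mul_distrib]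
    congr 1
    induction (Finset.univ : Finset ι) using Finset.induction_on with
    | empty => simp
    | insert t s ht ih => rw [Finset.prod_insert ht, Finset.sum_insert ht, zpow_add₀ hw, ih]
  rw [generator, generator, hprod, hu, mul_zpow, zpow_sub₀ hw]
  have := zpow_ne_zero (∑ t, n t) hw
  field_simp

omit [DecidableEq ι] in
theorem dlog_generator (i : Chart) (v : Fin 2) (z : ℤ) (n : ι → ℤ) :
    ((chartEmbedding i).der v).dlog (Λ.generator i z n) =
      z * ((chartEmbedding i).der v).dlog (chartEmbedding i).fst +
      ∑ t, n t * ((chartEmbedding i).der v).dlog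
        ((chartEmbedding i).snd ((chartLines Λ i).line t)) := by
  have hu := (chartEmbedding i).fst_ne_zero
  have hl := fun t => map_line_ne_zero (Λ := chartLines Λ i)
    (chartEmbedding i).snd_injective t
  rw [generator, Derivation.dlog_mul _ (zpow_ne_zero _ hu) (Finset.prod_ne_zero_iff.mpr
    fun t _ => zpow_ne_zero _ (hl t)), Derivation.dlog_zpow _ hu,
    Derivation.dlog_prod _ _ fun t => zpow_ne_zero _ (hl t)]
  simp only [Derivation.dlog_zpow _ (hl _)]

/-- The inverse image of `M_α^β` on the blow-up as a module of rational functions. -/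
def pullbackModel [Nonempty ι] (z : ℤ) (n : ι → ℤ) (T : Finset ι)
    (hT : ∀ t ∈ T, ∀ z : ℤ, β t ≠ z) (hn : ∀ t ∈ T, n t = 0) (hβ : ∀ t ∉ T, β t = n t) :
    BlowupModel (blowupPullback (Twisted Λ.form β)) Λ where
  toField := Λ.overlapVal β
  injective := Λ.overlapVal_injective β
  -- The new generator `e * α^β` is `u^(|β| - z) ∏ l_t^(β_t - n_t)`, and a section is described by
  -- its coefficient with respect to it.
  e i := Λ.generator i (-z) (-n)
  e_ne_zero i := generator_ne_zero i _ _
  κ := -z - ∑ t, (-n) t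
  e_other i := Λ.generator_other i _ _
  γ := ∑ t, β t - z
  T := T
  η := β
  η_int := hT
  res_injective := Λ.blowupPullback_res_injective β
  range i g := by
    have he := generator_ne_zero (Λ := Λ) i (-z) (-n)
    change g ∈ _ ↔ ∃ x, Λ.generator i (-z) (-n) * g = Λ.chartVal β i x
    rw [← mem_range_chartVal]
    refine ⟨mul_mem (Λ.generator_mem i _ _), fun h => ?_⟩
    have := mul_mem (Λ.generator_mem i (- -z) (- -n)) h
    rwa [← inv_generator, inv_mul_cancel_left₀ he] at this
  nabla i v x := by
    have he := generator_ne_zero (Λ := Λ) i (-z) (-n)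
    have hx := Λ.chartVal_nabla β i v x
    have hu := (chartEmbedding i).fst_ne_zero
    have hl := fun t => map_line_ne_zero (Λ := chartLines Λ i)
      (chartEmbedding i).snd_injective t
    have hde := Λ.dlog_generator i v (-z) (-n)
    set D := (chartEmbedding i).der v with hD
    -- The connection form of `e * α^β` is the logarithmic derivative of `α^β` plus that of `e`, in
    -- which the integral exponents cancel.
    have hform : (∑ t, algebraMap ℂ BlowupField (β t) *
          D.dlog (algebraMap PlaneRing BlowupField (Λ.form t))) +
        D.dlog (Λ.generator i (-z) (-n)) =
        (![algebraMap ℂ BlowupField (∑ t, β t - z) * (chartEmbedding i).fst⁻¹,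
          (chartLines Λ i).logForm (chartEmbedding i).snd T β] : Fin 2 → BlowupField) v := by
      have h1 : ∀ t, D.dlog (algebraMap PlaneRing BlowupField (Λ.form t)) =
          D.dlog (chartEmbedding i).fst +
            D.dlog ((chartEmbedding i).snd ((chartLines Λ i).line t)) := fun t => by
        rw [Λ.algebraMap_form i, Derivation.dlog_mul _ hu (hl t)]
      have h2 : (∑ t, algebraMap ℂ BlowupField (β t) *
          D.dlog (algebraMap PlaneRing BlowupField (Λ.form t))) +
          D.dlog (Λ.generator i (-z) (-n)) =
          algebraMap ℂ BlowupField (∑ t, β t - z) * D.dlog (chartEmbedding i).fst +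
          ∑ t, algebraMap ℂ BlowupField (β t - n t) *
            D.dlog ((chartEmbedding i).snd ((chartLines Λ i).line t)) := by
        rw [hde]
        simp only [h1, mul_add, Finset.sum_add_distrib, map_sub, map_sum, map_intCast, sub_mul,
          Finset.sum_sub_distrib, Finset.sum_mul, Pi.neg_apply, Int.cast_neg, neg_mul,
          Finset.sum_neg_distrib]
        ring
      rw [h2]
      fin_cases v
      · have h3 : ∀ t, D.dlog ((chartEmbedding i).snd ((chartLines Λ i).line t)) = 0 := fun t => by
          rw [Derivation.dlog, hD]
          erw [PlaneEmbedding.der_zero_snd, zero_mul]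
        have h4 : D.dlog (chartEmbedding i).fst = (chartEmbedding i).fst⁻¹ := by
          rw [Derivation.dlog, hD]
          erw [PlaneEmbedding.der_zero_fst, one_mul]
        simp [h3, h4]
      · have h3 : ∀ t, D.dlog ((chartEmbedding i).snd ((chartLines Λ i).line t)) =
            algebraMap ℂ BlowupField ((chartLines Λ i).b t) *
              ((chartEmbedding i).snd ((chartLines Λ i).line t))⁻¹ := fun t => by
          rw [Derivation.dlog, hD]
          erw [PlaneEmbedding.der_one_snd]
          congr 1
          rw [LineConfig.line]
          simp only [Polynomial.derivative_add, Polynomial.derivative_C,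
            Polynomial.derivative_C_mul, Polynomial.derivative_X, mul_one, zero_add]
          exact (chartEmbedding i).snd.commutes _
        have h4 : D.dlog (chartEmbedding i).fst = 0 := by
          rw [Derivation.dlog, hD]
          erw [PlaneEmbedding.der_one_fst, zero_mul]
        rw [h4, mul_zero, zero_add]
        change _ = (chartLines Λ i).logForm (chartEmbedding i).snd T β
        rw [LineConfig.logForm, ← Finset.sum_subset (Finset.subset_univ T)]
        · refine Finset.sum_congr rfl fun t ht => ?_
          rw [h3, hn t ht, Int.cast_zero, sub_zero, map_mul, mul_assoc]
        · intro t _ ht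
          rw [hβ t ht, sub_self, map_zero, zero_mul]
    change (Λ.generator i (-z) (-n))⁻¹ * Λ.chartVal β i (DMod.nabla (chartDer i v) x) =
      D ((Λ.generator i (-z) (-n))⁻¹ * Λ.chartVal β i x) + _ *
        ((Λ.generator i (-z) (-n))⁻¹ * Λ.chartVal β i x)
    rw [hx, ← hform, Derivation.leibniz, Derivation.leibniz_inv, Derivation.dlog]
    simp only [smul_eq_mul]
    field_simp
    ring

end LineConfig

end PullbackModel

/-! ### The composition series -/

section Series

/-- The zero module, or fractions whose poles contain `T`. -/
def IsLevel {ι : Type*} (T : Finset ι) (x : WithBot (Finset ι)) : Prop :=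
  ∀ S : Finset ι, x = S → T ⊆ S

theorem isLevel_bot {ι : Type*} (T : Finset ι) : IsLevel T ⊥ := fun S h => by simp at h

theorem isLevel_coe {ι : Type*} {T S : Finset ι} (h : T ⊆ S) : IsLevel T S := fun S' hS' => by
  rwa [← WithBot.coe_inj.mp hS']

/-- Climb from zero to poles along `T`, then add the lines outside `T` one by one. The family `f` is
left abstract so that the same climb serves for constant levels and for either block of degrees. -/
theorem HasFactors.of_levelSteps {ι X L : Type*} [Fintype ι] [DecidableEq ι] [PartialOrder X]
    {supp : X → X → L} {T : Finset ι} (f : ∀ x, IsLevel T x → X) (σ : Option ι → L)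
    (hf : ∀ low high l (h : IsLevel T low) (h' : IsLevel T high), LevelStep T low high l →
      f low h ⋖ f high h' ∧ supp (f low h) (f high h') = σ l) :
    HasFactors supp (f ⊥ (isLevel_bot T)) (f _ (isLevel_coe (Finset.subset_univ T)))
      ((Finset.insertNone Tᶜ).val.map σ) := by
  have key : ∀ J ⊆ Tᶜ, HasFactors supp (f ⊥ (isLevel_bot T))
      (f _ (isLevel_coe (Finset.subset_union_left (s₁ := T) (s₂ := J))))
      ((Finset.insertNone J).val.map σ) := by
    intro J
    induction J using Finset.induction_on with
    | empty =>
      intro _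
      obtain ⟨h, hs⟩ := hf _ _ _ (isLevel_bot T) (isLevel_coe subset_rfl) .base
      have := HasFactors.single (supp := supp) h
      rw [hs] at this
      convert this using 2
      · simp
      · rfl
    | insert t J ht ih =>
      intro hJ
      rw [Finset.insert_subset_iff] at hJ
      have htJ : t ∉ T ∪ J := by
        rw [Finset.mem_union, not_or]
        exact ⟨Finset.mem_compl.mp hJ.1, ht⟩
      obtain ⟨h, hs⟩ := hf _ _ _ (isLevel_coe Finset.subset_union_left)
        (isLevel_coe (Finset.subset_union_left.trans (Finset.subset_insert t (T ∪ J))))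
        (.insert (T ∪ J) t Finset.subset_union_left htJ)
      have := (ih hJ.2).snoc h
      rw [hs] at this
      have hins : Finset.insertNone (insert t J) = insert (some t) (Finset.insertNone J) := by
        ext (_ | s) <;> simp
      rw [hins, Finset.insert_val_of_notMem (by simpa using ht), Multiset.map_cons]
      convert this using 3
      exact Finset.union_insert t T J
  have := key Tᶜ subset_rfl
  convert this using 3
  exact (Finset.union_compl T).symm

namespace BlowupModel

variable {F : BlowupDMod} {ι : Type} [Fintype ι] [DecidableEq ι] {Λ : LineConfig ι}
  {m : BlowupModel F Λ}

theorem Admissible.subDMod_eq_bot {lev : ℤ → WithBot (Finset ι)} (h : m.Admissible lev)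
    (hlev : ∀ j, lev j = ⊥) : h.subDMod = ⊥ := by
  obtain rfl : lev = fun _ => ⊥ := funext hlev
  refine eq_bot_iff.mpr fun i x hx => ?_
  have h0 : m.val i x ∈ gradedLevel Λ i fun _ => ⊥ := hx
  have h1 : gradedLevel Λ i (fun _ => ⊥) = ⊥ := PlaneEmbedding.graded_bot
  rw [h1, AddSubgroup.mem_bot] at h0
  exact m.val_injective i (h0.trans (map_zero _).symm)

theorem Admissible.subDMod_eq_top {lev : ℤ → WithBot (Finset ι)} (h : m.Admissible lev)
    (hlev : ∀ j, lev j = (Finset.univ : Finset ι)) : h.subDMod = ⊤ := by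
  obtain rfl : lev = fun _ => ((Finset.univ : Finset ι) : WithBot (Finset ι)) := funext hlev
  refine eq_top_iff.mpr fun i x _ => ?_
  have h1 : gradedLevel Λ i (fun _ => ((Finset.univ : Finset ι) : WithBot (Finset ι))) =
      ((chartEmbedding i).planeFractions (chartLines Λ i) Finset.univ).toAddSubgroup :=
    PlaneEmbedding.graded_fractions _
  change m.val i x ∈ gradedLevel Λ i _
  rw [h1]
  refine (m.range i _).mpr ⟨x, ?_⟩
  rw [val_apply, mul_inv_cancel_left₀ (m.e_ne_zero i)]

theorem admissible_const {x : WithBot (Finset ι)} (hx : IsLevel m.T x) :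
    m.Admissible fun _ => x where
  subset _ := hx
  le_succ _ := le_rfl
  succ_le _ _ := le_rfl

/-- The level `x` in negative degrees and the level `y` in the other degrees. -/
def splitLevel (x y : WithBot (Finset ι)) (j : ℤ) : WithBot (Finset ι) := if j < 0 then x else y

/-- For `γ = 0` the descent from degree `j + 1` to `j` fails only at `j = -1`, so the level may jump
exactly between the degrees `-1` and `0`. -/
theorem admissible_splitLevel (hγ : m.γ = 0) {x y : WithBot (Finset ι)} (hx : IsLevel m.T x)
    (hy : IsLevel m.T y) (hxy : x ≤ y) : m.Admissible (splitLevel x y) where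
  subset j S hS := by
    rw [splitLevel] at hS
    split_ifs at hS
    exacts [hx S hS, hy S hS]
  le_succ j := by
    simp only [splitLevel]
    split_ifs
    exacts [le_rfl, hxy, by omega, le_rfl]
  succ_le j hj := by
    have : j + 1 ≠ 0 := fun h => hj (by rw [hγ, add_zero]; exact_mod_cast h)
    simp only [splitLevel]
    split_ifs
    exacts [le_rfl, by omega, by omega, le_rfl]

theorem isStep_const (hγ : ∀ z : ℤ, m.γ ≠ z) {low high : WithBot (Finset ι)} {l : Option ι}
    (h : LevelStep m.T low high l) :
    IsStep m (fun _ => low) (fun _ => high) Set.univ 0 False l where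
  ordConnected := Set.ordConnected_univ
  linked j _ _ hj := hγ (-(j + 1)) (by push_cast; linear_combination hj)
  mem := trivial
  bounded h := h.elim
  unbounded _ _ := trivial
  eq_off j hj := absurd trivial hj
  step := ⟨low, high, h, fun _ _ => rfl, fun _ _ => rfl⟩

theorem isStep_splitLevel_right (hγ : m.γ = 0) {low high : WithBot (Finset ι)} {l : Option ι}
    (x : WithBot (Finset ι)) (h : LevelStep m.T low high l) :
    IsStep m (splitLevel x low) (splitLevel x high) (Set.Ici 0) 0 False l where
  ordConnected := Set.ordConnected_Ici
  linked j hj _ := by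
    have : j + 1 ≠ 0 := by have := Set.mem_Ici.mp hj; omega
    rw [hγ, add_zero]
    exact_mod_cast this
  mem := Set.mem_Ici.mpr le_rfl
  bounded h := h.elim
  unbounded _ k := by simp
  eq_off j hj := by
    have : j < 0 := by simpa using hj
    simp [splitLevel, this]
  step := ⟨low, high, h, fun j hj => if_neg (not_lt.mpr hj), fun j hj => if_neg (not_lt.mpr hj)⟩

/-- The negative degrees are bounded above by `-1`, so powers of `u` carry every section into the
smaller module and the factor lives on `E`. -/
theorem isStep_splitLevel_left (hγ : m.γ = 0) {low high : WithBot (Finset ι)} {l : Option ι}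
    (y : WithBot (Finset ι)) (h : LevelStep m.T low high l) :
    IsStep m (splitLevel low y) (splitLevel high y) (Set.Iio 0) (-1) True l where
  ordConnected := Set.ordConnected_Iio
  linked j _ hj := by
    have : j + 1 ≠ 0 := by have := Set.mem_Iio.mp hj; omega
    rw [hγ, add_zero]
    exact_mod_cast this
  mem := by simp
  bounded _ j hj := by have := Set.mem_Iio.mp hj; omega
  unbounded h := absurd trivial h
  eq_off j hj := by
    have : ¬ j < 0 := by simpa using hj
    simp [splitLevel, this]
  step := ⟨low, high, h, fun j hj => if_pos hj, fun j hj => if_pos hj⟩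

variable (m)

/-- The decomposition factors when the order along the exceptional divisor is not an integer. -/
theorem hasFactors_of_ne (hγ : ∀ z : ℤ, m.γ ≠ z) :
    HasFactors subquotientSupport (⊥ : SubDMod F) ⊤
      ((Finset.insertNone m.Tᶜ).val.map (Λ.locus False)) := by
  have h := HasFactors.of_levelSteps (supp := subquotientSupport (F := F)) (T := m.T)
    (fun _ hx => (admissible_const (m := m) hx).subDMod) (Λ.locus False)
    fun low high l h h' hst => ⟨(isStep_const hγ hst).covBy _ _, (isStep_const hγ hst).support _ _⟩
  rwa [Admissible.subDMod_eq_bot _ fun _ => rfl, Admissible.subDMod_eq_top _ fun _ => rfl] at h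

/-- The decomposition factors when the order along the exceptional divisor is an integer. -/
theorem hasFactors_of_eq_zero (hγ : m.γ = 0) :
    HasFactors subquotientSupport (⊥ : SubDMod F) ⊤
      ((Finset.insertNone m.Tᶜ).val.map (Λ.locus False) +
        (Finset.insertNone m.Tᶜ).val.map (Λ.locus True)) := by
  have hbot := isLevel_bot m.T
  have htop := isLevel_coe (Finset.subset_univ m.T)
  have hle : ∀ x : WithBot (Finset ι), x ≤ (Finset.univ : Finset ι) := fun x => by
    induction x with
    | bot => exact bot_le
    | coe S => exact WithBot.coe_le_coe.mpr (Finset.subset_univ S)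
  -- First the degrees `j ≥ 0` are filled while the negative ones stay zero.
  have h := HasFactors.of_levelSteps (supp := subquotientSupport (F := F)) (T := m.T)
    (fun _ hx => (admissible_splitLevel hγ hbot hx bot_le).subDMod) (Λ.locus False)
    fun low high l h h' hst => ⟨(isStep_splitLevel_right hγ ⊥ hst).covBy _ _,
      (isStep_splitLevel_right hγ ⊥ hst).support _ _⟩
  -- Then the negative degrees are filled, over the full non-negative part.
  have h' := HasFactors.of_levelSteps (supp := subquotientSupport (F := F)) (T := m.T)
    (fun _ hx => (admissible_splitLevel hγ hx htop (hle _)).subDMod) (Λ.locus True)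
    fun low high l h h' hst => ⟨(isStep_splitLevel_left hγ _ hst).covBy _ _,
      (isStep_splitLevel_left hγ _ hst).support _ _⟩
  rw [Admissible.subDMod_eq_bot _ fun j => by simp [splitLevel]] at h
  rw [Admissible.subDMod_eq_top (admissible_splitLevel hγ htop htop (hle _))
    fun j => by simp [splitLevel]] at h'
  exact h.trans h'

end BlowupModel

/-- An injective labelling of a finite set has no repeated value, so equality of multisets contains
the length, the uniqueness of each index and the completeness of the list. -/
theorem DecompositionSeries.supp_of_map_eq {F : BlowupDMod} (s : DecompositionSeries F)
    {κ : Type*} {W : Finset κ} {f : κ → Set Blowup} (hf : Function.Injective f)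
    (h : Finset.univ.val.map s.supp = W.val.map f) :
    s.length = W.card ∧ (∀ w ∈ W, ∃! j, s.supp j = f w) ∧ ∀ j, ∃ w ∈ W, s.supp j = f w := by
  refine ⟨?_, fun w hw => ?_, fun j => ?_⟩
  · simpa using congrArg Multiset.card h
  · have hn : (Finset.univ.val.map s.supp).Nodup := h ▸ W.nodup.map hf
    have hm : f w ∈ Finset.univ.val.map s.supp := h ▸ Multiset.mem_map_of_mem f hw
    obtain ⟨j, -, hj⟩ := Multiset.mem_map.mp hm
    exact ⟨j, hj, fun j' hj' => Multiset.inj_on_of_nodup_map hn j' (Finset.mem_univ_val j') j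
      (Finset.mem_univ_val j) (hj'.trans hj.symm)⟩
  · have hm : s.supp j ∈ W.val.map f := h ▸ Multiset.mem_map_of_mem s.supp (Finset.mem_univ_val j)
    obtain ⟨w, hw, hj⟩ := Multiset.mem_map.mp hm
    exact ⟨w, hw, hj.symm⟩

/-- The lines `x = 0`, `y = 0` and `x + c_i y = 0`. -/
def standardLines {n : ℕ} (c : Fin n → ℂ) (hc : Function.Injective c) (hc0 : ∀ i, c i ≠ 0) :
    LineConfig (Fin (n + 2)) where
  a := Fin.cons 1 (Fin.cons 0 fun _ => 1)
  b := Fin.cons 0 (Fin.cons 1 c)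
  ne_zero t := by
    induction t using Fin.cases with
    | zero => exact Or.inl one_ne_zero
    | succ t =>
      induction t using Fin.cases with
      | zero => exact Or.inr one_ne_zero
      | succ t => exact Or.inl one_ne_zero
  det_ne_zero s t hst := by
    induction s using Fin.cases with
    | zero =>
      induction t using Fin.cases with
      | zero => exact absurd rfl hst
      | succ t => induction t using Fin.cases with
        | zero => simp
        | succ t => simpa using hc0 t
    | succ s =>
      induction s using Fin.cases with
      | zero =>
        induction t using Fin.cases with
        | zero => simp
        | succ t => induction t using Fin.cases with
          | zero => exact absurd rfl hst
          | succ t => simp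
      | succ s =>
        induction t using Fin.cases with
        | zero => simpa using hc0 s
        | succ t => induction t using Fin.cases with
          | zero => simp
          | succ t =>
            simp only [Fin.cons_succ, one_mul]
            exact sub_ne_zero.mpr fun h => hst (by rw [hc h])

theorem lineForms_eq_form {n : ℕ} (c : Fin n → ℂ) (hc : Function.Injective c)
    (hc0 : ∀ i, c i ≠ 0) : lineForms c = (standardLines c hc hc0).form := by
  funext t
  induction t using Fin.cases with
  | zero => simp [lineForms, LineConfig.form, standardLines]
  | succ t => induction t using Fin.cases with
    | zero => simp [lineForms, LineConfig.form, standardLines]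
    | succ t => simp [lineForms, LineConfig.form, standardLines]

theorem locus_prod_injective {ι : Type} [Fintype ι] [DecidableEq ι] [Nontrivial ι] (Λ : LineConfig ι) :
    Function.Injective fun p : Bool × Option ι => Λ.locus (p.1 = true) p.2 := by
  rintro ⟨u, l⟩ ⟨u', l'⟩ h
  obtain ⟨h1, h2⟩ := LineConfig.locus_injective h
  exact Prod.ext (Bool.eq_iff_iff.mpr h1) h2

end Series

end

/-! ### The theorem for the given configuration of lines -/

theorem mainTheorem7 (n : ℕ) (c : Fin n → ℂ) (hc : Function.Injective c) (hc0 : ∀ i, c i ≠ 0)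
    (β : Fin (n + 2) → ℂ) (I : Set (Fin (n + 2))) (hI : I = {i | ∃ z : ℤ, β i = z})
    (k : ℕ) (hk : I.ncard = k) :
    Nonempty (DecompositionSeries (blowupPullback (Twisted (lineForms c) β))) ∧
    ∀ s : DecompositionSeries (blowupPullback (Twisted (lineForms c) β)),
      ((∃ z : ℤ, ∑ i, β i = z) →
        s.length = 2 * (k + 1) ∧
        (∃! j, s.supp j = Set.univ) ∧
        (∃! j, s.supp j = excDivisor) ∧
        (∀ i ∈ I, ∃! j, s.supp j = properTransform (lineForms c i)) ∧
        (∀ i ∈ I, ∃! j, s.supp j = properTransform (lineForms c i) ∩ excDivisor) ∧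
        (∀ j, s.supp j = Set.univ ∨ s.supp j = excDivisor ∨
          (∃ i ∈ I, s.supp j = properTransform (lineForms c i)) ∨
          (∃ i ∈ I, s.supp j = properTransform (lineForms c i) ∩ excDivisor))) ∧
      ((¬ ∃ z : ℤ, ∑ i, β i = z) →
        s.length = k + 1 ∧
        (∃! j, s.supp j = Set.univ) ∧
        (∀ i ∈ I, ∃! j, s.supp j = properTransform (lineForms c i)) ∧
        (∀ j, s.supp j = Set.univ ∨
          (∃ i ∈ I, s.supp j = properTransform (lineForms c i)))) := by
  classical
  rw [lineForms_eq_form c hc hc0]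
  set Λ := standardLines c hc hc0
  have hmemI : ∀ t, t ∈ I ↔ ∃ z : ℤ, β t = z := fun t => by rw [hI]; rfl
  set T : Finset (Fin (n + 2)) := Finset.univ.filter fun t => t ∉ I with hTdef
  have hmemT : ∀ t, t ∈ Tᶜ ↔ t ∈ I := fun t => by simp [hTdef]
  have hcard : (Finset.insertNone Tᶜ).card = k + 1 := by
    rw [Finset.card_insertNone, ← hk, ← Set.ncard_coe_finset]
    congr 2
    ext t
    exact hmemT t
  -- The integers by which the generator is shifted: all of `β_t` for integral exponents, nothing
  -- for `t ∈ T`.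
  have hex : ∀ t, ∃ n : ℤ, (t ∈ T → n = 0) ∧ (t ∉ T → β t = n) := fun t => by
    by_cases ht : t ∈ T
    · exact ⟨0, fun _ => rfl, fun h => absurd ht h⟩
    · obtain ⟨z, hz⟩ := (hmemI t).mp ((hmemT t).mp (Finset.mem_compl.mpr ht))
      exact ⟨z, fun h => absurd h ht, fun _ => hz⟩
  choose ν hν0 hν using hex
  have hT : ∀ t ∈ T, ∀ z : ℤ, β t ≠ z := fun t ht z hz =>
    Finset.mem_compl.mp ((hmemT t).mpr ((hmemI t).mpr ⟨z, hz⟩)) ht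
  by_cases hβ : ∃ z : ℤ, ∑ i, β i = z
  · obtain ⟨z, hz⟩ := hβ
    have h := (Λ.pullbackModel β z ν T hT hν0 hν).hasFactors_of_eq_zero (by
      change ∑ t, β t - z = 0
      rw [hz, sub_self])
    refine ⟨h.nonempty_decompositionSeries, fun s => ⟨fun _ => ?_, fun h => absurd ⟨z, hz⟩ h⟩⟩
    -- The Boolean records whether the support is confined to `E`, the option which line it is
    -- confined to; both blocks of factors are then indexed by one product.
    have hs : Finset.univ.val.map s.supp =
        ((Finset.univ : Finset Bool) ×ˢ Finset.insertNone Tᶜ).val.map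
          fun p => Λ.locus (p.1 = true) p.2 := by
      rw [s.map_supp h, Finset.product_val]
      change _ = Multiset.map _ ((({true, false} : Multiset Bool)) ×ˢ _)
      rw [Multiset.insert_eq_cons, Multiset.cons_product, ← Multiset.cons_zero, Multiset.cons_product]
      simp [Multiset.map_map, add_comm]
      rfl
    obtain ⟨h1, h2, h3⟩ := s.supp_of_map_eq (locus_prod_injective Λ) hs
    have hW : ∀ (u : Bool) (l : Option (Fin (n + 2))),
        (u, l) ∈ (Finset.univ : Finset Bool) ×ˢ Finset.insertNone Tᶜ ↔ ∀ t ∈ l, t ∈ I :=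
      fun u l => by simp only [Finset.mem_product, Finset.mem_univ, true_and,
        Finset.mem_insertNone, hmemT]
    rw [Finset.card_product, hcard, Finset.card_univ, Fintype.card_bool] at h1
    refine ⟨h1, ?_, ?_, fun i hi => ?_, fun i hi => ?_, fun j => ?_⟩
    · simpa [Λ.locus_false_none] using h2 (false, none) ((hW _ _).mpr (by simp))
    · simpa [Λ.locus_true_none] using h2 (true, none) ((hW _ _).mpr (by simp))
    · simpa [Λ.locus_false_some] using h2 (false, some i) ((hW _ _).mpr (by simpa using hi))
    · simpa [Λ.locus_true_some] using h2 (true, some i) ((hW _ _).mpr (by simpa using hi))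
    · obtain ⟨⟨u, l⟩, hw, hj⟩ := h3 j
      rw [hW] at hw
      rcases u, l with ⟨- | -, - | t⟩
      · exact Or.inl (by simpa [Λ.locus_false_none] using hj)
      · exact Or.inr (Or.inr (Or.inl ⟨t, hw t rfl, by simpa [Λ.locus_false_some] using hj⟩))
      · exact Or.inr (Or.inl (by simpa [Λ.locus_true_none] using hj))
      · exact Or.inr (Or.inr (Or.inr ⟨t, hw t rfl, by simpa [Λ.locus_true_some] using hj⟩))
  -- No shift along `E` is made here, so `z = 0` and `γ = |β|`.
  · have hγ : ∀ z : ℤ, ∑ t, β t - (0 : ℤ) ≠ z := fun z hz =>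
      hβ ⟨z, by rwa [Int.cast_zero, sub_zero] at hz⟩
    have h := (Λ.pullbackModel β 0 ν T hT hν0 hν).hasFactors_of_ne hγ
    refine ⟨h.nonempty_decompositionSeries, fun s => ⟨fun h => absurd h hβ, fun _ => ?_⟩⟩
    have hinj : Function.Injective (Λ.locus False) := fun _ _ h =>
      (LineConfig.locus_injective h).2
    obtain ⟨h1, h2, h3⟩ := s.supp_of_map_eq hinj (s.map_supp h)
    have hW : ∀ l : Option (Fin (n + 2)), l ∈ Finset.insertNone Tᶜ ↔ ∀ t ∈ l, t ∈ I :=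
      fun l => by simp only [Finset.mem_insertNone, hmemT]
    refine ⟨h1.trans hcard, ?_, fun i hi => ?_, fun j => ?_⟩
    · rw [← Λ.locus_false_none]
      exact h2 none ((hW _).mpr (by simp))
    · rw [← Λ.locus_false_some]
      exact h2 (some i) ((hW _).mpr (by simpa using hi))
    · obtain ⟨- | t, hw, hj⟩ := h3 j
      · exact Or.inl (hj.trans Λ.locus_false_none)
      · exact Or.inr ⟨t, (hW _).mp hw t rfl, hj.trans (Λ.locus_false_some t)⟩
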